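/- Let $p>3$ be a prime. Let $M_1=\langle\rho,\sigma,\tau\mid\rho^p=\sigma^p=\tau^p=1,\ \sigma\rho=\rho\sigma,\ \tau\rho=\rho\tau,\ \tau\sigma=\rho\sigma\tau\rangle$ be the Heisenberg group of order $p^3$. A skew brace is a set $B$ with two group structures $\oplus,\odot$ such that $a\odot(b\oplus c)=(a\odot b)\ominus a\oplus(a\odot c)$. It is a $G$-skew brace of type $N$ if $(B,\odot)\cong G$ and $(B,\oplus)\cong N$. Put $\lambda_a(b)=\ominus a\oplus(a\odot b)$ and let $|\varTheta|$ denote the number of distinct maps $\lambda_a$ with $a\in B$. A regular subgroup $H$ of $\mathrm{Hol}(N)=N\rtimes\mathrm{Aut}(N)$ (acting on $N$ by $(\eta\alpha)(x)=\eta\,\alpha(x)$) gives a skew brace of type $N$ by identifying $H$ with $N$ through $g\mapsto g(1)$; its automorphisms are automorphisms of $N$, and $|\varTheta|$ is the order of the image of $H$ in $\mathrm{Aut}(N)$. Let $\alpha_1,\alpha_2,\alpha_3\in\mathrm{Aut}(M_1)$ be given by $\alpha_1:\sigma\mapsto\rho\sigma,\ \tau\mapsto\tau$; $\alpha_2:\sigma\mapsto\sigma\tau,\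 \tau\mapsto\tau$; $\alpha_3:\sigma\mapsto\sigma,\ \tau\mapsto\rho\tau$. Regard $\begin{pmatrix}a&b\\c&d\end{pmatrix}\in\mathrm{GL}_2(\mathbb F_p)$ as the automorphism $\sigma\mapsto\rho^{ac/2}\sigma^a\tau^c$, $\tau\mapsto\rho^{bd/2}\sigma^b\tau^d$ of $M_1$. All parameters below lie in $\mathbb F_p$. Consider the subgroups of $\mathrm{Hol}(M_1)$ $$A_{u_2,u_3}=\langle\rho,\sigma\alpha_1,\sigma^{u_2}\tau^{u_3}\alpha_3\rangle,\quad B_{v_2}=\langle\rho,\tau^{-v_2}\alpha_1,\sigma^{v_2}\alpha_3\rangle,\quad C_{x_3,a}=\langle\rho,\tau^{x_3}\alpha_1,\sigma\alpha_2\alpha_3^{a}\rangle .$$ (1) Up to isomorphism there are exactly $(2p-3)p$ $M_1$-skew braces of type $M_1$ with $|\varTheta|=p^2$. They are given by the following subgroups, which are regular, isomorphic to $M_1$, have image of order $p^2$ in $\mathrm{Aut}(M_1)$, and give pairwise non-isomorphic skew braces: $A_{u_2,u_3}$ with $u_3\ne0$, $u_2\neq u_3$; $B_{v_2}$ with $v_2\ne0,2$;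 $C_{x_3,a}$ with $x_3\neq0$, $ax_3\ne1+x_3$. (2) Up to isomorphism there are exactly $2p-1$ $C_p^3$-skew braces of type $M_1$ with $|\varTheta|=p^2$. They are given by the following subgroups, which are regular, isomorphic to $C_p^3$, have image of order $p^2$ in $\mathrm{Aut}(M_1)$, and give pairwise non-isomorphic skew braces: $A_{u,u}$ with $u\ne0$; $B_2$; $C_{x_3,a}$ with $x_3\ne0$, $ax_3=1+x_3$. (3) The automorphism groups of the skew braces, as sets of elements of $\mathrm{Aut}(M_1)$, are as follows. For $A_{u_2,u_3}$ with $u_3\ne0$: all $\alpha_1^{r_1}\alpha_3^{r_3}\begin{pmatrix}b_1&b_2\\-b_2u_3&b_1+b_2u_2\end{pmatrix}$ with invertible matrix. The order is $(p-1)p^3$ if $u_2^2-4u_3=0$, $(p-1)^2p^2$ if $u_2^2-4u_3$ is a nonzero square, and $(p^2-1)p^2$ if $u_2^2-4u_3$ is not a square. For $B_{v_2}$ with $v_2\ne0$: all of $\mathrm{Aut}(M_1)$, which consists of the elements $\alpha_1^{r_1}\alpha_3^{r_3}\beta$ with $\beta\in\mathrm{GL}_2(\mathbb F_p)$ and has order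 $(p^2-1)(p^2-p)p^2$. For $C_{x_3,a}$ with $x_3\ne0$: all $\alpha_1^{r_1}\alpha_3^{r_3}\begin{pmatrix}b_1&0\\b_3&b_1^2\end{pmatrix}$ with $b_1\neq0$ and $r_3=(a+x_3^{-1})b_1^{-1}b_3+\tfrac12(b_1-1)(1+a-x_3^{-1})$. The order is $(p-1)p^2$. (4) Let $L/K$ be a finite Galois extension of fields with group $G$. A Hopf-Galois structure on $L/K$ is a finite-dimensional cocommutative $K$-Hopf algebra $H$ acting on $L$, making $L$ an $H$-module algebra, such that $L\otimes_KH\to\mathrm{End}_K(L)$, $x\otimes h\mapsto(z\mapsto x\,h(z))$, is bijective; such structures are counted up to isomorphism of Hopf algebras compatible with the actions on $L$. A regular subgroup $N\subseteq\mathrm{Perm}(G)$ normalised by left translations gives the Hopf-Galois structure $L[N]^G$ (acting by $(\sum_n c_nn)\cdot x=\sum_n c_n\,n^{-1}(1)(x)$), which is said to be of type $N$. The skew brace attached to it is $G$ with its own multiplication as $\odot$ and with the group structure of $N$ carried over along $n\mapsto n(1)$ as $\oplus$; $|\varTheta|$ refers to this skew brace. If $G\cong M_1$, there are exactly $(p^4-p^3-2p^2+2p+1)p$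 Hopf-Galois structures of type $M_1$ on $L/K$ with $|\varTheta|=p^2$. If $G\cong C_p^3$, there are exactly $(p^3-1)(p^2-2)p^2$ of them. -/

import Mathlib

open scoped TensorProduct

universe u v w

/-! ### Skew braces -/

/-- A skew (left) brace: `+` and `*` are group structures (neither needs to be commutative) with
`a * (b + c) = a * b - a + a * c`. -/
class SkewBrace (B : Type u) extends AddGroup B, Group B where
  brace_property : ∀ a b c : B, a * (b + c) = a * b - a + a * c

namespace SkewBrace

/-- The map `λ_a : b ↦ -a + a * b` of a skew brace. -/
def lam {B : Type u} [SkewBrace B] (a : B) : B → B := fun b => -a + a * b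

/-- The number `|Θ|`: the size of the image of the multiplicative group in the automorphism group
of the additive group under `a ↦ λ_a`. -/
noncomputable def thetaCard (B : Type u) [SkewBrace B] : ℕ :=
  Nat.card (Set.range (lam : B → B → B))

/-- `B` is a `G`-skew brace of type `N` with `|Θ| = r`. -/
def IsBraceOf (G : Type v) (N : Type w) [Group G] [Group N] (r : ℕ) (B : Type u) [SkewBrace B] :
    Prop :=
  Nonempty (B ≃* G) ∧ Nonempty (B ≃+ Additive N) ∧ thetaCard B = r

/-- A skew brace bundled with its underlying set. -/
structure Bundled where
  carrier : Type u
  [inst : SkewBrace carrier]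

attribute [instance] Bundled.inst

/-- Isomorphism of skew braces. (`B ≃+* C` is Mathlib's type of bijections `B → C` that preserve
`+` and `*`; no ring structure is involved.) -/
instance isoSetoid : Setoid Bundled.{u} where
  r B C := Nonempty (B.carrier ≃+* C.carrier)
  iseqv :=
    { refl := fun _ => ⟨RingEquiv.refl _⟩
      symm := fun ⟨e⟩ => ⟨e.symm⟩
      trans := fun ⟨e⟩ ⟨f⟩ => ⟨e.trans f⟩ }

/-- The number of isomorphism classes of `G`-skew braces of type `N` with `|Θ| = r`. -/
noncomputable def numClasses (G : Type v) (N : Type w) [Group G] [Group N] (r : ℕ) : ℕ :=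
  Nat.card {q : Quotient isoSetoid.{u} //
    ∃ B : Bundled.{u}, Quotient.mk isoSetoid B = q ∧ IsBraceOf G N r B.carrier}

end SkewBrace

/-! ### The holomorph and its regular subgroups -/

/-- The holomorph `N ⋊ Aut N`. -/
abbrev Hol (N : Type u) [Group N] : Type u := N ⋊[MonoidHom.id (MulAut N)] MulAut N

namespace Hol

variable {N : Type u} [Group N]

/-- The element `η α` of the holomorph acts on `N` by `x ↦ η * α x`. -/
def act (g : Hol N) (x : N) : N := g.left * g.right x

theorem act_mul (g h : Hol N) (x : N) : act (g * h) x = act g (act h x) := by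
  simp [act, mul_assoc]

theorem act_one (x : N) : act (1 : Hol N) x = x := by simp [act]

/-- A subgroup of the holomorph is regular if it acts simply transitively on `N`. -/
def IsRegular (H : Subgroup (Hol N)) : Prop := ∀ x y : N, ∃! g : Hol N, g ∈ H ∧ act g x = y

/-- The natural projection `Hol N → Aut N`. -/
def Theta (N : Type u) [Group N] : Hol N →* MulAut N := SemidirectProduct.rightHom

/-- The underlying set of the skew brace of a regular subgroup `H` of the holomorph of `N`;
the bijection `g ↦ g(1)` identifies `H` with `N`. -/
def Brace (H : Subgroup (Hol N)) (_hH : IsRegular H) : Type u := N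

namespace Brace

/-- The identification of `N` with the underlying set of the skew brace. -/
def of (H : Subgroup (Hol N)) (hH : IsRegular H) : N ≃ Brace H hH := Equiv.refl N

variable (H : Subgroup (Hol N)) (hH : IsRegular H)

/-- The unique element of `H` that maps `1` to `a`. -/
noncomputable def elt (a : N) : Hol N := (hH 1 a).choose

theorem elt_mem (a : N) : elt H hH a ∈ H := (hH 1 a).choose_spec.1.1

theorem act_elt (a : N) : act (elt H hH a) 1 = a := (hH 1 a).choose_spec.1.2

theorem eq_elt {a : N} {g : Hol N} (hg : g ∈ H) (h : act g 1 = a) : g = elt H hH a :=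
  (hH 1 a).choose_spec.2 g ⟨hg, h⟩

theorem elt_left (a : N) : (elt H hH a).left = a := by
  have := act_elt H hH a
  simpa [act] using this

/-- The additive group of the skew brace is `N`. -/
instance : AddGroup (Brace H hH) := inferInstanceAs (AddGroup (Additive N))

theorem elt_act (a b : N) : elt H hH (act (elt H hH a) b) = elt H hH a * elt H hH b := by
  refine (eq_elt H hH (mul_mem (elt_mem H hH a) (elt_mem H hH b)) ?_).symm
  rw [act_mul, act_elt]

theorem mul_assoc_aux (a b c : N) : act (elt H hH (act (elt H hH a) b)) c =
    act (elt H hH a) (act (elt H hH b) c) := by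
  rw [elt_act, act_mul]

theorem one_mul_aux (a : N) : act (elt H hH 1) a = a := by
  rw [← eq_elt H hH (one_mem H) (act_one 1), act_one]

theorem inv_mul_aux (a : N) : act (elt H hH (act (elt H hH a)⁻¹ 1)) a = 1 := by
  rw [← eq_elt H hH (inv_mem (elt_mem H hH a)) rfl]
  nth_rewrite 2 [← act_elt H hH a]
  rw [← act_mul, inv_mul_cancel, act_one]

theorem brace_aux (a b c : N) : act (elt H hH a) (b * c) =
    act (elt H hH a) b / a * act (elt H hH a) c := by
  simp [act, elt_left, div_eq_mul_inv, mul_assoc]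

/-- The multiplicative group of the skew brace is `H`, carried over to `N` along `g ↦ g(1)`. -/
noncomputable instance : Group (Brace H hH) :=
  letI : Mul (Brace H hH) :=
    ⟨fun a b => of H hH (act (elt H hH ((of H hH).symm a)) ((of H hH).symm b))⟩
  letI : One (Brace H hH) := ⟨of H hH 1⟩
  letI : Inv (Brace H hH) := ⟨fun a => of H hH (act (elt H hH ((of H hH).symm a))⁻¹ 1)⟩
  Group.ofLeftAxioms (mul_assoc_aux H hH) (one_mul_aux H hH) (inv_mul_aux H hH)

noncomputable instance : SkewBrace (Brace H hH) where
  brace_property := brace_aux H hH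

end Brace

end Hol

/-! ### The group `M₁` and its automorphisms -/

/-- The Heisenberg group of order `p³`: `⟨a, b, c⟩` stands for `ρ ^ a * σ ^ b * τ ^ c`, and the
multiplication is the one forced by `ρ` central and `τ * σ = ρ * σ * τ`. -/
@[ext]
structure Heis (p : ℕ) where
  a : ZMod p
  b : ZMod p
  c : ZMod p

namespace Heis

variable {p : ℕ}

instance : Mul (Heis p) := ⟨fun x y => ⟨x.a + y.a + x.c * y.b, x.b + y.b, x.c + y.c⟩⟩
instance : One (Heis p) := ⟨⟨0, 0, 0⟩⟩
instance : Inv (Heis p) := ⟨fun x => ⟨-x.a + x.c * x.b, -x.b, -x.c⟩⟩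

@[simp] theorem mul_a (x y : Heis p) : (x * y).a = x.a + y.a + x.c * y.b := rfl
@[simp] theorem mul_b (x y : Heis p) : (x * y).b = x.b + y.b := rfl
@[simp] theorem mul_c (x y : Heis p) : (x * y).c = x.c + y.c := rfl
@[simp] theorem one_a : (1 : Heis p).a = 0 := rfl
@[simp] theorem one_b : (1 : Heis p).b = 0 := rfl
@[simp] theorem one_c : (1 : Heis p).c = 0 := rfl
@[simp] theorem inv_a (x : Heis p) : (x⁻¹).a = -x.a + x.c * x.b := rfl
@[simp] theorem inv_b (x : Heis p) : (x⁻¹).b = -x.b := rfl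
@[simp] theorem inv_c (x : Heis p) : (x⁻¹).c = -x.c := rfl

instance : Group (Heis p) :=
  Group.ofLeftAxioms (fun x y z => by ext <;> simp <;> ring) (fun x => by ext <;> simp)
    (fun x => by ext <;> simp)

variable (p) in
def rho : Heis p := ⟨1, 0, 0⟩
variable (p) in
def sigma : Heis p := ⟨0, 1, 0⟩
variable (p) in
def tau : Heis p := ⟨0, 0, 1⟩

theorem sigma_rho : sigma p * rho p = rho p * sigma p := by ext <;> simp [sigma, rho]
theorem tau_rho : tau p * rho p = rho p * tau p := by ext <;> simp [tau, rho]
theorem tau_sigma : tau p * sigma p = rho p * sigma p * tau p := by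
  ext <;> simp [sigma, tau, rho]

theorem rho_pow (n : ℕ) : rho p ^ n = ⟨n, 0, 0⟩ := by
  induction n with
  | zero => ext <;> simp
  | succ n ih => rw [pow_succ, ih]; ext <;> simp [rho]
theorem sigma_pow (n : ℕ) : sigma p ^ n = ⟨0, n, 0⟩ := by
  induction n with
  | zero => ext <;> simp
  | succ n ih => rw [pow_succ, ih]; ext <;> simp [sigma]
theorem tau_pow (n : ℕ) : tau p ^ n = ⟨0, 0, n⟩ := by
  induction n with
  | zero => ext <;> simp
  | succ n ih => rw [pow_succ, ih]; ext <;> simp [tau]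

theorem rho_pow_p : rho p ^ p = 1 := by rw [rho_pow]; ext <;> simp
theorem sigma_pow_p : sigma p ^ p = 1 := by rw [sigma_pow]; ext <;> simp
theorem tau_pow_p : tau p ^ p = 1 := by rw [tau_pow]; ext <;> simp

/-- The three generators generate the group, by the normal form `ρ ^ a * σ ^ b * τ ^ c`. -/
theorem normal_form [NeZero p] (x : Heis p) :
    x = rho p ^ x.a.val * sigma p ^ x.b.val * tau p ^ x.c.val := by
  rw [rho_pow, sigma_pow, tau_pow]; ext <;> simp

variable (p) in
theorem card_heis : Nat.card (Heis p) = p ^ 3 := by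
  let e : Heis p ≃ ZMod p × ZMod p × ZMod p :=
    { toFun := fun x => (x.a, x.b, x.c)
      invFun := fun y => ⟨y.1, y.2.1, y.2.2⟩
      left_inv := fun _ => rfl
      right_inv := fun _ => rfl }
  rw [Nat.card_congr e, Nat.card_prod, Nat.card_prod, Nat.card_zmod]
  ring

variable (p) in
/-- The automorphism `α₁`: `σ ↦ ρ * σ`, `τ ↦ τ`. -/
def alpha1 : MulAut (Heis p) where
  toFun x := ⟨x.a + x.b, x.b, x.c⟩
  invFun x := ⟨x.a - x.b, x.b, x.c⟩
  left_inv x := by ext <;> simp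
  right_inv x := by ext <;> simp
  map_mul' x y := by ext <;> simp; ring

variable (p) in
/-- The automorphism `α₃`: `σ ↦ σ`, `τ ↦ ρ * τ`. -/
def alpha3 : MulAut (Heis p) where
  toFun x := ⟨x.a + x.c, x.b, x.c⟩
  invFun x := ⟨x.a - x.c, x.b, x.c⟩
  left_inv x := by ext <;> simp
  right_inv x := by ext <;> simp
  map_mul' x y := by ext <;> simp; ring

variable [Fact p.Prime]

/-- The map `σ ↦ ρ ^ (ac/2) * σ ^ a * τ ^ c`, `τ ↦ ρ ^ (bd/2) * σ ^ b * τ ^ d`, `ρ ↦ ρ ^ (ad - bc)`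
attached to the matrix with rows `(a, b)` and `(c, d)`, on `ρ ^ x * σ ^ y * τ ^ z`. -/
def lin (A : Matrix (Fin 2) (Fin 2) (ZMod p)) (x : Heis p) : Heis p :=
  ⟨A.det * x.a + (A 0 0 * A 1 0 * x.b ^ 2 + A 0 1 * A 1 1 * x.c ^ 2) / 2 +
      A 0 1 * A 1 0 * x.b * x.c,
    A 0 0 * x.b + A 0 1 * x.c, A 1 0 * x.b + A 1 1 * x.c⟩

theorem lin_one (x : Heis p) : lin 1 x = x := by ext <;> simp [lin]

variable [Fact (3 < p)]

theorem two_ne_zero' : (2 : ZMod p) ≠ 0 := by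
  have h3 : 3 < p := Fact.out
  intro h
  have : ((2 : ℕ) : ZMod p) = 0 := by exact_mod_cast h
  rw [ZMod.natCast_eq_zero_iff] at this
  have := Nat.le_of_dvd (by norm_num) this
  omega

variable (p) in
/-- The automorphism `α₂`: `σ ↦ σ * τ`, `τ ↦ τ`. -/
def alpha2 : MulAut (Heis p) where
  toFun x := ⟨x.a + x.b * (x.b - 1) / 2, x.b, x.c + x.b⟩
  invFun x := ⟨x.a - x.b * (x.b - 1) / 2, x.b, x.c - x.b⟩
  left_inv x := by ext <;> simp
  right_inv x := by ext <;> simp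
  map_mul' x y := by
    have := two_ne_zero' (p := p)
    ext <;> simp
    · field_simp; ring
    · ring

theorem lin_lin (A B : Matrix (Fin 2) (Fin 2) (ZMod p)) (x : Heis p) :
    lin A (lin B x) = lin (A * B) x := by
  have := two_ne_zero' (p := p)
  ext <;> simp [lin, Matrix.det_fin_two, Matrix.mul_apply, Fin.sum_univ_two]
  · field_simp; ring
  · ring
  · ring

theorem lin_mul (A : Matrix (Fin 2) (Fin 2) (ZMod p)) (x y : Heis p) :
    lin A (x * y) = lin A x * lin A y := by
  have := two_ne_zero' (p := p)
  ext <;> simp [lin, Matrix.det_fin_two]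
  · field_simp; ring
  · ring
  · ring

/-- The automorphism attached to an invertible matrix. -/
noncomputable def autGL (A : GL (Fin 2) (ZMod p)) : MulAut (Heis p) where
  toFun := lin (A : Matrix (Fin 2) (Fin 2) (ZMod p))
  invFun := lin ((A⁻¹ : GL (Fin 2) (ZMod p)) : Matrix (Fin 2) (Fin 2) (ZMod p))
  left_inv x := by rw [lin_lin, ← Units.val_mul, inv_mul_cancel, Units.val_one, lin_one]
  right_inv x := by rw [lin_lin, ← Units.val_mul, mul_inv_cancel, Units.val_one, lin_one]
  map_mul' := lin_mul _

/-- The element `η α` of the holomorph. -/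
def hol (η : Heis p) (α : MulAut (Heis p)) : Hol (Heis p) := ⟨η, α⟩

/-- Parameters for the three families of subgroups of the holomorph. -/
inductive Param (p : ℕ) where
  | A (u₂ u₃ : ZMod p)
  | B (v₂ : ZMod p)
  | C (x₃ a : ZMod p)

/-- The subgroups `⟨ρ, σα₁, σ^u₂ τ^u₃ α₃⟩`, `⟨ρ, τ^(-v₂) α₁, σ^v₂ α₃⟩` and
`⟨ρ, τ^x₃ α₁, σ α₂ α₃^a⟩`. -/
def Param.subgroup : Param p → Subgroup (Hol (Heis p))
  | .A u₂ u₃ => Subgroup.closure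
      {hol (rho p) 1, hol (sigma p) (alpha1 p),
        hol (sigma p ^ u₂.val * tau p ^ u₃.val) (alpha3 p)}
  | .B v₂ => Subgroup.closure
      {hol (rho p) 1, hol ((tau p ^ v₂.val)⁻¹) (alpha1 p), hol (sigma p ^ v₂.val) (alpha3 p)}
  | .C x₃ a => Subgroup.closure
      {hol (rho p) 1, hol (tau p ^ x₃.val) (alpha1 p),
        hol (sigma p) (alpha2 p * alpha3 p ^ a.val)}

/-- The parameters of the `M₁`-skew braces. -/
def Param.IsHeis : Param p → Prop
  | .A u₂ u₃ => u₃ ≠ 0 ∧ u₂ ≠ u₃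
  | .B v₂ => v₂ ≠ 0 ∧ v₂ ≠ 2
  | .C x₃ a => x₃ ≠ 0 ∧ a * x₃ ≠ 1 + x₃

/-- The parameters of the `C_p³`-skew braces. -/
def Param.IsElem : Param p → Prop
  | .A u₂ u₃ => u₃ ≠ 0 ∧ u₂ = u₃
  | .B v₂ => v₂ = 2
  | .C x₃ a => x₃ ≠ 0 ∧ a * x₃ = 1 + x₃

/-- `α ∈ Aut(N)` is an automorphism of the skew brace of the regular subgroup `H`. -/
def IsBraceAut {H : Subgroup (Hol (Heis p))} (hH : Hol.IsRegular H) (α : MulAut (Heis p)) : Prop :=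
  ∃ φ : RingAut (Hol.Brace H hH), ∀ x, φ (Hol.Brace.of H hH x) = Hol.Brace.of H hH (α x)

end Heis

/-- The elementary abelian group `C_p³`. -/
abbrev ElemAb3 (p : ℕ) : Type := Fin 3 → Multiplicative (ZMod p)

/-! ### Hopf-Galois structures -/

/-- A Hopf-Galois structure on `L/K`: a finite-dimensional cocommutative `K`-Hopf algebra `H` with
an action on `L` that makes `L` an `H`-module algebra and for which
`L ⊗ H → End_K(L)`, `x ⊗ h ↦ (z ↦ x * h(z))`, is bijective. -/
structure HopfGaloisStructure (K : Type u) (L : Type v) [Field K] [Field L] [Algebra K L] where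
  H : Type v
  [ring : Ring H]
  [hopf : HopfAlgebra K H]
  [finite : Module.Finite K H]
  [cocomm : Coalgebra.IsCocomm K H]
  /-- the action of `H` on `L` -/
  act : H →ₐ[K] Module.End K L
  act_one : ∀ h : H, act h 1 = algebraMap K L (Coalgebra.counit (R := K) h)
  act_mul : ∀ (h : H) (x y : L), act h (x * y) =
    LinearMap.mul' K L (TensorProduct.map (act.toLinearMap.flip x) (act.toLinearMap.flip y)
      (Coalgebra.comul (R := K) h))
  galois : Function.Bijective (TensorProduct.lift
    ((LinearMap.mul K (Module.End K L)).compl₁₂ (Algebra.lmul K L).toLinearMap act.toLinearMap))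

namespace HopfGaloisStructure

attribute [instance] ring hopf finite cocomm

variable (K : Type u) (L : Type v) [Field K] [Field L] [Algebra K L]

/-- Two Hopf-Galois structures are identified if there is an isomorphism of Hopf algebras that is
compatible with the actions on `L`. -/
instance isoSetoid : Setoid (HopfGaloisStructure K L) where
  r S T := ∃ e : S.H ≃ₐc[K] T.H, ∀ h, T.act (e h) = S.act h
  iseqv :=
    { refl := fun S => ⟨BialgEquiv.refl K S.H, fun _ => rfl⟩
      symm := fun {S T} ⟨e, he⟩ => ⟨e.symm, fun h => by
        rw [← he (e.symm h), BialgEquiv.apply_symm_apply]⟩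
      trans := fun {S T U} ⟨e, he⟩ ⟨f, hf⟩ => ⟨e.trans f, fun h => by
        rw [← he, ← hf]; rfl⟩ }

end HopfGaloisStructure

/-- A subgroup of `Perm(G)` is regular and normalised by the left translations of `G`. -/
structure IsRegularNormalised {G : Type u} [Group G] (M : Subgroup (Equiv.Perm G)) : Prop where
  regular : ∀ x y : G, ∃! n : Equiv.Perm G, n ∈ M ∧ n x = y
  normalised : ∀ (g : G), ∀ n ∈ M, Equiv.mulLeft g * n * (Equiv.mulLeft g)⁻¹ ∈ M

namespace IsRegularNormalised

variable {G : Type u} [Group G] {M : Subgroup (Equiv.Perm G)}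

/-- Conjugation by a left translation, as a map `M → M`. -/
def conj (hM : IsRegularNormalised M) (g : G) (n : M) : M :=
  ⟨Equiv.mulLeft g * n * (Equiv.mulLeft g)⁻¹, hM.normalised g n n.2⟩

/-- The underlying set, which is `G`, of the skew brace of a regular subgroup of `Perm(G)`
normalised by left translations. -/
def Brace (_hM : IsRegularNormalised M) : Type u := G

variable (hM : IsRegularNormalised M)

/-- The multiplicative group of the skew brace is `G`. -/
instance : Group hM.Brace := inferInstanceAs (Group G)

/-- The unique element of `M` that maps `1` to `a`. -/
noncomputable def elt (a : G) : Equiv.Perm G := (hM.regular 1 a).choose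

theorem elt_mem (a : G) : hM.elt a ∈ M := (hM.regular 1 a).choose_spec.1.1

theorem elt_one (a : G) : hM.elt a 1 = a := (hM.regular 1 a).choose_spec.1.2

theorem eq_elt {a : G} {n : Equiv.Perm G} (hn : n ∈ M) (h : n 1 = a) : n = hM.elt a :=
  (hM.regular 1 a).choose_spec.2 n ⟨hn, h⟩

theorem elt_elt (a b : G) : hM.elt (hM.elt a b) = hM.elt a * hM.elt b := by
  refine (hM.eq_elt (mul_mem (hM.elt_mem a) (hM.elt_mem b)) ?_).symm
  rw [Equiv.Perm.mul_apply, hM.elt_one]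

theorem add_assoc_aux (a b c : G) : hM.elt (hM.elt a b) c = hM.elt a (hM.elt b c) := by
  rw [elt_elt, Equiv.Perm.mul_apply]

theorem zero_add_aux (a : G) : hM.elt 1 a = a := by
  rw [← hM.eq_elt (one_mem M) (Equiv.Perm.one_apply 1), Equiv.Perm.one_apply]

theorem elt_inv (a : G) : hM.elt ((hM.elt a)⁻¹ 1) = (hM.elt a)⁻¹ :=
  (hM.eq_elt (inv_mem (hM.elt_mem a)) rfl).symm

theorem neg_add_aux (a : G) : hM.elt ((hM.elt a)⁻¹ 1) a = 1 := by
  rw [elt_inv, Equiv.Perm.inv_eq_iff_eq, hM.elt_one]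

theorem brace_aux (x y z : G) :
    x * hM.elt y z = hM.elt (hM.elt (x * y) ((hM.elt x)⁻¹ 1)) (x * z) := by
  have h : hM.elt (x * y) = Equiv.mulLeft x * hM.elt y * (Equiv.mulLeft x)⁻¹ * hM.elt x := by
    refine (hM.eq_elt (mul_mem (hM.normalised x _ (hM.elt_mem y)) (hM.elt_mem x)) ?_).symm
    simp [hM.elt_one]
  rw [elt_elt, elt_inv, h]
  simp

/-- The additive group of the skew brace is `M`, carried over to `G` along `n ↦ n(1)`. -/
noncomputable instance : AddGroup hM.Brace :=
  letI : Add hM.Brace := ⟨fun a b => hM.elt a b⟩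
  letI : Zero hM.Brace := ⟨(1 : G)⟩
  letI : Neg hM.Brace := ⟨fun a => (hM.elt a)⁻¹ (1 : G)⟩
  AddGroup.ofLeftAxioms hM.add_assoc_aux hM.zero_add_aux hM.neg_add_aux

noncomputable instance : SkewBrace hM.Brace where
  brace_property a b c := (hM.brace_aux a b c).trans (by rw [sub_eq_add_neg]; rfl)

end IsRegularNormalised

namespace HopfGaloisStructure

variable {K : Type u} {L : Type v} [Field K] [Field L] [Algebra K L]

/-- The Hopf algebra `L[M]^G`, as a subset of the group algebra: `G = Gal(L/K)` acts on `L` as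
field automorphisms and on `M` by conjugation with left translations. -/
def fixedElements {M : Subgroup (Equiv.Perm (L ≃ₐ[K] L))} (hM : IsRegularNormalised M) :
    Set (MonoidAlgebra L M) :=
  {c | ∀ (g : L ≃ₐ[K] L) (n : M), c.coeff (hM.conj g n) = g (c.coeff n)}

/-- The action of an element of the group algebra on `L`: `(∑ cₙ n) · x = ∑ cₙ n⁻¹(1)(x)`. -/
noncomputable def groupAlgebraAct {M : Subgroup (Equiv.Perm (L ≃ₐ[K] L))}
    (c : MonoidAlgebra L M) (x : L) : L :=
  c.coeff.sum fun n a => a * ((n : Equiv.Perm (L ≃ₐ[K] L))⁻¹ 1) x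

/-- The Hopf-Galois structure `S` is the one given by `M`, i.e. by `L[M]^G`. Since the action on `L`
of the Hopf algebra of a Hopf-Galois structure is faithful and determines all its operations, this
is expressed by saying that the two act on `L` through the same set of operators. -/
def GivenBy (S : HopfGaloisStructure K L) {M : Subgroup (Equiv.Perm (L ≃ₐ[K] L))}
    (hM : IsRegularNormalised M) : Prop :=
  {f : L → L | ∃ h : S.H, f = S.act h} = groupAlgebraAct '' fixedElements hM

/-- The Hopf-Galois structure has type `N`, and the skew brace attached to it has `|Θ| = r`. -/
def HasType (S : HopfGaloisStructure K L) (N : Type w) [Group N] (r : ℕ) : Prop :=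
  ∃ (M : Subgroup (Equiv.Perm (L ≃ₐ[K] L))) (hM : IsRegularNormalised M),
    S.GivenBy hM ∧ Nonempty (M ≃* N) ∧ SkewBrace.thetaCard hM.Brace = r

variable (K L) in
/-- The number of Hopf-Galois structures on `L/K` of type `N` with `|Θ| = r`. -/
noncomputable def number (N : Type w) [Group N] (r : ℕ) : ℕ :=
  Nat.card {q : Quotient (isoSetoid K L) //
    ∃ S : HopfGaloisStructure K L, Quotient.mk (isoSetoid K L) S = q ∧ S.HasType N r}

end HopfGaloisStructure

/-! A skew brace with additive group N is the same as a gamma function, a map γ : N → Aut N with γ(n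
· γ(n)(m)) = γ(n)γ(m). Its graph is the regular subgroup of the holomorph, and isomorphisms of
braces are the automorphisms of N that intertwine the gamma functions
(`Hol.exists_isGamma_of_addEquiv`, `Hol.Brace.isoEquiv`). All of (1)-(3) is therefore a problem
about gamma functions on M₁.

If the image of γ has order p², it is an abelian p-group, so its elements act on M₁/Z by commuting
unipotent matrices, and after conjugation these are lower triangular (`exists_conj_unip`). Moreover
γ kills the centre (`rho_mem_ker`), so by counting it is an injection of M₁/Z = F_p² into Aut(M₁).
Then γ is given by three functions l₁, l₂, k of (b, c). If k = 0, then (l₁, l₂) is an invertible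
matrix P, that is, a nondegenerate bilinear form, and a change of basis β acts by det(β) P = βᵀ P'
β. A form that is not alternating has the normal form A, whose parameters are determined by the
invariants det P and the skew part of P; the alternating forms give B. If k ≠ 0, the functional
equations force k and l₂ to be multiples of b and l₁ to be quadratic in b and linear in c, which is
family C (`exists_intertwines_of_unip`). The multiplicative group has an explicit 2-cocycle; after
removal of a coboundary it is the alternating form times a scalar `kappa`, and the group is M₁ or
C_p³ according to whether this scalar is nonzero (`X_sub_corr_mul`).

The automorphisms of a brace are the self-intertwiners. For family A their matrices are the units of
the quadratic algebra F_p[x]/(x² - u₂x + u₃), whence the three cases for the discriminant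
(`card_norm_ne_zero`).

For (4), Galois descent shows that each regular M ≤ Perm(G) normalised by left translations gives a
Hopf-Galois structure L[M]^G (`ofRegular`). Dedekind independence of automorphisms shows that the
operators on L determine both the structure up to isomorphism and M itself (`iso_of_range_eq`,
`GivenBy.unique`). So one counts such M. The M whose brace is isomorphic to a given B number |Aut G|
/ |Aut B| (`card_mul_card_ringAut`). Summing this over the classified braces leads to elementary
sums of the quadratic character of u₂² - 4u₃. -/

set_option linter.unusedSectionVars false


/-! ### Galois descent for the fixed points of a twisted group algebra -/

namespace TwistedGroupAlgebra

open MonoidAlgebra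

section Fixed

variable {K : Type*} {L : Type*} [Field K] [Field L] [Algebra K L]
variable {S : Type*} [Group S] (φ : (L ≃ₐ[K] L) →* MulAut S)

/-- The semilinear action of a field automorphism on the group algebra. -/
noncomputable def twist (g : L ≃ₐ[K] L) : MonoidAlgebra L S →+* MonoidAlgebra L S :=
  (mapDomainRingHom L (φ g : S →* S)).comp (mapRingHom S (g : L →+* L))

theorem coeff_twist (g : L ≃ₐ[K] L) (c : MonoidAlgebra L S) (n : S) :
    (twist φ g c).coeff (φ g n) = g (c.coeff n) := by
  simp only [twist, RingHom.comp_apply, mapDomainRingHom_apply, mapDomain]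
  refine (Finsupp.mapDomain_apply (φ g).injective _ _).trans ?_
  simp

theorem twist_eq_self_iff (g : L ≃ₐ[K] L) (c : MonoidAlgebra L S) :
    twist φ g c = c ↔ ∀ n, c.coeff (φ g n) = g (c.coeff n) := by
  constructor
  · intro h n
    rw [← coeff_twist φ, h]
  · intro h
    ext n
    obtain ⟨m, rfl⟩ := (φ g).surjective n
    rw [coeff_twist, h]

/-- The twisted group algebra `L[S]^G`. -/
noncomputable def fixed : Subalgebra K (MonoidAlgebra L S) where
  carrier := {c | ∀ g n, c.coeff (φ g n) = g (c.coeff n)}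
  mul_mem' {x y} hx hy g := by
    rw [← twist_eq_self_iff, map_mul, (twist_eq_self_iff φ g x).2 (hx g),
      (twist_eq_self_iff φ g y).2 (hy g)]
  add_mem' {x y} hx hy g := by
    rw [← twist_eq_self_iff, map_add, (twist_eq_self_iff φ g x).2 (hx g),
      (twist_eq_self_iff φ g y).2 (hy g)]
  algebraMap_mem' r g := by
    rw [← twist_eq_self_iff]
    simp [twist]

theorem mem_fixed {c : MonoidAlgebra L S} :
    c ∈ fixed φ ↔ ∀ g n, c.coeff (φ g n) = g (c.coeff n) := Iff.rfl

theorem mem_fixed' {c : MonoidAlgebra L S} : c ∈ fixed φ ↔ ∀ g, twist φ g c = c := by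
  simp_rw [mem_fixed, twist_eq_self_iff]

theorem twist_smul (g : L ≃ₐ[K] L) (a : L) (c : MonoidAlgebra L S) :
    twist φ g (a • c) = g a • twist φ g c := by
  ext n
  obtain ⟨m, rfl⟩ := (φ g).surjective n
  simp [coeff_twist]

variable [FiniteDimensional K L]

/-- The trace of `a • n`. -/
noncomputable def traceElt (a : L) (n : S) : MonoidAlgebra L S :=
  ∑ g : L ≃ₐ[K] L, single (φ g n) (g a)

theorem traceElt_mem (a : L) (n : S) : traceElt φ a n ∈ fixed φ := by
  rw [mem_fixed']
  intro h
  have hs : ∀ g : L ≃ₐ[K] L, twist φ h (single (φ g n) (g a)) =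
      single (φ (h * g) n) ((h * g) a) := by
    intro g
    simp [twist]
  rw [traceElt, map_sum]
  simp_rw [hs]
  exact Fintype.sum_bijective (h * ·) (Group.mulLeft_bijective h) _ _ fun _ => rfl

/-- Evaluating `f` on the trace of `a • n` gives a linear relation, valid for all `a`, between the
automorphisms g with coefficients f(φ_g(n)). By Dedekind independence all coefficients vanish, and g
= 1 gives f(n) = 0. -/
theorem eq_zero_of_forall_fixed (f : MonoidAlgebra L S →ₗ[L] L)
    (hf : ∀ c ∈ fixed φ, f c = 0) : f = 0 := by
  have key : ∀ n, f (single n 1) = 0 := by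
    intro n
    have hli := (linearIndependent_monoidHom L L).comp
      (fun g : L ≃ₐ[K] L => ((g : L →+* L) : L →* L))
      (fun g h hgh => by ext x; exact DFunLike.congr_fun hgh x)
    rw [Fintype.linearIndependent_iff] at hli
    have := hli (fun g => f (single (φ g n) 1)) (by
      ext a
      have h := hf _ (traceElt_mem φ a n)
      rw [traceElt, map_sum] at h
      simp only [Finset.sum_apply, Pi.smul_apply, Pi.zero_apply, smul_eq_mul, Function.comp]
      rw [← h]
      refine Finset.sum_congr rfl fun g _ => ?_
      have : (single (φ g n) (g a) : MonoidAlgebra L S) = g a • single (φ g n) 1 := by simp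
      rw [this, map_smul, smul_eq_mul, mul_comm]
      rfl) 1
    simpa using this
  refine (MonoidAlgebra.basis S L).ext fun n => ?_
  simpa using key n

theorem span_fixed : Submodule.span L (fixed φ : Set (MonoidAlgebra L S)) = ⊤ := by
  by_contra hne
  obtain ⟨f, hf0, hf⟩ := Submodule.exists_le_ker_of_lt_top _ (lt_top_iff_ne_top.2 hne)
  exact hf0 (eq_zero_of_forall_fixed φ f fun c hc => hf (Submodule.subset_span hc))

theorem exists_basis_fixed : ∃ (ι : Set (MonoidAlgebra L S))
    (B : Module.Basis ι L (MonoidAlgebra L S)), ∀ i, B i ∈ fixed φ := by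
  obtain ⟨b, hb, hspan, hli⟩ := exists_linearIndependent L (fixed φ : Set (MonoidAlgebra L S))
  refine ⟨b, Module.Basis.mk hli ?_, fun i => ?_⟩
  · simp [hspan, span_fixed]
  · simpa using hb i.2

/-- The semilinear action of g fixes `c` and the basis, so it can only apply g to the coordinates.
By uniqueness the coordinates are fixed by the whole Galois group. -/
theorem repr_mem_range [IsGalois K L] {ι : Type*} (B : Module.Basis ι L (MonoidAlgebra L S))
    (hB : ∀ i, B i ∈ fixed φ) {c : MonoidAlgebra L S} (hc : c ∈ fixed φ) (i : ι) :
    B.repr c i ∈ Set.range (algebraMap K L) := by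
  rw [IsGalois.mem_range_algebraMap_iff_fixed]
  intro g
  rw [mem_fixed'] at hc
  simp_rw [mem_fixed'] at hB
  have h : c = (B.repr c).sum fun i a => g a • B i := by
    conv_lhs => rw [← hc g, ← B.linearCombination_repr c]
    rw [Finsupp.linearCombination_apply, Finsupp.sum, map_sum]
    refine Finset.sum_congr rfl fun j _ => ?_
    rw [twist_smul, hB]
  have h2 : c = Finsupp.linearCombination L B ((B.repr c).mapRange g (map_zero g)) := by
    rw [Finsupp.linearCombination_apply, Finsupp.sum_mapRange_index (by simp)]
    exact h
  have h3 := congrArg B.repr h2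
  rw [B.repr_linearCombination] at h3
  conv_rhs => rw [h3]
  simp

theorem mem_span_of_fixed [IsGalois K L] {ι : Type*} (B : Module.Basis ι L (MonoidAlgebra L S))
    (hB : ∀ i, B i ∈ fixed φ) {c : MonoidAlgebra L S} (hc : c ∈ fixed φ) :
    c ∈ Submodule.span K (Set.range B) := by
  rw [← B.linearCombination_repr c, Finsupp.linearCombination_apply]
  refine Submodule.sum_mem _ fun i _ => ?_
  obtain ⟨k, hk⟩ := repr_mem_range φ B hB hc i
  dsimp only
  rw [← hk, algebraMap_smul]
  exact Submodule.smul_mem _ _ (Submodule.subset_span ⟨i, rfl⟩)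

end Fixed

/-! ### Embedding tensor products of K-forms into group algebras of products -/

section Form

variable {K : Type*} {L : Type*} [Field K] [Field L] [Algebra K L]
variable {S T A B : Type*} [Group S] [Group T] [Semiring A] [Algebra K A] [Semiring B] [Algebra K B]

/-- The homomorphism sends some finite `K`-basis to an `L`-linearly independent family. -/
def IsForm (f : A →ₐ[K] MonoidAlgebra L S) : Prop :=
  ∃ (n : ℕ) (b : Module.Basis (Fin n) K A), LinearIndependent L (f ∘ b)

theorem IsForm.of_basis {ι : Type*} [Finite ι] {f : A →ₐ[K] MonoidAlgebra L S}
    (b : Module.Basis ι K A) (h : LinearIndependent L (f ∘ b)) : IsForm f := by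
  obtain ⟨n, ⟨e⟩⟩ := Finite.exists_equiv_fin ι
  refine ⟨n, b.reindex e, ?_⟩
  have : f ∘ (b.reindex e) = (f ∘ b) ∘ e.symm := by ext; simp
  rw [this]
  exact h.comp _ e.symm.injective

theorem IsForm.injective {f : A →ₐ[K] MonoidAlgebra L S} (hf : IsForm f) :
    Function.Injective f := by
  obtain ⟨n, b, hb⟩ := hf
  have hb' : LinearIndependent K (f ∘ b) := hb.restrict_scalars' K
  have h : ∀ a, f a = Finsupp.linearCombination K (f ∘ b) (b.repr a) := fun a => by
    conv_lhs => rw [← b.linearCombination_repr a]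
    rw [Finsupp.linearCombination_apply, Finsupp.linearCombination_apply, Finsupp.sum, map_sum]
    simp [Finsupp.sum]
  intro a a' ha
  rw [h, h] at ha
  exact b.repr.injective (hb' ha)

/-- The homomorphism `x ⊗ y ↦ f x * g y` into the group algebra of the product group. -/
noncomputable def tens (f : A →ₐ[K] MonoidAlgebra L S) (g : B →ₐ[K] MonoidAlgebra L T) :
    A ⊗[K] B →ₐ[K] MonoidAlgebra L (S × T) :=
  Algebra.TensorProduct.lift ((mapDomainAlgHom K L (MonoidHom.inl S T)).comp f)
    ((mapDomainAlgHom K L (MonoidHom.inr S T)).comp g) fun a b => by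
      simp only [AlgHom.comp_apply]
      induction f a using MonoidAlgebra.induction_linear with
      | zero => simp
      | add x y hx hy => rw [map_add]; exact hx.add_left hy
      | single s r =>
        induction g b using MonoidAlgebra.induction_linear with
        | zero => simp
        | add x y hx hy => rw [map_add]; exact hx.add_right hy
        | single t r' =>
          simp [Commute, SemiconjBy, mul_comm]

theorem tens_tmul (f : A →ₐ[K] MonoidAlgebra L S) (g : B →ₐ[K] MonoidAlgebra L T) (a : A) (b : B) :
    tens f g (a ⊗ₜ b) = mapDomainAlgHom K L (MonoidHom.inl S T) (f a) *
      mapDomainAlgHom K L (MonoidHom.inr S T) (g b) := by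
  simp [tens]

theorem coeff_inl_mul_inr (x : MonoidAlgebra L S) (y : MonoidAlgebra L T) (s : S) (t : T) :
    (mapDomainAlgHom K L (MonoidHom.inl S T) x *
      mapDomainAlgHom K L (MonoidHom.inr S T) y).coeff (s, t) = x.coeff s * y.coeff t := by
  classical
  induction x using MonoidAlgebra.induction_linear with
  | zero => simp
  | add x x' hx hx' => rw [map_add, add_mul, coeff_add, Finsupp.add_apply, hx, hx', coeff_add, Finsupp.add_apply,
      add_mul]
  | single s' r =>
    induction y using MonoidAlgebra.induction_linear with
    | zero => simp
    | add x y hx hy => rw [map_add, mul_add, coeff_add, Finsupp.add_apply, hx, hy, coeff_add, Finsupp.add_apply,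
        mul_add]
    | single t' r' =>
      simp [Finsupp.single_apply, Prod.ext_iff]
      split_ifs <;> simp_all

theorem coeff_tens_tmul (f : A →ₐ[K] MonoidAlgebra L S) (g : B →ₐ[K] MonoidAlgebra L T)
    (a : A) (b : B) (s : S) (t : T) :
    (tens f g (a ⊗ₜ b)).coeff (s, t) = (f a).coeff s * (g b).coeff t := by
  rw [tens_tmul, coeff_inl_mul_inr]

/-- The coefficient at (s, t) of a pure tensor is a product, so a relation can be separated: for
fixed t use independence in the first factor, then independence in the second. -/
theorem linearIndependent_tens {ι κ : Type*} [Finite ι] [Finite κ]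
    {f : A →ₐ[K] MonoidAlgebra L S} {g : B →ₐ[K] MonoidAlgebra L T} {v : ι → A} {w : κ → B}
    (hv : LinearIndependent L (f ∘ v)) (hw : LinearIndependent L (g ∘ w)) :
    LinearIndependent L fun i : ι × κ => tens f g (v i.1 ⊗ₜ w i.2) := by
  have := Fintype.ofFinite ι
  have := Fintype.ofFinite κ
  rw [Fintype.linearIndependent_iff] at hv hw ⊢
  intro c hc i
  have h : ∀ s t, ∑ i : ι, (∑ j : κ, c (i, j) * (g (w j)).coeff t) * (f (v i)).coeff s = 0 := by
    intro s t
    have := congrArg (fun x => x.coeff (s, t)) hc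
    simp only [coeff_sum, Finsupp.finsetSum_apply, coeff_smul, Finsupp.smul_apply,
      coeff_tens_tmul, coeff_zero, Finsupp.zero_apply, smul_eq_mul] at this
    rw [Fintype.sum_prod_type] at this
    rw [← this]
    refine Finset.sum_congr rfl fun i _ => ?_
    rw [Finset.sum_mul]
    refine Finset.sum_congr rfl fun j _ => ?_
    ring
  have h2 : ∀ i t, ∑ j : κ, c (i, j) * (g (w j)).coeff t = 0 := fun i t =>
    hv (fun i => ∑ j : κ, c (i, j) * (g (w j)).coeff t) (by
      ext s; simpa using h s t) i
  exact hw (fun j => c (i.1, j)) (by ext t; simpa using h2 i.1 t) i.2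

/-- With `IsForm.injective` this embeds tensor powers of L[S]^G into group algebras of powers of S,
where the Hopf algebra axioms can be checked on group elements. -/
theorem isForm_tens {f : A →ₐ[K] MonoidAlgebra L S} {g : B →ₐ[K] MonoidAlgebra L T}
    (hf : IsForm f) (hg : IsForm g) :
    IsForm (K := K) (L := L) (S := S × T) (A := A ⊗[K] B) (tens f g) := by
  obtain ⟨n, b, hb⟩ := hf
  obtain ⟨m, b', hb'⟩ := hg
  refine IsForm.of_basis (b.tensorProduct b') ?_
  have h := linearIndependent_tens hb hb'
  have he : (tens f g ∘ b.tensorProduct b') = fun i : Fin n × Fin m => tens f g (b i.1 ⊗ₜ b' i.2) :=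
    funext fun i => congrArg _ (Module.Basis.tensorProduct_apply' b b' i)
  exact he ▸ h

end Form

end TwistedGroupAlgebra

/-! ### The comultiplication and counit of L[S]^G -/

namespace TwistedGroupAlgebra

open MonoidAlgebra

section Lift

variable {K A B C : Type*} [CommSemiring K] [Semiring A] [Semiring B] [Semiring C] [Algebra K A]
  [Algebra K B] [Algebra K C]

/-- Factor an algebra homomorphism through an injective one. -/
noncomputable def factorThrough (f : A →ₐ[K] C) (hf : Function.Injective f) (g : B →ₐ[K] C)
    (h : ∀ b, g b ∈ f.range) : B →ₐ[K] A :=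
  (AlgEquiv.ofInjective f hf).symm.toAlgHom.comp (g.codRestrict f.range h)

theorem apply_factorThrough (f : A →ₐ[K] C) (hf : Function.Injective f) (g : B →ₐ[K] C)
    (h : ∀ b, g b ∈ f.range) (b : B) : f (factorThrough f hf g h b) = g b := by
  have := (AlgEquiv.ofInjective f hf).apply_symm_apply (g.codRestrict f.range h b)
  exact congrArg Subtype.val this

end Lift

theorem mapDomainAlgHom_mapDomainAlgHom {K L S T U : Type*} [CommSemiring K] [Semiring L]
    [Algebra K L] [Monoid S] [Monoid T] [Monoid U] (g : T →* U) (f : S →* T)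
    (x : MonoidAlgebra L S) : mapDomainAlgHom K L g (mapDomainAlgHom K L f x) =
      mapDomainAlgHom K L (g.comp f) x := by
  rw [mapDomainAlgHom_comp, AlgHom.comp_apply]

section Hopf

variable {K : Type*} {L : Type*} [Field K] [Field L] [Algebra K L] [FiniteDimensional K L]
variable {S : Type*} [Group S] [Finite S] (φ : (L ≃ₐ[K] L) →* MulAut S)

theorem exists_basis_fixed_val [IsGalois K L] : ∃ (ι : Set (MonoidAlgebra L S)) (_ : Finite ι)
    (B : Module.Basis ι L (MonoidAlgebra L S)) (b : Module.Basis ι K (fixed φ)),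
    ∀ i, (b i : MonoidAlgebra L S) = B i := by
  obtain ⟨ι, B, hB⟩ := exists_basis_fixed φ
  have : Module.Finite L (MonoidAlgebra L S) := .of_basis (MonoidAlgebra.basis S L)
  refine ⟨ι, Module.Finite.finite_basis B, B, ?_⟩
  let v : ι → fixed φ := fun i => ⟨B i, hB i⟩
  have hli : LinearIndependent K v := by
    have h : LinearIndependent K ((fixed φ).val.toLinearMap ∘ v) :=
      B.linearIndependent.restrict_scalars' K
    exact h.of_comp
  have hsp : ⊤ ≤ Submodule.span K (Set.range v) := by
    rintro ⟨c, hc⟩ -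
    have h := mem_span_of_fixed φ B hB hc
    have hr : Set.range B = (fixed φ).val.toLinearMap '' Set.range v := by
      rw [← Set.range_comp]; rfl
    rw [hr, ← Submodule.map_span] at h
    obtain ⟨y, hy, hyc⟩ := h
    have : y = ⟨c, hc⟩ := Subtype.ext hyc
    rwa [← this]
  exact ⟨Module.Basis.mk hli hsp, fun i => by simp [v]⟩

variable [IsGalois K L]

theorem isForm_val : IsForm (fixed φ).val := by
  obtain ⟨ι, _, B, b, h⟩ := exists_basis_fixed_val φ
  refine IsForm.of_basis b ?_
  have : (fixed φ).val ∘ b = B := funext h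
  rw [this]
  exact B.linearIndependent

instance finite_fixed : Module.Finite K (fixed φ) := by
  obtain ⟨ι, _, B, b, h⟩ := exists_basis_fixed_val φ
  exact .of_basis b

theorem finrank_fixed : Module.finrank K (fixed φ) = Nat.card S := by
  obtain ⟨ι, _, B, b, h⟩ := exists_basis_fixed_val φ
  have := Fintype.ofFinite ι
  have := Fintype.ofFinite S
  rw [Module.finrank_eq_card_basis b, ← Module.finrank_eq_card_basis B,
    Module.finrank_eq_card_basis (MonoidAlgebra.basis S L), Nat.card_eq_fintype_card]

/-- The diagonal action on the product group. -/
def diagAut : (L ≃ₐ[K] L) →* MulAut (S × S) where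
  toFun g := MulEquiv.prodCongr (φ g) (φ g)
  map_one' := by rw [map_one]; rfl
  map_mul' g h := by rw [map_mul]; rfl

theorem diagAut_apply (g : L ≃ₐ[K] L) (x : S × S) : diagAut φ g x = (φ g x.1, φ g x.2) := rfl

theorem tens_mem_fixed (x y : fixed φ) :
    tens (fixed φ).val (fixed φ).val (x ⊗ₜ y) ∈ fixed (diagAut φ) := by
  rintro g ⟨s, t⟩
  have h1 := x.2 g s
  have h2 := y.2 g t
  rw [diagAut_apply, coeff_tens_tmul, coeff_tens_tmul, map_mul]
  exact congrArg₂ (· * ·) h1 h2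

variable (S) in
/-- The diagonal embedding of a group. -/
def diag : S →* S × S := (MonoidHom.id S).prod (MonoidHom.id S)

theorem diag_mem_fixed (x : fixed φ) :
    mapDomainAlgHom K L (diag S) (x : MonoidAlgebra L S) ∈ fixed (diagAut φ) := by
  rw [mem_fixed']
  intro g
  have h : ∀ c : MonoidAlgebra L S, twist (diagAut φ) g (mapDomainAlgHom K L (diag S) c) =
      mapDomainAlgHom K L (diag S) (twist φ g c) := by
    intro c
    induction c using MonoidAlgebra.induction_linear with
    | zero => simp
    | add x y hx hy => simp only [map_add, hx, hy]
    | single s r => simp [twist, diag, diagAut_apply]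
  rw [h, (mem_fixed' φ).1 x.2]

/-- The products of basis elements are fixed under the diagonal action and form an L-basis of L[S ×
S], by independence and counting. A fixed element has coordinates in K with respect to them, so it
comes from the tensor product over K. -/
theorem diag_mem_range (x : fixed φ) :
    (mapDomainAlgHom K L (diag S)).comp (fixed φ).val x ∈
      (tens (fixed φ).val (fixed φ).val).range := by
  obtain ⟨ι, _, B, b, h⟩ := exists_basis_fixed_val φ
  have := Fintype.ofFinite ι
  have := Fintype.ofFinite S
  have hb : (fixed φ).val ∘ b = B := funext h
  have hli : LinearIndependent L ((fixed φ).val ∘ b) := hb ▸ B.linearIndependent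
  have hli2 := linearIndependent_tens hli hli
  have hcard : Fintype.card ι = Fintype.card S := by
    rw [← Module.finrank_eq_card_basis B, Module.finrank_eq_card_basis (MonoidAlgebra.basis S L)]
  obtain hι | hι := isEmpty_or_nonempty ι
  · have := Fintype.card_pos (α := S)
    rw [← hcard, Fintype.card_eq_zero] at this
    exact absurd this (lt_irrefl _)
  let B2 := basisOfLinearIndependentOfCardEqFinrank hli2 (by
    rw [Module.finrank_eq_card_basis (MonoidAlgebra.basis (S × S) L), Fintype.card_prod,
      Fintype.card_prod, hcard])
  have hB2 : ∀ i, B2 i = tens (fixed φ).val (fixed φ).val (b i.1 ⊗ₜ b i.2) := fun i => by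
    simp [B2]
  have hmem := mem_span_of_fixed (diagAut φ) B2
    (fun i => by rw [hB2]; exact tens_mem_fixed φ _ _) (diag_mem_fixed φ x)
  have hle : Submodule.span K (Set.range B2) ≤
      Subalgebra.toSubmodule (tens (fixed φ).val (fixed φ).val).range := by
    rw [Submodule.span_le]
    rintro _ ⟨i, rfl⟩
    rw [hB2]
    exact ⟨_, rfl⟩
  exact hle hmem

/-- The comultiplication of the twisted group algebra. -/
noncomputable def comulHom : fixed φ →ₐ[K] fixed φ ⊗[K] fixed φ :=
  factorThrough (tens (fixed φ).val (fixed φ).val)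
    (isForm_tens (isForm_val φ) (isForm_val φ)).injective
    ((mapDomainAlgHom K L (diag S)).comp (fixed φ).val) (diag_mem_range φ)

theorem tens_comulHom (x : fixed φ) : tens (fixed φ).val (fixed φ).val (comulHom φ x) =
    mapDomainAlgHom K L (diag S) (x : MonoidAlgebra L S) :=
  apply_factorThrough _ _ _ _ x

variable (K L S) in
/-- The augmentation of the group algebra. -/
noncomputable def augmentation : MonoidAlgebra L S →ₐ[K] L :=
  (MonoidAlgebra.lift L L S (1 : S →* L)).restrictScalars K

theorem augmentation_single (s : S) (a : L) : augmentation K L S (single s a) = a := by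
  simp [augmentation]

theorem augmentation_mem_range (x : fixed φ) :
    (augmentation K L S).comp (fixed φ).val x ∈ (Algebra.ofId K L).range := by
  change _ ∈ Set.range (algebraMap K L)
  rw [IsGalois.mem_range_algebraMap_iff_fixed]
  intro g
  have h : ∀ c : MonoidAlgebra L S, g (augmentation K L S c) =
      augmentation K L S (twist φ g c) := by
    intro c
    induction c using MonoidAlgebra.induction_linear with
    | zero => simp
    | add x y hx hy => simp only [map_add, hx, hy]
    | single s r => simp [twist, augmentation_single]
  rw [AlgHom.comp_apply, h]
  exact congrArg _ ((mem_fixed' φ).1 x.2 g)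

/-- The counit of the twisted group algebra. -/
noncomputable def counitHom : fixed φ →ₐ[K] K :=
  factorThrough (Algebra.ofId K L) (algebraMap K L).injective
    ((augmentation K L S).comp (fixed φ).val) (augmentation_mem_range φ)

theorem algebraMap_counitHom (x : fixed φ) :
    algebraMap K L (counitHom φ x) = augmentation K L S (x : MonoidAlgebra L S) :=
  apply_factorThrough (Algebra.ofId K L) _ _ _ x

/-- After embedding into L[S × (S × S)] both composites are induced by s ↦ (s, (s, s)). -/
theorem comulHom_coassoc : (Algebra.TensorProduct.assoc K K K (fixed φ) (fixed φ)
      (fixed φ)).toAlgHom.comp ((Algebra.TensorProduct.map (comulHom φ) (.id K (fixed φ))).comp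
      (comulHom φ)) = (Algebra.TensorProduct.map (.id K (fixed φ)) (comulHom φ)).comp
      (comulHom φ) := by
  have hinj := (isForm_tens (isForm_val φ) (isForm_tens (isForm_val φ) (isForm_val φ))).injective
  let ι₂ := tens (fixed φ).val (fixed φ).val
  let ι₃ := tens (fixed φ).val ι₂
  have h0 : ∀ (w : fixed φ ⊗[K] fixed φ) (y : fixed φ),
      ι₃ (Algebra.TensorProduct.assoc K K K (fixed φ) (fixed φ) (fixed φ) (w ⊗ₜ y)) =
      mapDomainAlgHom K L (MulEquiv.prodAssoc : (S × S) × S ≃* S × (S × S)).toMonoidHom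
        (tens ι₂ (fixed φ).val (w ⊗ₜ y)) := by
    intro w y
    induction w with
    | zero => simp
    | add x y hx hy => simp only [TensorProduct.add_tmul, map_add, hx, hy]
    | tmul a b =>
      rw [Algebra.TensorProduct.assoc_tmul]
      simp only [ι₃, ι₂, tens_tmul, map_mul, mul_assoc]
      simp only [mapDomainAlgHom_mapDomainAlgHom]
      rfl
  have h1 : ∀ z : fixed φ ⊗[K] fixed φ, ι₃ (Algebra.TensorProduct.assoc K K K (fixed φ) (fixed φ)
      (fixed φ) (Algebra.TensorProduct.map (comulHom φ) (.id K (fixed φ)) z)) =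
      mapDomainAlgHom K L ((diag S).prodMap (MonoidHom.id S) |> MonoidHom.comp
        (MulEquiv.prodAssoc : (S × S) × S ≃* S × (S × S)).toMonoidHom) (ι₂ z) := by
    intro z
    induction z with
    | zero => simp
    | add x y hx hy => simp only [map_add, hx, hy]
    | tmul a b =>
      rw [Algebra.TensorProduct.map_tmul, h0]
      simp only [ι₂, tens_tmul, map_mul, tens_comulHom]
      simp only [mapDomainAlgHom_mapDomainAlgHom, Subalgebra.val_apply]
      rfl
  have h2 : ∀ z : fixed φ ⊗[K] fixed φ, ι₃
      (Algebra.TensorProduct.map (.id K (fixed φ)) (comulHom φ) z) =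
      mapDomainAlgHom K L ((MonoidHom.id S).prodMap (diag S)) (ι₂ z) := by
    intro z
    induction z with
    | zero => simp
    | add x y hx hy => simp only [map_add, hx, hy]
    | tmul a b =>
      rw [Algebra.TensorProduct.map_tmul]
      simp only [ι₃, ι₂, tens_tmul, map_mul, tens_comulHom]
      simp only [mapDomainAlgHom_mapDomainAlgHom, Subalgebra.val_apply]
      rfl
  refine AlgHom.ext fun x => hinj ?_
  refine (h1 (comulHom φ x)).trans ((h2 (comulHom φ x)).trans ?_).symm
  simp only [ι₂, tens_comulHom]
  simp only [mapDomainAlgHom_mapDomainAlgHom]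
  rfl

end Hopf

end TwistedGroupAlgebra

/-! ### The Hopf algebra axioms and cocommutativity of L[S]^G -/

namespace TwistedGroupAlgebra

open MonoidAlgebra

section Hopf

variable {K : Type*} {L : Type*} [Field K] [Field L] [Algebra K L] [FiniteDimensional K L]
variable {S : Type*} [Group S] [Finite S] (φ : (L ≃ₐ[K] L) →* MulAut S) [IsGalois K L]

theorem mapDomainAlgHom_one (c : MonoidAlgebra L S) :
    mapDomainAlgHom K L (1 : S →* S) c = augmentation K L S c • 1 := by
  induction c using MonoidAlgebra.induction_linear with
  | zero => simp
  | add x y hx hy => simp only [map_add, hx, hy, add_smul]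
  | single s r => simp [augmentation_single, one_def]

theorem counit_rTensor : (Algebra.TensorProduct.map (counitHom φ) (.id K (fixed φ))).comp
    (comulHom φ) = (Algebra.TensorProduct.lid K (fixed φ)).symm := by
  have h : ∀ z : fixed φ ⊗[K] fixed φ, (Algebra.TensorProduct.lid K (fixed φ)
      (Algebra.TensorProduct.map (counitHom φ) (.id K (fixed φ)) z) : MonoidAlgebra L S) =
      mapDomainAlgHom K L (MonoidHom.snd S S) (tens (fixed φ).val (fixed φ).val z) := by
    intro z
    induction z with
    | zero => simp
    | add x y hx hy => simp only [map_add, Subalgebra.coe_add, hx, hy]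
    | tmul a b =>
      rw [tens_tmul, map_mul, mapDomainAlgHom_mapDomainAlgHom, mapDomainAlgHom_mapDomainAlgHom,
        MonoidHom.snd_comp_inr, MonoidHom.snd_comp_inl, mapDomainAlgHom_one, mapDomainAlgHom_id]
      simp [← algebraMap_counitHom, algebraMap_smul]
  refine AlgHom.ext fun x => (Algebra.TensorProduct.lid K (fixed φ)).injective (Subtype.ext ?_)
  refine (h (comulHom φ x)).trans ?_
  rw [tens_comulHom, mapDomainAlgHom_mapDomainAlgHom]
  change mapDomainAlgHom K L (MonoidHom.id S) _ = _
  rw [mapDomainAlgHom_id]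
  simp

theorem counit_lTensor : (Algebra.TensorProduct.map (.id K (fixed φ)) (counitHom φ)).comp
    (comulHom φ) = (Algebra.TensorProduct.rid K K (fixed φ)).symm := by
  have h : ∀ z : fixed φ ⊗[K] fixed φ, (Algebra.TensorProduct.rid K K (fixed φ)
      (Algebra.TensorProduct.map (.id K (fixed φ)) (counitHom φ) z) : MonoidAlgebra L S) =
      mapDomainAlgHom K L (MonoidHom.fst S S) (tens (fixed φ).val (fixed φ).val z) := by
    intro z
    induction z with
    | zero => simp
    | add x y hx hy => simp only [map_add, Subalgebra.coe_add, hx, hy]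
    | tmul a b =>
      rw [tens_tmul, map_mul, mapDomainAlgHom_mapDomainAlgHom, mapDomainAlgHom_mapDomainAlgHom,
        MonoidHom.fst_comp_inr, MonoidHom.fst_comp_inl, mapDomainAlgHom_one, mapDomainAlgHom_id]
      simp [← algebraMap_counitHom, algebraMap_smul]
  refine AlgHom.ext fun x => (Algebra.TensorProduct.rid K K (fixed φ)).injective (Subtype.ext ?_)
  refine (h (comulHom φ x)).trans ?_
  rw [tens_comulHom, mapDomainAlgHom_mapDomainAlgHom]
  change mapDomainAlgHom K L (MonoidHom.id S) _ = _
  rw [mapDomainAlgHom_id]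
  simp

noncomputable instance : Bialgebra K (fixed φ) :=
  Bialgebra.ofAlgHom (comulHom φ) (counitHom φ) (comulHom_coassoc φ) (counit_rTensor φ)
    (counit_lTensor φ)

theorem comul_eq (x : fixed φ) : Coalgebra.comul (R := K) x = comulHom φ x := rfl

theorem counit_eq (x : fixed φ) : Coalgebra.counit (R := K) x = counitHom φ x := rfl

theorem coeff_mapDomain_inv (c : MonoidAlgebra L S) (n : S) :
    (mapDomainLinearMap K L (·⁻¹ : S → S) c).coeff n = c.coeff n⁻¹ := by
  have := Finsupp.mapDomain_apply (f := (·⁻¹ : S → S)) inv_injective c.coeff n⁻¹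
  simpa using this

/-- The antipode of the twisted group algebra. -/
noncomputable def antipodeMap : fixed φ →ₗ[K] fixed φ :=
  ((mapDomainLinearMap K L (·⁻¹ : S → S)).comp (fixed φ).val.toLinearMap).codRestrict
    (Subalgebra.toSubmodule (fixed φ)) fun c g n => by
      simp only [LinearMap.comp_apply, coeff_mapDomain_inv, ← map_inv]
      exact c.2 g n⁻¹

theorem coe_antipodeMap (x : fixed φ) : (antipodeMap φ x : MonoidAlgebra L S) =
    mapDomainLinearMap K L (·⁻¹ : S → S) (x : MonoidAlgebra L S) := rfl

/-- The left side becomes a pushforward from L[S × S]. On the image of the comultiplication, which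
is diagonal, (s, t) ↦ s⁻¹t is constantly 1, and this is the antipode axiom. -/
theorem mapDomain_inv_mul (x y : MonoidAlgebra L S) :
    mapDomainLinearMap K L (·⁻¹ : S → S) x * y =
    mapDomainLinearMap K L (fun p : S × S => p.1⁻¹ * p.2)
      (mapDomainAlgHom K L (MonoidHom.inl S S) x * mapDomainAlgHom K L (MonoidHom.inr S S) y) := by
  induction x using MonoidAlgebra.induction_linear with
  | zero => simp
  | add x x' hx hx' => simp only [map_add, add_mul, hx, hx']
  | single s r =>
    induction y using MonoidAlgebra.induction_linear with
    | zero => simp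
    | add x y hx hy => simp only [map_add, mul_add, hx, hy]
    | single t r' => simp

theorem mul_mapDomain_inv (x y : MonoidAlgebra L S) :
    x * mapDomainLinearMap K L (·⁻¹ : S → S) y =
    mapDomainLinearMap K L (fun p : S × S => p.1 * p.2⁻¹)
      (mapDomainAlgHom K L (MonoidHom.inl S S) x * mapDomainAlgHom K L (MonoidHom.inr S S) y) := by
  induction x using MonoidAlgebra.induction_linear with
  | zero => simp
  | add x x' hx hx' => simp only [map_add, add_mul, hx, hx']
  | single s r =>
    induction y using MonoidAlgebra.induction_linear with
    | zero => simp
    | add x y hx hy => simp only [map_add, mul_add, hx, hy]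
    | single t r' => simp

theorem mapDomain_diag_eq (f : S × S → S) (hf : ∀ s, f (s, s) = 1) (c : MonoidAlgebra L S) :
    mapDomainLinearMap K L f (mapDomainAlgHom K L (diag S) c) = augmentation K L S c • 1 := by
  induction c using MonoidAlgebra.induction_linear with
  | zero => simp
  | add x y hx hy => simp only [map_add, hx, hy, add_smul]
  | single s r => simp [augmentation_single, one_def, diag, hf]

theorem antipode_rTensor : LinearMap.mul' K (fixed φ) ∘ₗ (antipodeMap φ).rTensor (fixed φ) ∘ₗ
    Coalgebra.comul = Algebra.linearMap K (fixed φ) ∘ₗ Coalgebra.counit := by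
  have h : ∀ z : fixed φ ⊗[K] fixed φ,
      (LinearMap.mul' K (fixed φ) ((antipodeMap φ).rTensor (fixed φ) z) : MonoidAlgebra L S) =
      mapDomainLinearMap K L (fun p : S × S => p.1⁻¹ * p.2)
        (tens (fixed φ).val (fixed φ).val z) := by
    intro z
    induction z with
    | zero => simp
    | add x y hx hy => simp only [map_add, Subalgebra.coe_add, hx, hy]
    | tmul a b =>
      rw [tens_tmul, Subalgebra.val_apply, Subalgebra.val_apply, ← mapDomain_inv_mul]
      simp [coe_antipodeMap]
  refine LinearMap.ext fun x => Subtype.ext ?_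
  refine (h (comulHom φ x)).trans ?_
  rw [tens_comulHom, mapDomain_diag_eq _ (fun s => by simp), ← algebraMap_counitHom,
    algebraMap_smul]
  simp [counit_eq, Algebra.algebraMap_eq_smul_one]

theorem antipode_lTensor : LinearMap.mul' K (fixed φ) ∘ₗ (antipodeMap φ).lTensor (fixed φ) ∘ₗ
    Coalgebra.comul = Algebra.linearMap K (fixed φ) ∘ₗ Coalgebra.counit := by
  have h : ∀ z : fixed φ ⊗[K] fixed φ,
      (LinearMap.mul' K (fixed φ) ((antipodeMap φ).lTensor (fixed φ) z) : MonoidAlgebra L S) =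
      mapDomainLinearMap K L (fun p : S × S => p.1 * p.2⁻¹)
        (tens (fixed φ).val (fixed φ).val z) := by
    intro z
    induction z with
    | zero => simp
    | add x y hx hy => simp only [map_add, Subalgebra.coe_add, hx, hy]
    | tmul a b =>
      rw [tens_tmul, Subalgebra.val_apply, Subalgebra.val_apply, ← mul_mapDomain_inv]
      simp [coe_antipodeMap]
  refine LinearMap.ext fun x => Subtype.ext ?_
  refine (h (comulHom φ x)).trans ?_
  rw [tens_comulHom, mapDomain_diag_eq _ (fun s => by simp), ← algebraMap_counitHom,
    algebraMap_smul]
  simp [counit_eq, Algebra.algebraMap_eq_smul_one]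

noncomputable instance : HopfAlgebra K (fixed φ) where
  antipode := antipodeMap φ
  mul_antipode_rTensor_comul := antipode_rTensor φ
  mul_antipode_lTensor_comul := antipode_lTensor φ

instance : Coalgebra.IsCocomm K (fixed φ) where
  comm_comp_comul := by
    have h : ∀ z : fixed φ ⊗[K] fixed φ,
        tens (fixed φ).val (fixed φ).val (TensorProduct.comm K (fixed φ) (fixed φ) z) =
        mapDomainLinearMap K L Prod.swap (tens (fixed φ).val (fixed φ).val z) := by
      intro z
      induction z with
      | zero => simp
      | add x y hx hy => simp only [map_add, hx, hy]
      | tmul a b =>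
        ext ⟨s, t⟩
        have := Finsupp.mapDomain_apply (f := (Prod.swap : S × S → S × S)) Prod.swap_injective
          (tens (fixed φ).val (fixed φ).val (a ⊗ₜ b)).coeff (t, s)
        rw [TensorProduct.comm_tmul, coeff_tens_tmul, coeff_mapDomainLinearMap]
        refine Eq.trans ?_ this.symm
        rw [coeff_tens_tmul, mul_comm]
    refine LinearMap.ext fun x =>
      (isForm_tens (isForm_val φ) (isForm_val φ)).injective ?_
    refine (h (comulHom φ x)).trans ?_
    rw [comul_eq, tens_comulHom]
    induction (x : MonoidAlgebra L S) using MonoidAlgebra.induction_linear with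
    | zero => simp
    | add x y hx hy => simp only [map_add, hx, hy]
    | single s r => simp [diag]

end Hopf

end TwistedGroupAlgebra

/-! ### Conjugation by left translations on a regular subgroup -/

namespace IsRegularNormalised

variable {G : Type*} [Group G] {M : Subgroup (Equiv.Perm G)} (hM : IsRegularNormalised M)

/-- The conjugation action of `G` on `M`. -/
def conjAut : G →* MulAut M where
  toFun g :=
    { toFun := hM.conj g
      invFun := hM.conj g⁻¹
      left_inv := fun n => by
        apply Subtype.ext; ext x; simp [conj]
      right_inv := fun n => by
        apply Subtype.ext; ext x; simp [conj]
      map_mul' := fun n m => by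
        apply Subtype.ext; ext x; simp [conj] }
  map_one' := by
    ext n x; simp [conj]
  map_mul' g h := by
    ext n x; simp [conj, mul_assoc]

theorem conjAut_apply (g : G) (n : M) : hM.conjAut g n = hM.conj g n := rfl

theorem bijective_inv_apply_one (hM : IsRegularNormalised M) :
    Function.Bijective fun n : M => (n : Equiv.Perm G)⁻¹ 1 := by
  constructor
  · intro n m h
    have := (hM.regular 1 ((n : Equiv.Perm G)⁻¹ 1)).unique
      ⟨inv_mem n.2, rfl⟩ ⟨inv_mem m.2, h.symm⟩
    exact Subtype.ext (inv_injective this)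
  · intro g
    obtain ⟨n, ⟨hn, h⟩, -⟩ := hM.regular 1 g
    exact ⟨⟨n⁻¹, inv_mem hn⟩, by simpa using h⟩

theorem finite (hM : IsRegularNormalised M) [Finite G] : Finite M := Finite.of_injective _ hM.bijective_inv_apply_one.1

theorem card_eq (hM : IsRegularNormalised M) : Nat.card M = Nat.card G := Nat.card_eq_of_bijective _ hM.bijective_inv_apply_one

/-- The bijection n ↦ n⁻¹(1) from M to G is multiplicative only up to conjugation. The Galois twist
in L[M]^G compensates for exactly this. -/
theorem mul_conj_inv_apply_one (n m : M) :
    ((n * hM.conj ((n : Equiv.Perm G)⁻¹ 1) m : M) : Equiv.Perm G)⁻¹ 1 =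
      (n : Equiv.Perm G)⁻¹ 1 * (m : Equiv.Perm G)⁻¹ 1 := by
  simp [conj]

end IsRegularNormalised

/-! ### The Hopf-Galois structure of a regular subgroup -/

namespace HopfGaloisStructure

open MonoidAlgebra TwistedGroupAlgebra

variable {K : Type u} {L : Type v} [Field K] [Field L] [Algebra K L]

section Act

variable {M : Subgroup (Equiv.Perm (L ≃ₐ[K] L))}

/-- The action of the group algebra on `L` as an `L`-linear map to `End_K(L)`. -/
noncomputable def actLin : MonoidAlgebra L M →ₗ[L] Module.End K L :=
  (Finsupp.linearCombination L
    (fun n : M => (((n : Equiv.Perm (L ≃ₐ[K] L))⁻¹ 1 : L ≃ₐ[K] L) : L →ₐ[K] L).toLinearMap)).comp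
    (coeffLinearEquiv L).toLinearMap

theorem actLin_apply (c : MonoidAlgebra L M) (x : L) : actLin c x = groupAlgebraAct c x := by
  simp [actLin, groupAlgebraAct, Finsupp.linearCombination_apply, Finsupp.sum]

theorem actLin_single (n : M) (a : L) (x : L) :
    actLin (single n a : MonoidAlgebra L M) x =
      a * ((n : Equiv.Perm (L ≃ₐ[K] L))⁻¹ 1 : L ≃ₐ[K] L) x := by
  simp [actLin]

end Act

variable {M : Subgroup (Equiv.Perm (L ≃ₐ[K] L))} (hM : IsRegularNormalised M)

theorem actLin_injective (hM : IsRegularNormalised M) :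
    Function.Injective (actLin (K := K) (L := L) (M := M)) := by
  have h := (linearIndependent_toLinearMap K L L).comp
    (fun n : M => (((n : Equiv.Perm (L ≃ₐ[K] L))⁻¹ 1 : L ≃ₐ[K] L) : L →ₐ[K] L))
    (fun n m hnm => hM.bijective_inv_apply_one.1 (AlgEquiv.ext fun x => DFunLike.congr_fun hnm x))
  intro c d hcd
  exact (coeffLinearEquiv L).injective (h hcd)

variable [FiniteDimensional K L]

/-- For `c` supported at n, put g = n⁻¹(1). Composing the operators applies g to the coefficients of
`d`; since `d` is fixed, this moves them to the conjugates by g, as `mul_conj_inv_apply_one`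
requires. Nothing is needed of `c`. -/
theorem actLin_mul (c : MonoidAlgebra L M) {d : MonoidAlgebra L M} (hd : d ∈ fixed hM.conjAut) :
    actLin (c * d) = actLin c * actLin d := by
  have := hM.finite
  have := Fintype.ofFinite M
  have hsum : ∀ d : MonoidAlgebra L M, d = ∑ m : M, single m (d.coeff m) := fun d => by
    conv_lhs => rw [← sum_coeff_single d, Finsupp.sum_fintype _ _ (by simp)]
  induction c using MonoidAlgebra.induction_linear with
  | zero => simp
  | add x y hx hy => simp only [map_add, add_mul, hx, hy]
  | single n a =>
    ext x
    set g : L ≃ₐ[K] L := (n : Equiv.Perm (L ≃ₐ[K] L))⁻¹ 1 with hg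
    have h1 : actLin d x = ∑ m : M, d.coeff m * ((m : Equiv.Perm (L ≃ₐ[K] L))⁻¹ 1) x := by
      conv_lhs => rw [hsum d, map_sum, LinearMap.sum_apply]
      simp_rw [actLin_single]
    rw [Module.End.mul_apply, actLin_single, h1, map_sum, Finset.mul_sum]
    conv_lhs => rw [hsum d, Finset.mul_sum, map_sum, LinearMap.sum_apply]
    symm
    refine Fintype.sum_bijective (hM.conjAut g) (hM.conjAut g).bijective _ _ fun m => ?_
    rw [single_mul_single, actLin_single, hM.conjAut_apply, hg, hM.mul_conj_inv_apply_one, ← hg,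
      ← hM.conjAut_apply, hd g m, AlgEquiv.mul_apply, map_mul, mul_assoc]

variable [IsGalois K L]

theorem act_mul_tens (x y : L) [Finite M]
    (z : fixed hM.conjAut ⊗[K] fixed hM.conjAut) :
    LinearMap.mul' K L (TensorProduct.map
      (((actLin.restrictScalars K).comp (fixed hM.conjAut).val.toLinearMap).flip x)
      (((actLin.restrictScalars K).comp (fixed hM.conjAut).val.toLinearMap).flip y) z) =
    (tens (fixed hM.conjAut).val (fixed hM.conjAut).val z).coeff.sum fun p a =>
      a * (((p.1 : Equiv.Perm (L ≃ₐ[K] L))⁻¹ 1) x * ((p.2 : Equiv.Perm (L ≃ₐ[K] L))⁻¹ 1) y) := by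
  have := Fintype.ofFinite M
  rw [Finsupp.sum_fintype _ _ (by simp)]
  induction z with
  | zero => simp
  | add z w hz hw =>
    simp only [map_add, hz, hw, coeff_add, Finsupp.add_apply, add_mul, Finset.sum_add_distrib]
  | tmul a b =>
    simp only [TensorProduct.map_tmul, LinearMap.mul'_apply, LinearMap.flip_apply,
      LinearMap.comp_apply, LinearMap.restrictScalars_apply, actLin_apply]
    rw [Fintype.sum_prod_type]
    simp only [coeff_tens_tmul, groupAlgebraAct]
    rw [Finsupp.sum_fintype _ _ (by simp), Finsupp.sum_fintype _ _ (by simp), Finset.sum_mul]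
    refine Finset.sum_congr rfl fun n _ => ?_
    rw [Finset.mul_sum]
    refine Finset.sum_congr rfl fun m _ => ?_
    simp only [AlgHom.toLinearMap_apply, Subalgebra.val_apply]
    ring

/-- The action of `L[M]^G` on `L`. -/
noncomputable def actHom : fixed hM.conjAut →ₐ[K] Module.End K L :=
  AlgHom.ofLinearMap ((actLin.restrictScalars K).comp (fixed hM.conjAut).val.toLinearMap)
    (by ext x; simp [one_def, actLin_single])
    (fun c d => actLin_mul hM (c : MonoidAlgebra L M) d.2)

theorem actHom_apply (c : fixed hM.conjAut) :
    actHom hM c = actLin (c : MonoidAlgebra L M) := rfl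

/-- A K-basis of L[M]^G that is also an L-basis of L[M] identifies the domain with L[M], on which
`actLin` is injective by independence of automorphisms. -/
theorem galois_actHom : Function.Bijective (TensorProduct.lift
    ((LinearMap.mul K (Module.End K L)).compl₁₂ (Algebra.lmul K L).toLinearMap
      (actHom hM).toLinearMap)) := by
  have := hM.finite
  obtain ⟨ι, _, B, b, h⟩ := exists_basis_fixed_val hM.conjAut
  have := Fintype.ofFinite ι
  set T := TensorProduct.lift ((LinearMap.mul K (Module.End K L)).compl₁₂
    (Algebra.lmul K L).toLinearMap (actHom hM).toLinearMap) with hT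
  have hinj : Function.Injective T := by
    rw [injective_iff_map_eq_zero]
    intro z hz
    set bb := Algebra.TensorProduct.basis L b with hbb
    have hz' : z = ∑ i, (bb.repr z i) ⊗ₜ[K] b i := by
      conv_lhs => rw [← bb.sum_repr z]
      refine Finset.sum_congr rfl fun i _ => ?_
      rw [hbb, Algebra.TensorProduct.basis_apply, TensorProduct.smul_tmul', smul_eq_mul, mul_one]
    have hTz : T z = actLin (∑ i, bb.repr z i • B i) := by
      conv_lhs => rw [hz']
      rw [map_sum, map_sum]
      refine Finset.sum_congr rfl fun i _ => ?_
      rw [hT, TensorProduct.lift.tmul, map_smul, ← h, ← actHom_apply]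
      ext x
      simp
    rw [hTz] at hz
    have h0 := actLin_injective hM (hz.trans (map_zero _).symm)
    have h1 := Fintype.linearIndependent_iff.1 B.linearIndependent _ h0
    rw [hz']
    simp [h1]
  refine ⟨hinj, (LinearMap.injective_iff_surjective_of_finrank_eq_finrank ?_).1 hinj⟩
  -- Both sides have K-dimension [L : K]², because |M| = |G| = [L : K].
  rw [Module.finrank_tensorProduct, Module.finrank_linearMap, finrank_fixed, hM.card_eq,
    IsGalois.card_aut_eq_finrank]

/-- The Hopf-Galois structure of a regular subgroup normalised by left translations. -/
noncomputable def ofRegular : HopfGaloisStructure K L :=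
  have := hM.finite
  { H := fixed hM.conjAut
    act := actHom hM
    act_one := fun c => by
      rw [counit_eq, algebraMap_counitHom, actHom_apply]
      induction (c : MonoidAlgebra L M) using MonoidAlgebra.induction_linear with
      | zero => simp
      | add x y hx hy => simp only [map_add, LinearMap.add_apply, hx, hy]
      | single n a => simp [actLin_single, augmentation_single]
    act_mul := fun c x y => by
      refine Eq.trans ?_ (act_mul_tens hM x y (comulHom hM.conjAut c)).symm
      have := Fintype.ofFinite M
      rw [tens_comulHom, actHom_apply, Finsupp.sum_fintype _ _ (by simp)]
      induction (c : MonoidAlgebra L M) using MonoidAlgebra.induction_linear with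
      | zero => simp
      | add x y hx hy =>
        simp only [map_add, LinearMap.add_apply, hx, hy, coeff_add, Finsupp.add_apply, add_mul,
          Finset.sum_add_distrib]
      | single n a =>
        rw [actLin_single, Finset.sum_eq_single (n, n)]
        · simp [diag]
        · intro p _ hp
          simp [diag, hp.symm]
        · simp
    galois := galois_actHom hM }

theorem givenBy_ofRegular : (ofRegular hM).GivenBy hM := by
  ext f
  constructor
  · rintro ⟨h, rfl⟩
    change fixed hM.conjAut at h
    exact ⟨h.1, h.2, funext fun x => (actLin_apply h.1 x).symm⟩
  · rintro ⟨c, hc, rfl⟩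
    exact ⟨(⟨c, hc⟩ : fixed hM.conjAut), funext fun x => (actLin_apply c x).symm⟩

end HopfGaloisStructure

/-! ### The operators on L determine the structure and the subgroup -/

namespace HopfGaloisStructure

open MonoidAlgebra TwistedGroupAlgebra

section Iso

variable {K : Type u} {L : Type v} [Field K] [Field L] [Algebra K L]

theorem act_injective (S : HopfGaloisStructure K L) : Function.Injective S.act := by
  intro h k hhk
  have : (1 : L) ⊗ₜ[K] h = (1 : L) ⊗ₜ[K] k := S.galois.1 (by simp [hhk])
  have hf := Module.Flat.rTensor_preserves_injective_linearMap (M := S.H)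
    (Algebra.linearMap K L) (algebraMap K L).injective
  have h2 : (1 : K) ⊗ₜ[K] h = (1 : K) ⊗ₜ[K] k := hf (by simpa using this)
  simpa using congrArg (TensorProduct.lid K S.H) h2

theorem eq_zero_of_sum_act (S : HopfGaloisStructure K L) {ι : Type*} [Fintype ι]
    (b : Module.Basis ι K S.H) (a : ι → L) (h : ∀ x, ∑ i, a i * S.act (b i) x = 0) : a = 0 := by
  set bb := Algebra.TensorProduct.basis L b with hbb
  have h0 : ∑ i, a i ⊗ₜ[K] b i = 0 := by
    apply S.galois.1
    rw [map_zero, map_sum]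
    ext x
    simpa using h x
  have h1 : ∑ i, a i • bb i = 0 := by
    rw [← h0]
    refine Finset.sum_congr rfl fun i _ => ?_
    rw [hbb, Algebra.TensorProduct.basis_apply, TensorProduct.smul_tmul', smul_eq_mul, mul_one]
  exact funext (Fintype.linearIndependent_iff.1 bb.linearIndependent _ h1)

/-- The operation of `H ⊗ H` on pairs of elements of `L`. -/
noncomputable def act₂ (S : HopfGaloisStructure K L) (x y : L) : S.H ⊗[K] S.H →ₗ[K] L :=
  LinearMap.mul' K L ∘ₗ
    TensorProduct.map (S.act.toLinearMap.flip x) (S.act.toLinearMap.flip y)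

theorem act₂_tmul (S : HopfGaloisStructure K L) (x y : L) (h k : S.H) :
    S.act₂ x y (h ⊗ₜ k) = S.act h x * S.act k y := by
  simp [act₂]

theorem act₂_comul (S : HopfGaloisStructure K L) (x y : L) (h : S.H) :
    S.act₂ x y (Coalgebra.comul (R := K) h) = S.act h (x * y) := (S.act_mul h x y).symm

/-- Injectivity of the Galois map, used once in each tensor factor, shows that H ⊗ H acts faithfully
on pairs. Hence the comultiplication is determined by the action on products in L. -/
theorem eq_of_act₂ (S : HopfGaloisStructure K L) {z w : S.H ⊗[K] S.H}
    (h : ∀ x y, S.act₂ x y z = S.act₂ x y w) : z = w := by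
  rw [← sub_eq_zero]
  have h' : ∀ x y, S.act₂ x y (z - w) = 0 := fun x y => by rw [map_sub, h, sub_self]
  generalize z - w = t at h'
  let b := Module.finBasis K S.H
  let B := b.tensorProduct b
  have ht : t = ∑ i, ∑ j, B.repr t (i, j) • (b i ⊗ₜ[K] b j) := by
    conv_lhs => rw [← B.sum_repr t, Fintype.sum_prod_type]
    simp [B, Module.Basis.tensorProduct_apply]
  have h2 : ∀ y, (fun i => ∑ j, algebraMap K L (B.repr t (i, j)) * S.act (b j) y) = 0 := by
    intro y
    apply S.eq_zero_of_sum_act b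
    intro x
    rw [← h' x y]
    conv_rhs => rw [ht]
    simp only [map_sum, map_smul, act₂_tmul, Finset.sum_mul]
    refine Finset.sum_congr rfl fun i _ => Finset.sum_congr rfl fun j _ => ?_
    rw [Algebra.smul_def]
    ring
  have h3 : ∀ i, (fun j => algebraMap K L (B.repr t (i, j))) = 0 := fun i =>
    S.eq_zero_of_sum_act b _ fun y => congrFun (h2 y) i
  have h4 : ∀ i j, B.repr t (i, j) = 0 := fun i j => by simpa using congrFun (h3 i) j
  rw [ht]
  simp [h4]

/-- Hopf-Galois structures acting through the same operators are isomorphic. -/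
theorem iso_of_range_eq (S T : HopfGaloisStructure K L)
    (h : {f : L → L | ∃ h : S.H, f = S.act h} = {f : L → L | ∃ h : T.H, f = T.act h}) :
    (isoSetoid K L).r S T := by
  have hr : S.act.range = T.act.range := by
    ext f
    have := Set.ext_iff.1 h f
    constructor
    · rintro ⟨k, rfl⟩
      obtain ⟨k', hk'⟩ := (Set.ext_iff.1 h (S.act k)).1 ⟨k, rfl⟩
      exact ⟨k', DFunLike.coe_injective hk'.symm⟩
    · rintro ⟨k, rfl⟩
      obtain ⟨k', hk'⟩ := (Set.ext_iff.1 h (T.act k)).2 ⟨k, rfl⟩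
      exact ⟨k', DFunLike.coe_injective hk'.symm⟩
  let e : S.H ≃ₐ[K] T.H := (AlgEquiv.ofInjective S.act S.act_injective).trans
    ((Subalgebra.equivOfEq _ _ hr).trans (AlgEquiv.ofInjective T.act T.act_injective).symm)
  have he : ∀ k, T.act (e k) = S.act k := fun k => by
    have := (AlgEquiv.ofInjective T.act T.act_injective).apply_symm_apply
      (Subalgebra.equivOfEq _ _ hr (AlgEquiv.ofInjective S.act S.act_injective k))
    exact congrArg Subtype.val this
  have hcounit : ∀ k, Coalgebra.counit (R := K) (e k) = Coalgebra.counit (R := K) k := fun k => by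
    apply (algebraMap K L).injective
    rw [← T.act_one, ← S.act_one, he]
  have hmap : ∀ x y (z : S.H ⊗[K] S.H), T.act₂ x y (Algebra.TensorProduct.map e.toAlgHom
      e.toAlgHom z) = S.act₂ x y z := by
    intro x y z
    induction z with
    | zero => simp
    | add z w hz hw => simp only [map_add, hz, hw]
    | tmul h k =>
      rw [Algebra.TensorProduct.map_tmul, act₂_tmul, act₂_tmul]
      exact congrArg₂ (fun f g => f x * g y) (he h) (he k)
  have hcomul : ∀ k, Algebra.TensorProduct.map e.toAlgHom e.toAlgHom
      (Coalgebra.comul (R := K) k) = Coalgebra.comul (R := K) (e k) := fun k =>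
    T.eq_of_act₂ fun x y => by rw [hmap, act₂_comul, act₂_comul, he]
  refine ⟨BialgEquiv.ofAlgEquiv e (AlgHom.ext hcounit) (AlgHom.ext hcomul), he⟩

theorem GivenBy.iso {S T : HopfGaloisStructure K L} {M : Subgroup (Equiv.Perm (L ≃ₐ[K] L))}
    {hM : IsRegularNormalised M} (hS : S.GivenBy hM) (hT : T.GivenBy hM) :
    (isoSetoid K L).r S T :=
  iso_of_range_eq S T (hS.trans hT.symm)

theorem GivenBy.of_iso {S T : HopfGaloisStructure K L} {M : Subgroup (Equiv.Perm (L ≃ₐ[K] L))}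
    {hM : IsRegularNormalised M} (hS : S.GivenBy hM) (h : (isoSetoid K L).r S T) :
    T.GivenBy hM := by
  refine Eq.trans ?_ hS
  obtain ⟨e, he⟩ := h
  ext f
  constructor
  · rintro ⟨k, rfl⟩
    exact ⟨e.symm k, by rw [← he, BialgEquiv.apply_symm_apply]⟩
  · rintro ⟨k, rfl⟩
    exact ⟨e k, by rw [he]⟩

end Iso

section Unique

variable {K : Type u} {L : Type v} [Field K] [Field L] [Algebra K L] [FiniteDimensional K L]
variable {M : Subgroup (Equiv.Perm (L ≃ₐ[K] L))} (hM : IsRegularNormalised M)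

/-- The coefficient function of an element of `L[M]`, with `M` identified with `G` through
`n ↦ n⁻¹(1)`. -/
noncomputable def coeffFun (c : MonoidAlgebra L M) (g : L ≃ₐ[K] L) : L :=
  c.coeff ⟨(hM.elt g)⁻¹, inv_mem (hM.elt_mem g)⟩

theorem actLin_eq_sum (c : MonoidAlgebra L M) (x : L) :
    actLin c x = ∑ g : L ≃ₐ[K] L, coeffFun hM c g * g x := by
  have := hM.finite
  have := Fintype.ofFinite M
  rw [actLin_apply, groupAlgebraAct, Finsupp.sum_fintype _ _ (by simp)]
  refine Fintype.sum_bijective _ hM.bijective_inv_apply_one _ _ fun n => ?_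
  rw [coeffFun]
  congr 3
  apply Subtype.ext
  rw [← inv_inv (n : Equiv.Perm (L ≃ₐ[K] L))]
  congr 1
  exact hM.eq_elt (inv_mem n.2) rfl

theorem coeffFun_eq_of_act_eq {M' : Subgroup (Equiv.Perm (L ≃ₐ[K] L))}
    (hM' : IsRegularNormalised M') {c : MonoidAlgebra L M} {c' : MonoidAlgebra L M'}
    (h : ∀ x, actLin c x = actLin c' x) : coeffFun hM c = coeffFun hM' c' := by
  have hli := (linearIndependent_toLinearMap K L L).comp
    (fun g : L ≃ₐ[K] L => (g : L →ₐ[K] L))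
    (fun n m hnm => AlgEquiv.ext fun x => DFunLike.congr_fun hnm x)
  rw [Fintype.linearIndependent_iff] at hli
  funext g
  have := hli (fun g => coeffFun hM c g - coeffFun hM' c' g) (by
    ext x
    have hx := h x
    rw [actLin_eq_sum hM, actLin_eq_sum hM', ← sub_eq_zero, ← Finset.sum_sub_distrib] at hx
    simpa [sub_mul] using hx) g
  exact sub_eq_zero.1 this

/-- Conjugating by the left translation of h the element of M that sends 1 to g gives the element
that sends 1 to h · n(h⁻¹), where n is the original one. Being fixed is thus equivariance for an
action of G on the set G, and this action encodes M. -/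
theorem coeffFun_equivariant {c : MonoidAlgebra L M} (hc : c ∈ fixed hM.conjAut)
    (g h : L ≃ₐ[K] L) : coeffFun hM c (h * hM.elt g h⁻¹) = h (coeffFun hM c g) := by
  rw [coeffFun, coeffFun, ← hc h]
  congr 1
  apply Subtype.ext
  rw [hM.conjAut_apply]
  change (hM.elt _)⁻¹ = Equiv.mulLeft h * (hM.elt g)⁻¹ * (Equiv.mulLeft h)⁻¹
  rw [inv_eq_iff_eq_inv]
  symm
  have : (Equiv.mulLeft h * (hM.elt g)⁻¹ * (Equiv.mulLeft h)⁻¹)⁻¹ =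
    Equiv.mulLeft h * hM.elt g * (Equiv.mulLeft h)⁻¹ := by group
  rw [this]
  refine hM.eq_elt (hM.normalised h _ (hM.elt_mem g)) ?_
  simp

/-- Fixed elements span L[M] over L, so two coefficient functionals that agree on them coincide. -/
theorem eq_of_coeffFun_eq {g h : L ≃ₐ[K] L}
    (hgh : ∀ c ∈ fixed hM.conjAut, coeffFun hM c g = coeffFun hM c h) : g = h := by
  classical
  let ev (g : L ≃ₐ[K] L) : MonoidAlgebra L M →ₗ[L] L :=
    (Finsupp.lapply ⟨(hM.elt g)⁻¹, inv_mem (hM.elt_mem g)⟩).comp (coeffLinearEquiv L).toLinearMap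
  have h0 := eq_zero_of_forall_fixed hM.conjAut (ev g - ev h) fun c hc =>
    sub_eq_zero.2 (hgh c hc)
  have h1 := LinearMap.congr_fun h0 (single ⟨(hM.elt g)⁻¹, inv_mem (hM.elt_mem g)⟩ 1)
  by_contra hne
  have hne' : hM.elt g ≠ hM.elt h := fun h => hne (by rw [← hM.elt_one g, h, hM.elt_one])
  simp [ev, hne'] at h1

/-- The operators determine the coefficient functions of the fixed elements. These separate the
points of G, so equivariance recovers the action of G on itself, and from it every element of M. -/
theorem GivenBy.unique {S : HopfGaloisStructure K L} {M' : Subgroup (Equiv.Perm (L ≃ₐ[K] L))}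
    {hM : IsRegularNormalised M} {hM' : IsRegularNormalised M'} (h : S.GivenBy hM)
    (h' : S.GivenBy hM') : M = M' := by
  have heq : groupAlgebraAct '' fixedElements hM = groupAlgebraAct '' fixedElements hM' :=
    h.symm.trans h'
  have helt : ∀ g k, hM.elt g k = hM'.elt g k := by
    intro g k
    have : k⁻¹ * hM.elt g k⁻¹⁻¹ = k⁻¹ * hM'.elt g k⁻¹⁻¹ := by
      refine eq_of_coeffFun_eq hM fun c hc => ?_
      obtain ⟨c', hc', hcc'⟩ := (Set.ext_iff.1 heq (groupAlgebraAct c)).1 ⟨c, hc, rfl⟩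
      have hf : coeffFun hM c = coeffFun hM' c' := coeffFun_eq_of_act_eq hM hM' fun x => by
        rw [actLin_apply, actLin_apply, hcc']
      rw [coeffFun_equivariant hM hc, hf, coeffFun_equivariant hM' hc']
    simpa using this
  have helt' : hM.elt = hM'.elt := funext fun g => Equiv.ext (helt g)
  ext n
  constructor
  · intro hn
    rw [hM.eq_elt hn rfl, helt']
    exact hM'.elt_mem _
  · intro hn
    rw [hM'.eq_elt hn rfl, ← helt']
    exact hM.elt_mem _

-- A type presupposes a subgroup that gives the structure, so only two facts are needed: every
-- subgroup occurs, and structures are isomorphic exactly when their subgroups agree.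
variable (K L) in
theorem number_eq [IsGalois K L] (N : Type w) [Group N] (r : ℕ) :
    number K L N r = Nat.card {M : Subgroup (Equiv.Perm (L ≃ₐ[K] L)) //
      ∃ hM : IsRegularNormalised M, Nonempty (M ≃* N) ∧ SkewBrace.thetaCard hM.Brace = r} := by
  symm
  refine Nat.card_eq_of_bijective (fun M => ⟨Quotient.mk _ (ofRegular M.2.choose),
    ofRegular M.2.choose, rfl, M.1, M.2.choose, givenBy_ofRegular _, M.2.choose_spec⟩) ⟨?_, ?_⟩
  · intro M M' h
    have h1 : (isoSetoid K L).r (ofRegular M.2.choose) (ofRegular M'.2.choose) :=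
      Quotient.exact (Subtype.ext_iff.1 h)
    exact Subtype.ext (((givenBy_ofRegular M.2.choose).of_iso h1).unique (givenBy_ofRegular _))
  · rintro ⟨q, S, rfl, M, hM, hS, h⟩
    refine ⟨⟨M, hM, h⟩, Subtype.ext (Quotient.sound ?_)⟩
    exact (givenBy_ofRegular _).iso hS

end Unique

end HopfGaloisStructure

/-! ### The λ-maps of a skew brace and invariance under isomorphism -/

namespace SkewBrace

section Lam

variable {B : Type*} [SkewBrace B]

theorem one_eq_zero : (1 : B) = 0 := by
  have h := brace_property (1 : B) 0 0
  simp only [one_mul, add_zero, zero_sub] at h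
  exact (neg_eq_zero.1 h.symm)

theorem lam_add (a b c : B) : lam a (b + c) = lam a b + lam a c := by
  simp only [lam, brace_property, sub_eq_add_neg, add_assoc]

theorem mul_eq_add_lam (a b : B) : a * b = a + lam a b := by simp [lam]

theorem lam_mul (a b c : B) : lam (a * b) c = lam a (lam b c) := by
  have h : lam a (-b) = -lam a b := by
    refine eq_neg_of_add_eq_zero_left ?_
    rw [← lam_add, neg_add_cancel]
    rw [lam, ← one_eq_zero, mul_one, one_eq_zero, neg_add_cancel]
  conv_rhs => rw [lam.eq_1 b c, lam_add, h, lam]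
  rw [lam, mul_assoc, mul_eq_add_lam a b, mul_eq_add_lam a (b * c), neg_add_rev]
  simp only [add_assoc, neg_add_cancel_left]

theorem lam_one (b : B) : lam 1 b = b := by
  rw [lam, one_mul, one_eq_zero, neg_zero, zero_add]

theorem _root_.RingEquiv.map_lam {B : Type*} {C : Type*} [SkewBrace B] [SkewBrace C] (e : B ≃+* C)
    (a b : B) : e (lam a b) = lam (e a) (e b) := by
  have h : e (a + lam a b) = e a + lam (e a) (e b) := by
    rw [← mul_eq_add_lam, ← mul_eq_add_lam, map_mul]
  rwa [map_add, add_right_inj] at h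

theorem thetaCard_congr {B : Type*} {C : Type*} [SkewBrace B] [SkewBrace C] (e : B ≃+* C) :
    thetaCard B = thetaCard C := by
  have hr : (fun f : B → B => e ∘ f ∘ e.symm) '' Set.range (lam : B → B → B) =
      Set.range (lam : C → C → C) := by
    ext f
    constructor
    · rintro ⟨_, ⟨a, rfl⟩, rfl⟩
      exact ⟨e a, funext fun c => by simp [e.map_lam]⟩
    · rintro ⟨c, rfl⟩
      exact ⟨lam (e.symm c), ⟨_, rfl⟩, funext fun c => by simp [e.map_lam]⟩
  rw [thetaCard, thetaCard, ← hr, Nat.card_image_of_injective]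
  intro f g hfg
  funext b
  have := congrFun hfg (e b)
  simpa using this

theorem IsBraceOf.congr {G N : Type*} [Group G] [Group N] {r : ℕ} {B : Type*} {C : Type*}
    [SkewBrace B] [SkewBrace C] (h : IsBraceOf G N r B) (e : B ≃+* C) : IsBraceOf G N r C :=
  ⟨h.1.map fun f => (e.symm : C ≃* B).trans f, h.2.1.map fun f => (e.symm : C ≃+ B).trans f,
    (thetaCard_congr e).symm.trans h.2.2⟩

end Lam

section ULift

variable (B : Type u) [SkewBrace B]

instance : SkewBrace (ULift.{v} B) where
  brace_property a b c := ULift.ext _ _ (brace_property a.down b.down c.down)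

/-- A skew brace is isomorphic to its lift to a higher universe. -/
def uliftEquiv : ULift.{v} B ≃+* B where
  toFun := ULift.down
  invFun := ULift.up
  left_inv _ := rfl
  right_inv _ := rfl
  map_mul' _ _ := rfl
  map_add' _ _ := rfl

end ULift

end SkewBrace

/-! ### Gamma functions, regular subgroups and isomorphisms of their braces -/

namespace Hol

open SkewBrace

variable {N : Type u} [Group N]

theorem isRegular_of_existsUnique {H : Subgroup (Hol N)}
    (h : ∀ n : N, ∃! g : Hol N, g ∈ H ∧ g.left = n) : IsRegular H := by
  have hact : ∀ g : Hol N, act g 1 = g.left := fun g => by simp [act]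
  intro x y
  obtain ⟨gx, ⟨hgx, hx⟩, -⟩ := h x
  obtain ⟨gy, ⟨hgy, hy⟩, hyu⟩ := h y
  refine ⟨gy * gx⁻¹, ⟨mul_mem hgy (inv_mem hgx), ?_⟩, ?_⟩
  · rw [← hx, ← hact, ← act_mul, inv_mul_cancel_right, hact, hy]
  · rintro g ⟨hg, hgxy⟩
    rw [← hyu (g * gx) ⟨mul_mem hg hgx, ?_⟩, mul_inv_cancel_right]
    rw [← hact, act_mul, hact, hx, hgxy]

/-- A gamma function on `N`: the map `λ` of a skew brace with additive group `N`. -/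
def IsGamma (γ : N → MulAut N) : Prop := ∀ n m, γ (n * γ n m) = γ n * γ m

namespace IsGamma

variable {γ : N → MulAut N} (h : IsGamma γ)

theorem map_one (h : IsGamma γ) : γ 1 = 1 := by
  have := h 1 1
  rw [_root_.map_one, mul_one] at this
  exact left_eq_mul.1 this

theorem map_inv (h : IsGamma γ) (n : N) : γ ((γ n)⁻¹ n⁻¹) = (γ n)⁻¹ := by
  have := h n ((γ n)⁻¹ n⁻¹)
  rw [MulAut.apply_inv_self, mul_inv_cancel, h.map_one] at this
  exact eq_inv_of_mul_eq_one_right this.symm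

/-- The regular subgroup of the holomorph attached to a gamma function. -/
def subgroup : Subgroup (Hol N) where
  carrier := {g | g.right = γ g.left}
  mul_mem' {x y} hx hy := by
    change (x * y).right = γ (x * y).left
    rw [SemidirectProduct.mul_left, SemidirectProduct.mul_right, MonoidHom.id_apply,
      Set.mem_ofPred.1 hx, Set.mem_ofPred.1 hy, h]
  one_mem' := h.map_one.symm
  inv_mem' {x} hx := by
    change (x⁻¹).right = γ (x⁻¹).left
    rw [SemidirectProduct.inv_left, SemidirectProduct.inv_right, MonoidHom.id_apply,
      Set.mem_ofPred.1 hx, h.map_inv]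

theorem mem_subgroup {g : Hol N} : g ∈ h.subgroup ↔ g.right = γ g.left := Iff.rfl

theorem isRegular : IsRegular h.subgroup :=
  isRegular_of_existsUnique fun n => ⟨⟨n, γ n⟩, ⟨rfl, rfl⟩, fun g hg =>
    SemidirectProduct.ext hg.2 (by rw [h.mem_subgroup.1 hg.1, hg.2])⟩

end IsGamma

namespace Brace

variable (H : Subgroup (Hol N)) (hH : IsRegular H)

/-- The map `λ` of the skew brace of `H`, with values in `Aut N`. -/
noncomputable def gamma (n : N) : MulAut N := (elt H hH n).right

theorem elt_eq (n : N) : elt H hH n = ⟨n, gamma H hH n⟩ :=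
  SemidirectProduct.ext (elt_left H hH n) rfl

theorem act_elt_eq (a b : N) : act (elt H hH a) b = a * gamma H hH a b := by
  rw [elt_eq, act]

theorem gamma_eq_of_mem {n : N} {α : MulAut N} (h : (⟨n, α⟩ : Hol N) ∈ H) :
    gamma H hH n = α := by
  have := eq_elt H hH h (a := n) (by simp [act])
  rw [gamma, ← this]

theorem mem_iff (g : Hol N) : g ∈ H ↔ g.right = gamma H hH g.left := by
  constructor
  · intro h
    exact (gamma_eq_of_mem H hH (n := g.left) (α := g.right) h).symm
  · intro h
    have : g = elt H hH g.left := by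
      rw [elt_eq]; exact SemidirectProduct.ext rfl h
    rw [this]
    exact elt_mem H hH _

variable {H}

theorem mul_of (a b : N) : of H hH a * of H hH b = of H hH (a * gamma H hH a b) :=
  congrArg (of H hH) (act_elt_eq H hH a b)

theorem add_of (a b : N) : of H hH a + of H hH b = of H hH (a * b) := rfl

theorem neg_of (a : N) : -of H hH a = of H hH a⁻¹ := rfl

theorem lam_of (a b : N) : lam (of H hH a) (of H hH b) = of H hH (gamma H hH a b) := by
  rw [lam, mul_of, neg_of, add_of, inv_mul_cancel_left]

/-- The additive group of the skew brace of `H` is `N`. -/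
def addEquiv : Brace H hH ≃+ Additive N where
  toFun x := Additive.ofMul ((of H hH).symm x)
  invFun x := of H hH x.toMul
  left_inv _ := rfl
  right_inv _ := rfl
  map_add' _ _ := rfl

/-- The multiplicative group of the skew brace of `H` is `H`. -/
noncomputable def mulEquiv : H ≃* Brace H hH where
  toFun g := of H hH g.1.left
  invFun x := ⟨elt H hH ((of H hH).symm x), elt_mem _ _ _⟩
  left_inv g := Subtype.ext (eq_elt H hH g.2 (by simp [act])).symm
  right_inv x := congrArg (of H hH) (elt_left H hH _)
  map_mul' g k := by
    rw [mul_of, ← (mem_iff H hH g.1).1 g.2]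
    rfl

theorem thetaCard_eq_card_range :
    thetaCard (Brace H hH) = Nat.card (Set.range (gamma H hH)) := by
  let F : MulAut N → (Brace H hH → Brace H hH) := fun α x => of H hH (α ((of H hH).symm x))
  have hF : Function.Injective F := fun α β hαβ => MulEquiv.ext fun n => congrFun hαβ (of H hH n)
  have hr : F '' Set.range (gamma H hH) = Set.range (lam : Brace H hH → _ → _) := by
    rw [← Set.range_comp]
    refine congrArg Set.range (funext fun n => funext fun x => ?_)
    exact (lam_of hH n x).symm
  rw [thetaCard, ← hr, Nat.card_image_of_injective hF]

theorem coe_map_Theta : (H.map (Theta N) : Set (MulAut N)) = Set.range (gamma H hH) := by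
  ext α
  constructor
  · rintro ⟨g, hg, rfl⟩
    exact ⟨g.left, ((mem_iff H hH g).1 hg).symm⟩
  · rintro ⟨n, rfl⟩
    exact ⟨elt H hH n, elt_mem _ _ _, rfl⟩

theorem card_map_Theta : Nat.card (H.map (Theta N)) = Nat.card (Set.range (gamma H hH)) :=
  Nat.card_congr (Equiv.setCongr (coe_map_Theta hH))

variable {H' : Subgroup (Hol N)} (hH' : IsRegular H')

/-- Isomorphisms between the skew braces of regular subgroups are automorphisms of `N`. -/
noncomputable def isoEquiv : (Brace H hH ≃+* Brace H' hH') ≃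
    {α : MulAut N // ∀ n, α * gamma H hH n = gamma H' hH' (α n) * α} where
  toFun e := ⟨MulEquiv.toAdditive.symm
      ((addEquiv hH).symm.trans ((e : Brace H hH ≃+ Brace H' hH').trans (addEquiv hH'))), by
    intro n
    ext m
    have := e.map_lam (of H hH n) (of H hH m)
    rw [lam_of] at this
    exact this.trans (lam_of hH' (e (of H hH n)) (e (of H hH m)))⟩
  invFun α :=
    { toFun := fun x => of H' hH' (α.1 ((of H hH).symm x))
      invFun := fun x => of H hH (α.1.symm ((of H' hH').symm x))
      left_inv := fun x => by simp
      right_inv := fun x => by simp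
      map_add' := fun x y => congrArg (of H' hH') (α.1.map_mul ((of H hH).symm x) ((of H hH).symm y))
      map_mul' := fun x y => by
        obtain ⟨x, rfl⟩ := (of H hH).surjective x
        obtain ⟨y, rfl⟩ := (of H hH).surjective y
        rw [mul_of]
        simp only [Equiv.symm_apply_apply]
        rw [mul_of, map_mul]
        have := MulEquiv.congr_fun (α.2 x) y
        simp only [MulAut.mul_apply] at this
        rw [this] }
  left_inv _ := rfl
  right_inv _ := rfl

theorem nonempty_iso_iff : Nonempty (Brace H hH ≃+* Brace H' hH') ↔
    ∃ α : MulAut N, ∀ n, α * gamma H hH n = gamma H' hH' (α n) * α :=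
  (isoEquiv hH hH').nonempty_congr.trans nonempty_subtype

end Brace

theorem IsGamma.gamma_eq {γ : N → MulAut N} (h : IsGamma γ) :
    Brace.gamma h.subgroup h.isRegular = γ :=
  funext fun _ => Brace.gamma_eq_of_mem _ _ (h.mem_subgroup.2 rfl)

/-- Every skew brace with additive group `N` comes from a gamma function on `N`. -/
theorem exists_isGamma_of_addEquiv {B : Type v} [SkewBrace B] (f : B ≃+ Additive N) :
    ∃ (γ : N → MulAut N) (h : IsGamma γ), Nonempty (B ≃+* Brace h.subgroup h.isRegular) := by
  let g : B ≃ N := f.toEquiv.trans Additive.toMul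
  have hg : ∀ x y, g (x + y) = g x * g y := fun x y => congrArg Additive.toMul (map_add f x y)
  obtain ⟨γ, hγ⟩ : ∃ γ : N → MulAut N, ∀ b c, γ (g b) (g c) = g (lam b c) := by
    refine ⟨fun n =>
      { toFun := fun m => g (lam (g.symm n) (g.symm m))
        invFun := fun m => g (lam (g.symm n)⁻¹ (g.symm m))
        left_inv := fun m => by simp [← lam_mul, lam_one]
        right_inv := fun m => by simp [← lam_mul, lam_one]
        map_mul' := fun m m' => ?_ }, fun b c => by simp⟩
    have : g.symm (m * m') = g.symm m + g.symm m' := by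
      apply g.injective; rw [hg]; simp
    rw [this, lam_add, hg]
  have hmul : ∀ b c, g (b * c) = g b * γ (g b) (g c) := fun b c => by
    rw [mul_eq_add_lam, hg, hγ]
  have h : IsGamma γ := by
    intro n m
    obtain ⟨b, rfl⟩ := g.surjective n
    obtain ⟨c, rfl⟩ := g.surjective m
    ext k
    obtain ⟨d, rfl⟩ := g.surjective k
    rw [← hmul, MulAut.mul_apply, hγ, hγ, hγ, lam_mul]
  have hmul' : ∀ x y, g.trans (Brace.of h.subgroup h.isRegular) (x * y) =
      g.trans (Brace.of h.subgroup h.isRegular) x * g.trans (Brace.of h.subgroup h.isRegular) y := by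
    intro x y
    have := Brace.mul_of h.isRegular (g x) (g y)
    rw [h.gamma_eq, ← hmul] at this
    exact this.symm
  have hadd : ∀ x y, g.trans (Brace.of h.subgroup h.isRegular) (x + y) =
      g.trans (Brace.of h.subgroup h.isRegular) x + g.trans (Brace.of h.subgroup h.isRegular) y :=
    fun x y => congrArg (Brace.of h.subgroup h.isRegular) (hg x y)
  exact ⟨γ, h, ⟨⟨g.trans (Brace.of h.subgroup h.isRegular), hmul', hadd⟩⟩⟩

end Hol

/-! ### Exponential coordinates on M₁ and its automorphism group -/

namespace Heis

variable {p : ℕ} [Fact p.Prime] [Fact (3 < p)]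

/-- The coordinate of `ρ` in exponential coordinates. -/
def X (n : Heis p) : ZMod p := n.a - n.b * n.c / 2

theorem ext_X {n m : Heis p} (hX : X n = X m) (hb : n.b = m.b) (hc : n.c = m.c) : n = m := by
  refine Heis.ext ?_ hb hc
  rw [X, X, hb, hc] at hX
  exact sub_left_injective hX

/-- The element with given exponential coordinates. -/
def mk' (x b c : ZMod p) : Heis p := ⟨x + b * c / 2, b, c⟩

@[simp] theorem X_mk' (x b c : ZMod p) : X (mk' x b c) = x := by simp [X, mk']
@[simp] theorem mk'_b (x b c : ZMod p) : (mk' x b c).b = b := rfl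
@[simp] theorem mk'_c (x b c : ZMod p) : (mk' x b c).c = c := rfl

/-- The cocycle is alternating in this coordinate, so a matrix acts linearly and merely scales `X`
by its determinant; the quadratic terms in `lin` disappear (`X_aut`). -/
theorem X_mul (n m : Heis p) : X (n * m) = X n + X m + (n.c * m.b - n.b * m.c) / 2 := by
  have := two_ne_zero' (p := p)
  simp only [X, mul_a, mul_b, mul_c]
  field_simp
  ring

theorem X_inv (n : Heis p) : X n⁻¹ = -X n := by
  have := two_ne_zero' (p := p)
  simp only [X, inv_a, inv_b, inv_c]
  field_simp
  ring

@[simp] theorem X_rho : X (rho p) = 1 := by simp [X, rho]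
@[simp] theorem X_sigma : X (sigma p) = 0 := by simp [X, sigma]
@[simp] theorem X_tau : X (tau p) = 0 := by simp [X, tau]

/-- The inner automorphism with `σ ↦ ρ ^ r₁ * σ`, `τ ↦ ρ ^ r₃ * τ`. -/
def inner (r₁ r₃ : ZMod p) : MulAut (Heis p) where
  toFun n := ⟨n.a + (r₁ * n.b + r₃ * n.c), n.b, n.c⟩
  invFun n := ⟨n.a - (r₁ * n.b + r₃ * n.c), n.b, n.c⟩
  left_inv n := by ext <;> simp
  right_inv n := by ext <;> simp
  map_mul' n m := by ext <;> simp; ring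

theorem alpha1_pow (r : ℕ) : alpha1 p ^ r = inner (r : ZMod p) 0 := by
  induction r with
  | zero => ext n <;> simp [inner]
  | succ r ih =>
    rw [pow_succ, ih]
    ext n <;> simp [inner, alpha1]
    ring

theorem alpha3_pow (r : ℕ) : alpha3 p ^ r = inner 0 (r : ZMod p) := by
  induction r with
  | zero => ext n <;> simp [inner]
  | succ r ih =>
    rw [pow_succ, ih]
    ext n <;> simp [inner, alpha3]
    ring

/-- The automorphism `α₁ ^ r₁ * α₃ ^ r₃ * β`. -/
noncomputable def aut (r₁ r₃ : ZMod p) (β : GL (Fin 2) (ZMod p)) : MulAut (Heis p) :=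
  inner r₁ r₃ * autGL β

theorem aut_natCast (r₁ r₃ : ℕ) (β : GL (Fin 2) (ZMod p)) :
    aut (r₁ : ZMod p) (r₃ : ZMod p) β = alpha1 p ^ r₁ * alpha3 p ^ r₃ * autGL β := by
  rw [alpha1_pow, alpha3_pow, aut]
  congr 1
  ext n <;> simp [inner]
  ring

section aut

variable (r₁ r₃ : ZMod p) (β : GL (Fin 2) (ZMod p)) (n : Heis p)

theorem aut_b : (aut r₁ r₃ β n).b = β.1 0 0 * n.b + β.1 0 1 * n.c := rfl

theorem aut_c : (aut r₁ r₃ β n).c = β.1 1 0 * n.b + β.1 1 1 * n.c := rfl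

theorem X_aut : X (aut r₁ r₃ β n) = (β.1 0 0 * β.1 1 1 - β.1 0 1 * β.1 1 0) * X n +
    r₁ * (β.1 0 0 * n.b + β.1 0 1 * n.c) + r₃ * (β.1 1 0 * n.b + β.1 1 1 * n.c) := by
  have := two_ne_zero' (p := p)
  have ha : (aut r₁ r₃ β n).a = (lin β.1 n).a +
    (r₁ * (β.1 0 0 * n.b + β.1 0 1 * n.c) + r₃ * (β.1 1 0 * n.b + β.1 1 1 * n.c)) := rfl
  rw [X, aut_b, aut_c, ha, lin, X, Matrix.det_fin_two]
  field_simp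
  ring

theorem det_ne_zero : β.1 0 0 * β.1 1 1 - β.1 0 1 * β.1 1 0 ≠ 0 := by
  rw [← Matrix.det_fin_two]
  exact ((Matrix.isUnit_iff_isUnit_det _).1 β.isUnit).ne_zero

end aut

/-- The invertible matrix with given entries. -/
noncomputable def mat (x y z w : ZMod p) (h : x * w - y * z ≠ 0) : GL (Fin 2) (ZMod p) :=
  Matrix.GeneralLinearGroup.mkOfDetNeZero !![x, y; z, w] (by rwa [Matrix.det_fin_two_of])

theorem coe_mat (x y z w : ZMod p) (h : x * w - y * z ≠ 0) :
    (mat x y z w h).1 = !![x, y; z, w] := rfl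

/-- ρ is the commutator of τ and σ, so it is scaled by the determinant of the induced map on the
quotient by the centre. -/
theorem aut_rho (α : MulAut (Heis p)) : α (rho p) =
    mk' ((α (sigma p)).b * (α (tau p)).c - (α (tau p)).b * (α (sigma p)).c) 0 0 := by
  have h : rho p = tau p * sigma p * (tau p)⁻¹ * (sigma p)⁻¹ := by
    rw [tau_sigma]; group
  conv_lhs => rw [h]
  simp only [map_mul, map_inv]
  have := two_ne_zero' (p := p)
  refine ext_X ?_ (by simp) (by simp)
  simp only [X_mul, X_inv, mul_b, mul_c, inv_b, inv_c, X_mk']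
  field_simp
  ring

theorem mulAut_ext {α β : MulAut (Heis p)} (hs : α (sigma p) = β (sigma p))
    (ht : α (tau p) = β (tau p)) : α = β := by
  have hr : α (rho p) = β (rho p) := by rw [aut_rho, aut_rho, hs, ht]
  refine MulEquiv.ext fun n => ?_
  rw [normal_form n]
  simp only [map_mul, map_pow, hs, ht, hr]

theorem exists_eq_aut (α : MulAut (Heis p)) : ∃ r₁ r₃ β, α = aut r₁ r₃ β := by
  have hD : (α (sigma p)).b * (α (tau p)).c - (α (tau p)).b * (α (sigma p)).c ≠ 0 := by
    intro h
    have h1 := aut_rho α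
    rw [h] at h1
    have h2 : mk' 0 0 0 = (1 : Heis p) := by ext <;> simp [mk']
    rw [h2] at h1
    have h3 := (map_eq_one_iff α α.injective).1 h1
    have := congrArg X h3
    simp [X] at this
    simp [rho] at this
  set s := α (sigma p) with hs
  set t := α (tau p) with ht
  set D := s.b * t.c - t.b * s.c with hDdef
  -- Cramer's rule for r₁ · b + r₃ · c = X at the images of σ and τ, as `X_aut` requires.
  refine ⟨(X s * t.c - X t * s.c) / D, (X t * s.b - X s * t.b) / D,
    mat s.b t.b s.c t.c hD, mulAut_ext ?_ ?_⟩
  · rw [← hs]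
    refine ext_X ?_ ?_ ?_
    · rw [X_aut]
      simp [coe_mat, sigma, X]
      field_simp
      rw [hDdef]
      ring
    · simp [aut_b, coe_mat, sigma]
    · simp [aut_c, coe_mat, sigma]
  · rw [← ht]
    refine ext_X ?_ ?_ ?_
    · rw [X_aut]
      simp [coe_mat, tau, X]
      field_simp
      rw [hDdef]
      ring
    · simp [aut_b, coe_mat, tau]
    · simp [aut_c, coe_mat, tau]

theorem aut_injective {r₁ r₃ s₁ s₃ : ZMod p} {β β' : GL (Fin 2) (ZMod p)}
    (h : aut r₁ r₃ β = aut s₁ s₃ β') : r₁ = s₁ ∧ r₃ = s₃ ∧ β = β' := by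
  have hs : aut r₁ r₃ β (sigma p) = aut s₁ s₃ β' (sigma p) := by rw [h]
  have ht : aut r₁ r₃ β (tau p) = aut s₁ s₃ β' (tau p) := by rw [h]
  have h00 := congrArg Heis.b hs
  have h10 := congrArg Heis.c hs
  have h01 := congrArg Heis.b ht
  have h11 := congrArg Heis.c ht
  have hXs := congrArg X hs
  have hXt := congrArg X ht
  simp only [aut_b, aut_c, X_aut, X_sigma, X_tau] at h00 h01 h10 h11 hXs hXt
  simp only [sigma, tau, mul_one, mul_zero, add_zero, zero_add] at h00 h01 h10 h11 hXs hXt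
  have hβ : β = β' := by
    ext i j
    fin_cases i <;> fin_cases j <;> assumption
  have hD := det_ne_zero β
  subst hβ
  refine ⟨?_, ?_, rfl⟩
  · apply mul_left_cancel₀ hD
    linear_combination β.1 1 1 * hXs - β.1 1 0 * hXt
  · apply mul_left_cancel₀ hD
    linear_combination β.1 0 0 * hXt - β.1 0 1 * hXs

/-- The parametrization of the automorphism group. -/
noncomputable def autEquiv : ZMod p × ZMod p × GL (Fin 2) (ZMod p) ≃ MulAut (Heis p) :=
  Equiv.ofBijective (fun t => aut t.1 t.2.1 t.2.2)
    ⟨fun s t h => by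
      obtain ⟨h1, h2, h3⟩ := aut_injective h
      exact Prod.ext h1 (Prod.ext h2 h3),
    fun α => by
      obtain ⟨r₁, r₃, β, rfl⟩ := exists_eq_aut α
      exact ⟨(r₁, r₃, β), rfl⟩⟩

variable (p) in
theorem card_mulAut : Nat.card (MulAut (Heis p)) = p ^ 2 * ((p ^ 2 - 1) * (p ^ 2 - p)) := by
  rw [← Nat.card_congr autEquiv, Nat.card_prod, Nat.card_prod, Nat.card_zmod,
    Matrix.card_GL_field, Fin.prod_univ_two]
  simp
  ring

/-- The automorphism with `X ↦ X + l₁ b + l₂ c` and matrix with rows `(1, 0)`, `(k, 1)`. -/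
def unip (l₁ l₂ k : ZMod p) : MulAut (Heis p) where
  toFun n := ⟨n.a + k * n.b ^ 2 / 2 + l₁ * n.b + l₂ * n.c, n.b, n.c + k * n.b⟩
  invFun n := ⟨n.a - k * n.b ^ 2 / 2 - l₁ * n.b - l₂ * (n.c - k * n.b), n.b, n.c - k * n.b⟩
  left_inv n := by
    ext <;> simp
    ring
  right_inv n := by
    ext <;> simp
    ring
  map_mul' n m := by
    have := two_ne_zero' (p := p)
    ext <;> simp
    · field_simp; ring
    · ring

@[simp] theorem unip_b (l₁ l₂ k : ZMod p) (n : Heis p) : (unip l₁ l₂ k n).b = n.b := rfl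

@[simp] theorem unip_c (l₁ l₂ k : ZMod p) (n : Heis p) : (unip l₁ l₂ k n).c = n.c + k * n.b := rfl

@[simp] theorem X_unip (l₁ l₂ k : ZMod p) (n : Heis p) :
    X (unip l₁ l₂ k n) = X n + l₁ * n.b + l₂ * n.c := by
  have := two_ne_zero' (p := p)
  simp [X, unip]
  field_simp
  ring

theorem unip_mul (l₁ l₂ k m₁ m₂ j : ZMod p) :
    unip l₁ l₂ k * unip m₁ m₂ j = unip (l₁ + m₁ + l₂ * j) (l₂ + m₂) (k + j) := by
  refine MulEquiv.ext fun n => ext_X ?_ ?_ ?_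
  · simp; ring
  · simp
  · simp; ring

theorem unip_zero : unip 0 0 0 = (1 : MulAut (Heis p)) :=
  MulEquiv.ext fun n => ext_X (by simp) (by simp) (by simp)

theorem unip_injective {l₁ l₂ k m₁ m₂ j : ZMod p} (h : unip l₁ l₂ k = unip m₁ m₂ j) :
    l₁ = m₁ ∧ l₂ = m₂ ∧ k = j := by
  have hs : unip l₁ l₂ k (sigma p) = unip m₁ m₂ j (sigma p) := by rw [h]
  have ht : unip l₁ l₂ k (tau p) = unip m₁ m₂ j (tau p) := by rw [h]
  have h1 := congrArg X hs
  have h2 := congrArg X ht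
  have h3 := congrArg Heis.c hs
  simp only [X_unip, unip_c] at h1 h2 h3
  simp [sigma, tau] at h1 h2 h3
  exact ⟨by simpa using h1, by simpa using h2, h3⟩

/-- It suffices to compare values on σ and τ. The parameter r₁ enters only through a multiple of
β₀₁k, which vanishes. For k = j = 0 the conditions reduce to det(β) l = βᵀ m, which turns
equivalence of linear gamma functions into a rescaled congruence of bilinear forms. -/
theorem aut_mul_unip_iff (r₁ r₃ l₁ l₂ k m₁ m₂ j : ZMod p) (β : GL (Fin 2) (ZMod p)) :
    aut r₁ r₃ β * unip l₁ l₂ k = unip m₁ m₂ j * aut r₁ r₃ β ↔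
      β.1 0 1 * k = 0 ∧ β.1 1 1 * k = j * β.1 0 0 ∧ j * β.1 0 1 = 0 ∧
      (β.1 0 0 * β.1 1 1 - β.1 0 1 * β.1 1 0) * l₁ + r₃ * β.1 1 1 * k =
        m₁ * β.1 0 0 + m₂ * β.1 1 0 ∧
      (β.1 0 0 * β.1 1 1 - β.1 0 1 * β.1 1 0) * l₂ = m₁ * β.1 0 1 + m₂ * β.1 1 1 := by
  constructor
  · intro h
    have hs := DFunLike.congr_fun h (sigma p)
    have ht := DFunLike.congr_fun h (tau p)
    have h1 := congrArg Heis.b hs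
    have h2 := congrArg Heis.c hs
    have h3 := congrArg Heis.c ht
    have h4 := congrArg X hs
    have h5 := congrArg X ht
    simp only [MulAut.mul_apply, aut_b, aut_c, X_aut, X_unip, unip_b, unip_c, X_sigma, X_tau]
      at h1 h2 h3 h4 h5
    simp only [sigma, tau, mul_one, mul_zero, add_zero, zero_add] at h1 h2 h3 h4 h5
    have h1' : β.1 0 1 * k = 0 := by linear_combination h1
    refine ⟨h1', by linear_combination h2, by linear_combination -h3, ?_, ?_⟩
    · linear_combination h4 - r₁ * h1'
    · linear_combination h5
  · rintro ⟨h1, h2, h3, h4, h5⟩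
    refine MulEquiv.ext fun n => ext_X ?_ ?_ ?_
    · simp only [MulAut.mul_apply, aut_b, aut_c, X_aut, X_unip, unip_b, unip_c]
      linear_combination n.b * h4 + n.c * h5 + r₁ * n.b * h1
    · simp only [MulAut.mul_apply, aut_b, unip_b, unip_c]
      linear_combination n.b * h1
    · simp only [MulAut.mul_apply, aut_b, aut_c, unip_b, unip_c]
      linear_combination n.b * h2 - n.c * h3

end Heis

/-! ### The gamma functions of the three families and their multiplicative groups -/

namespace Heis

variable {p : ℕ} [Fact p.Prime] [Fact (3 < p)]

theorem three_ne_zero' : (3 : ZMod p) ≠ 0 := by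
  have h3 : 3 < p := Fact.out
  intro h
  have : ((3 : ℕ) : ZMod p) = 0 := by exact_mod_cast h
  rw [ZMod.natCast_eq_zero_iff] at this
  have := Nat.le_of_dvd (by norm_num) this
  omega

namespace Param

/-- The parameters for which the subgroup is regular. -/
def Valid : Param p → Prop
  | .A _ u₃ => u₃ ≠ 0
  | .B v₂ => v₂ ≠ 0
  | .C x₃ _ => x₃ ≠ 0

/-- The gamma function of the subgroup with the given parameters. -/
def gam : Param p → Heis p → MulAut (Heis p)
  | .A u₂ u₃, n => unip (n.b - u₂ / u₃ * n.c) (n.c / u₃) 0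
  | .B v₂, n => unip (-n.c / v₂) (n.b / v₂) 0
  | .C x₃ a, n => unip ((a - x₃⁻¹) / 2 * n.b ^ 2 + (x₃⁻¹ - a - 1) / 2 * n.b + x₃⁻¹ * n.c)
      (a * n.b) n.b

theorem isGamma_gam (t : Param p) : Hol.IsGamma t.gam := by
  have := two_ne_zero' (p := p)
  intro n m
  cases t with
  | A u₂ u₃ =>
    simp only [gam, unip_mul, mul_b, mul_c, unip_b, unip_c]
    congr 1 <;> ring
  | B v₂ =>
    simp only [gam, unip_mul, mul_b, mul_c, unip_b, unip_c]
    congr 1 <;> ring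
  | C x₃ a =>
    simp only [gam, unip_mul, mul_b, mul_c, unip_b, unip_c]
    congr 1
    · field_simp; ring
    · ring

/-- The second additive coordinate on the multiplicative group. -/
def cc : Param p → Heis p → ZMod p
  | .A _ _, n => n.c
  | .B _, n => n.c
  | .C _ _, n => n.c - n.b ^ 2 / 2

/-- The correction making the cocycle of the multiplicative group alternating. -/
def corr : Param p → Heis p → ZMod p
  | .A u₂ u₃, n => (n.b ^ 2 - u₂ / u₃ * n.b * n.c + n.c ^ 2 / u₃) / 2
  | .B _, _ => 0
  | .C x₃ a, n => (a / 2 - 1 / 4) * n.b ^ 3 / 3 + (x₃⁻¹ - a - 1) / 2 * n.b ^ 2 / 2 +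
      (x₃⁻¹ + a) / 2 * n.b * (n.c - n.b ^ 2 / 2)

/-- The alternating part of the cocycle of the multiplicative group. -/
def kappa : Param p → ZMod p
  | .A u₂ u₃ => 1 - u₂ / u₃
  | .B v₂ => 1 - 2 / v₂
  | .C x₃ a => 1 + x₃⁻¹ - a

theorem cc_mul (t : Param p) (n m : Heis p) : t.cc (n * t.gam n m) = t.cc n + t.cc m := by
  have := two_ne_zero' (p := p)
  cases t with
  | A u₂ u₃ => simp [cc, gam]
  | B v₂ => simp [cc, gam]
  | C x₃ a =>
    simp [cc, gam]
    field_simp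
    ring

theorem b_mul (t : Param p) (n m : Heis p) : (n * t.gam n m).b = n.b + m.b := by
  cases t <;> simp [gam]

/-- The cocycle of the brace multiplication splits into a coboundary, that of `corr`, and a multiple
of the standard alternating cocycle. For family C the correction is cubic, which is why 3 has to be
invertible. -/
theorem X_sub_corr_mul (t : Param p) (n m : Heis p) :
    X (n * t.gam n m) - t.corr (n * t.gam n m) = (X n - t.corr n) + (X m - t.corr m) +
      t.kappa * ((t.cc n * m.b - n.b * t.cc m) / 2) := by
  have h2 := two_ne_zero' (p := p)
  have h3 := three_ne_zero' (p := p)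
  have h4 : (4 : ZMod p) ≠ 0 := by
    have : (4 : ZMod p) = 2 * 2 := by norm_num
    rw [this]; exact mul_ne_zero h2 h2
  cases t with
  | A u₂ u₃ =>
    simp only [gam, corr, kappa, cc, X_mul, mul_b, mul_c, unip_b, unip_c, X_unip, div_eq_mul_inv]
    generalize u₃⁻¹ = e
    field_simp
    ring
  | B v₂ =>
    simp only [gam, corr, kappa, cc, X_mul, unip_b, unip_c, X_unip, div_eq_mul_inv]
    generalize v₂⁻¹ = e
    field_simp
    ring
  | C x₃ a =>
    simp only [gam, corr, kappa, cc, X_mul, mul_b, mul_c, unip_b, unip_c, X_unip]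
    generalize x₃⁻¹ = e
    field_simp
    ring

theorem IsHeis.valid {t : Param p} (h : t.IsHeis) : t.Valid := by
  cases t with
  | A u₂ u₃ => exact h.1
  | B v₂ => exact h.1
  | C x₃ a => exact h.1

theorem IsElem.valid {t : Param p} (h : t.IsElem) : t.Valid := by
  cases t with
  | A u₂ u₃ => exact h.1
  | B v₂ => exact (show v₂ = 2 from h) ▸ two_ne_zero'
  | C x₃ a => exact h.1

theorem isHeis_or_isElem {t : Param p} (h : t.Valid) : t.IsHeis ∨ t.IsElem := by
  cases t with
  | A u₂ u₃ => exact (em (u₂ = u₃)).symm.imp (fun h' => ⟨h, h'⟩) fun h' => ⟨h, h'⟩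
  | B v₂ => exact (em (v₂ = 2)).symm.imp (fun h' => ⟨h, h'⟩) fun h' => h'
  | C x₃ a => exact (em (a * x₃ = 1 + x₃)).symm.imp (fun h' => ⟨h, h'⟩) fun h' => ⟨h, h'⟩

theorem IsHeis.kappa_ne_zero {t : Param p} (h : t.IsHeis) : t.kappa ≠ 0 := by
  cases t with
  | A u₂ u₃ =>
    obtain ⟨h1, h2⟩ := h
    intro h0
    rw [kappa, sub_eq_zero, eq_div_iff h1, one_mul] at h0
    exact h2 h0.symm
  | B v₂ =>
    obtain ⟨h1, h2⟩ := h
    intro h0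
    rw [kappa, sub_eq_zero, eq_div_iff h1, one_mul] at h0
    exact h2 h0
  | C x₃ a =>
    obtain ⟨h1, h2⟩ := h
    intro h0
    apply h2
    have : x₃⁻¹ * x₃ = 1 := inv_mul_cancel₀ h1
    rw [kappa] at h0
    linear_combination this - x₃ * h0

theorem IsElem.kappa_eq_zero {t : Param p} (h : t.IsElem) : t.kappa = 0 := by
  cases t with
  | A u₂ u₃ =>
    obtain ⟨h1, h2⟩ := h
    rw [kappa, h2, div_self h1, sub_self]
  | B v₂ =>
    have h1 : v₂ = 2 := h
    rw [kappa, h1, div_self two_ne_zero', sub_self]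
  | C x₃ a =>
    obtain ⟨h1, h2⟩ := h
    have : x₃⁻¹ * x₃ = 1 := inv_mul_cancel₀ h1
    rw [kappa]
    linear_combination -x₃⁻¹ * h2 + (a - 1) * this

/-- The coordinates in which the multiplicative group becomes the Heisenberg group or `C_p³`. -/
theorem coord_injective (t : Param p) {n m : Heis p} (hb : n.b = m.b) (hc : t.cc n = t.cc m)
    (hX : X n - t.corr n = X m - t.corr m) : n = m := by
  have hc' : n.c = m.c := by
    cases t with
    | A u₂ u₃ => exact hc
    | B v₂ => exact hc
    | C x₃ a => simpa [cc, hb] using hc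
  have hQ : t.corr n = t.corr m := by cases t <;> simp [corr, hb, hc']
  exact ext_X (by rw [hQ] at hX; exact sub_left_injective hX) hb hc'

instance : Finite (Heis p) := Nat.finite_of_card_ne_zero (by
  rw [card_heis]
  exact pow_ne_zero _ (Fact.out : p.Prime).ne_zero)

theorem card_elemAb3 : Nat.card (ElemAb3 p) = p ^ 3 := by
  have : Nat.card (Multiplicative (ZMod p)) = p :=
    (Nat.card_congr Multiplicative.toAdd).trans (Nat.card_zmod p)
  simp

variable {H : Subgroup (Hol (Heis p))} (hH : Hol.IsRegular H)

/-- Dividing the corrected central coordinate by `kappa` normalises the cocycle to the one in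
`X_mul`. -/
theorem nonempty_mulEquiv_heis {t : Param p} (ht : t.IsHeis)
    (hg : Hol.Brace.gamma H hH = t.gam) : Nonempty (Hol.Brace H hH ≃* Heis p) := by
  have hk := ht.kappa_ne_zero
  let f : Hol.Brace H hH →* Heis p := MonoidHom.mk'
    (fun n => mk' ((X ((Hol.Brace.of H hH).symm n) - t.corr ((Hol.Brace.of H hH).symm n)) / t.kappa)
      ((Hol.Brace.of H hH).symm n).b (t.cc ((Hol.Brace.of H hH).symm n))) fun n m => by
      obtain ⟨n, rfl⟩ := (Hol.Brace.of H hH).surjective n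
      obtain ⟨m, rfl⟩ := (Hol.Brace.of H hH).surjective m
      rw [Hol.Brace.mul_of, hg]
      simp only [Equiv.symm_apply_apply]
      refine ext_X ?_ ?_ ?_
      · rw [X_mk', X_sub_corr_mul, X_mul (mk' _ _ _), X_mk', X_mk']
        simp only [mk'_b, mk'_c]
        field_simp
      · rw [mk'_b, b_mul]; rfl
      · rw [mk'_c, cc_mul]; rfl
  have hf : Function.Injective f := by
    intro n m h
    have h1 := congrArg X h
    have h2 := congrArg Heis.b h
    have h3 := congrArg Heis.c h
    simp only [f, MonoidHom.mk'_apply, X_mk', mk'_b, mk'_c] at h1 h2 h3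
    apply (Hol.Brace.of H hH).symm.injective
    exact t.coord_injective h2 h3 ((div_left_inj' hk).1 h1)
  have : Finite (Hol.Brace H hH) := inferInstanceAs (Finite (Heis p))
  refine ⟨MulEquiv.ofBijective f ⟨hf, ?_⟩⟩
  exact Finite.injective_iff_surjective (α := Heis p) (f := f) |>.1 hf

theorem nonempty_mulEquiv_elemAb3 {t : Param p} (ht : t.IsElem)
    (hg : Hol.Brace.gamma H hH = t.gam) : Nonempty (Hol.Brace H hH ≃* ElemAb3 p) := by
  let f : Hol.Brace H hH →* ElemAb3 p := MonoidHom.mk'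
    (fun n => ![.ofAdd (X ((Hol.Brace.of H hH).symm n) - t.corr ((Hol.Brace.of H hH).symm n)),
      .ofAdd ((Hol.Brace.of H hH).symm n).b, .ofAdd (t.cc ((Hol.Brace.of H hH).symm n))])
    fun n m => by
      obtain ⟨n, rfl⟩ := (Hol.Brace.of H hH).surjective n
      obtain ⟨m, rfl⟩ := (Hol.Brace.of H hH).surjective m
      rw [Hol.Brace.mul_of, hg]
      simp only [Equiv.symm_apply_apply]
      rw [X_sub_corr_mul, b_mul, cc_mul, ht.kappa_eq_zero, zero_mul, add_zero]
      funext i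
      fin_cases i <;> rfl
  have hf : Function.Injective f := by
    intro n m h
    apply (Hol.Brace.of H hH).symm.injective
    exact t.coord_injective (congrFun h 1) (congrFun h 2) (congrFun h 0)
  have : Finite (Hol.Brace H hH) := inferInstanceAs (Finite (Heis p))
  refine ⟨MulEquiv.ofBijective f ((Nat.bijective_iff_injective_and_card f).2 ⟨hf, ?_⟩)⟩
  rw [card_elemAb3]
  exact card_heis p

theorem card_range_gam {t : Param p} (ht : t.Valid) : Nat.card (Set.range t.gam) = p ^ 2 := by
  have h2 := two_ne_zero' (p := p)
  let g : ZMod p × ZMod p → MulAut (Heis p) := fun v => t.gam ⟨0, v.1, v.2⟩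
  have hr : Set.range t.gam = Set.range g := by
    ext α
    constructor
    · rintro ⟨n, rfl⟩
      exact ⟨(n.b, n.c), by cases t <;> rfl⟩
    · rintro ⟨v, rfl⟩
      exact ⟨_, rfl⟩
  have hg : Function.Injective g := by
    rintro ⟨b, c⟩ ⟨b', c'⟩ h
    cases t with
    | A u₂ u₃ =>
      obtain ⟨h1, h2, -⟩ := unip_injective h
      have hc : c = c' := (div_left_inj' ht).1 h2
      subst hc
      exact Prod.ext (sub_left_injective h1) rfl
    | B v₂ =>
      obtain ⟨h1, h2, -⟩ := unip_injective h
      exact Prod.ext ((div_left_inj' ht).1 h2) (neg_injective ((div_left_inj' ht).1 h1))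
    | C x₃ a =>
      obtain ⟨h1, -, h3⟩ := unip_injective h
      have hb : b = b' := h3
      subst hb
      exact Prod.ext rfl (mul_left_cancel₀ (inv_ne_zero ht) (add_left_cancel h1))
  rw [hr, Nat.card_congr (Equiv.ofInjective g hg).symm, Nat.card_prod, Nat.card_zmod, sq]

theorem exists_nsmul_eq {x y z w : ZMod p} (h : x * w - y * z ≠ 0) (b c : ZMod p) :
    ∃ i j : ℕ, (i : ZMod p) * x + j * y = b ∧ (i : ZMod p) * z + j * w = c := by
  obtain ⟨i, hi⟩ := ZMod.natCast_zmod_surjective ((b * w - y * c) / (x * w - y * z))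
  obtain ⟨j, hj⟩ := ZMod.natCast_zmod_surjective ((x * c - b * z) / (x * w - y * z))
  refine ⟨i, j, ?_, ?_⟩ <;> rw [hi, hj]
  all_goals
    rw [div_mul_eq_mul_div, div_mul_eq_mul_div, ← add_div, div_eq_iff h]
    ring

/-- The group of a gamma function is generated by `ρ` and two elements whose additive coordinates
are independent. -/
theorem subgroup_le_of_generators (t : Param p) {H : Subgroup (Hol (Heis p))}
    (hρ : hol (rho p) 1 ∈ H) {n m : Heis p} (hn : hol n (t.gam n) ∈ H) (hm : hol m (t.gam m) ∈ H)
    (hnm : n.b * t.cc m - m.b * t.cc n ≠ 0) : t.isGamma_gam.subgroup ≤ H := by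
  set S := t.isGamma_gam.subgroup with hS
  have hb : ∀ {g h : Hol (Heis p)}, g ∈ S → (g * h).left.b = g.left.b + h.left.b := by
    intro g h hg
    rw [SemidirectProduct.mul_left, MonoidHom.id_apply, t.isGamma_gam.mem_subgroup.1 hg, b_mul]
  have hc : ∀ {g h : Hol (Heis p)}, g ∈ S → t.cc (g * h).left = t.cc g.left + t.cc h.left := by
    intro g h hg
    rw [SemidirectProduct.mul_left, MonoidHom.id_apply, t.isGamma_gam.mem_subgroup.1 hg, cc_mul]
  have hc1 : t.cc 1 = 0 := by cases t <;> simp [cc]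
  have hpow : ∀ {g : Hol (Heis p)}, g ∈ S → ∀ i : ℕ, (g ^ i).left.b = i * g.left.b ∧
      t.cc (g ^ i).left = i * t.cc g.left := by
    intro g hg i
    induction i with
    | zero => simp [hc1]
    | succ i ih =>
      rw [pow_succ, hb (pow_mem hg i), hc (pow_mem hg i), ih.1, ih.2]
      push_cast
      constructor <;> ring
  have hnS : hol n (t.gam n) ∈ S := rfl
  have hmS : hol m (t.gam m) ∈ S := rfl
  intro g hg
  obtain ⟨i, j, hi, hj⟩ := exists_nsmul_eq hnm g.left.b (t.cc g.left)
  set k := hol n (t.gam n) ^ i * hol m (t.gam m) ^ j with hk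
  have hkS : k ∈ S := mul_mem (pow_mem hnS i) (pow_mem hmS j)
  have hkH : k ∈ H := mul_mem (pow_mem hn i) (pow_mem hm j)
  have hkb : k.left.b = g.left.b := by
    rw [hk, hb (pow_mem hnS i), (hpow hnS i).1, (hpow hmS j).1]; exact hi
  have hkc : t.cc k.left = t.cc g.left := by
    rw [hk, hc (pow_mem hnS i), (hpow hnS i).2, (hpow hmS j).2]; exact hj
  -- The quotient has trivial coordinates modulo the centre. The gamma function is trivial there, so
  -- the quotient is a power of ρ.
  set r := g * k⁻¹ with hr
  have hrS : r ∈ S := mul_mem hg (inv_mem hkS)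
  have hrk : r * k = g := inv_mul_cancel_right g k
  have hrb : r.left.b = 0 := by
    have := hb (h := k) hrS
    rw [hrk, hkb] at this
    exact right_eq_add.1 this
  have hrc : r.left.c = 0 := by
    have := hc (h := k) hrS
    rw [hrk, hkc] at this
    have h0 := right_eq_add.1 this
    cases t <;> simpa [cc, hrb] using h0
  have hr1 : r.right = 1 := by
    rw [t.isGamma_gam.mem_subgroup.1 hrS]
    cases t <;> simp [gam, hrb, hrc, unip_zero]
  have hrr : r = hol (rho p) 1 ^ r.left.a.val := by
    have hpw : ∀ i : ℕ, (hol (rho p) 1 : Hol (Heis p)) ^ i = hol (rho p ^ i) 1 := by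
      intro i
      induction i with
      | zero => rfl
      | succ i ih =>
        rw [pow_succ, ih, pow_succ]
        rfl
    rw [hpw, rho_pow]
    refine SemidirectProduct.ext ?_ hr1
    ext
    · simp [hol]
    · exact hrb
    · exact hrc
  rw [← hrk, hrr]
  exact mul_mem (pow_mem hρ _) hkH

theorem subgroup_eq {t : Param p} (ht : t.Valid) : t.subgroup = t.isGamma_gam.subgroup := by
  have h2 := two_ne_zero' (p := p)
  have hρ : t.gam (rho p) = 1 := by
    cases t <;> simp [gam, rho, unip_zero]
  have ha1 : alpha1 p = unip 1 0 0 := by ext n <;> simp [alpha1, unip]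
  have ha3 : alpha3 p = unip 0 1 0 := by ext n <;> simp [alpha3, unip]
  have ha2 : alpha2 p = unip (-1 / 2) 0 1 := by
    ext n <;> simp [alpha2, unip]
    field_simp
    ring
  have ha3p : ∀ a : ZMod p, alpha3 p ^ a.val = unip 0 a 0 := fun a => by
    rw [alpha3_pow, ZMod.natCast_zmod_val]
    ext n <;> simp [inner, unip]
  -- Both noncentral generators already lie on the graph of the gamma function. Their independence
  -- modulo the centre is the condition that u₃, v₂ or x₃ is nonzero.
  obtain ⟨n, m, _, _, rfl, rfl, hnm, hcl⟩ : ∃ n m α β, α = t.gam n ∧ β = t.gam m ∧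
      n.b * t.cc m - m.b * t.cc n ≠ 0 ∧
      t.subgroup = Subgroup.closure {hol (rho p) 1, hol n α, hol m β} := by
    cases t with
    | A u₂ u₃ =>
      refine ⟨_, _, _, _, ?_, ?_, ?_, rfl⟩
      · simp [gam, sigma, ha1]
      · rw [sigma_pow, tau_pow]
        simp [gam, ha3, div_self ht, div_mul_cancel₀ _ ht]
      · rw [sigma_pow, tau_pow]
        simpa [sigma, cc] using (show u₃ ≠ 0 from ht)
    | B v₂ =>
      refine ⟨_, _, _, _, ?_, ?_, ?_, rfl⟩
      · rw [tau_pow]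
        simp [gam, ha1, div_self ht]
      · rw [sigma_pow]
        simp [gam, ha3, div_self ht]
      · rw [sigma_pow, tau_pow]
        simpa [cc] using (show v₂ ≠ 0 from ht)
    | C x₃ a =>
      refine ⟨_, _, _, _, ?_, ?_, ?_, rfl⟩
      · rw [tau_pow]
        simp [gam, ha1, inv_mul_cancel₀ ht]
      · rw [ha2, ha3p, unip_mul]
        simp [gam, sigma]
        congr 1
        field_simp
        ring
      · rw [tau_pow]
        simpa [cc, sigma] using (show x₃ ≠ 0 from ht)
  rw [hcl]
  refine le_antisymm ?_ ?_
  · rw [Subgroup.closure_le]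
    rintro _ (rfl | rfl | rfl)
    · exact hρ.symm
    · rfl
    · rfl
  · refine subgroup_le_of_generators t (Subgroup.subset_closure (by simp)) (n := n) (m := m)
      (Subgroup.subset_closure (by simp)) (Subgroup.subset_closure (by simp)) hnm

theorem isRegular {t : Param p} (ht : t.Valid) : Hol.IsRegular t.subgroup := by
  rw [subgroup_eq ht]
  exact t.isGamma_gam.isRegular

theorem gamma_eq {t : Param p} (ht : t.Valid) (h : Hol.IsRegular t.subgroup) :
    Hol.Brace.gamma t.subgroup h = t.gam :=
  funext fun n => Hol.Brace.gamma_eq_of_mem _ _ (by rw [subgroup_eq ht]; rfl)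

theorem thetaCard_eq {t : Param p} (ht : t.Valid) (h : Hol.IsRegular t.subgroup) :
    SkewBrace.thetaCard (Hol.Brace t.subgroup h) = p ^ 2 := by
  rw [Hol.Brace.thetaCard_eq_card_range, gamma_eq ht, card_range_gam ht]

theorem isBraceOf_heis {t : Param p} (ht : t.IsHeis) (h : Hol.IsRegular t.subgroup) :
    SkewBrace.IsBraceOf (Heis p) (Heis p) (p ^ 2) (Hol.Brace t.subgroup h) :=
  ⟨nonempty_mulEquiv_heis h ht (gamma_eq ht.valid h), ⟨Hol.Brace.addEquiv h⟩,
    thetaCard_eq ht.valid h⟩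

theorem isBraceOf_elemAb3 {t : Param p} (ht : t.IsElem) (h : Hol.IsRegular t.subgroup) :
    SkewBrace.IsBraceOf (ElemAb3 p) (Heis p) (p ^ 2) (Hol.Brace t.subgroup h) :=
  ⟨nonempty_mulEquiv_elemAb3 h ht (gamma_eq ht.valid h), ⟨Hol.Brace.addEquiv h⟩,
    thetaCard_eq ht.valid h⟩

end Param

end Heis

/-! ### Intertwiners between the normal forms -/

namespace Heis

variable {p : ℕ} [Fact p.Prime] [Fact (3 < p)]

/-- The automorphism `α` carries the gamma function `γ` to `γ'`. -/
def Intertwines (γ γ' : Heis p → MulAut (Heis p)) (α : MulAut (Heis p)) : Prop :=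
  ∀ n, α * γ n = γ' (α n) * α

theorem Intertwines.symm {γ γ' : Heis p → MulAut (Heis p)} {α : MulAut (Heis p)}
    (h : Intertwines γ γ' α) : Intertwines γ' γ α⁻¹ := by
  intro n
  have := h (α⁻¹ n)
  rw [MulAut.apply_inv_self] at this
  rw [eq_mul_inv_iff_mul_eq, mul_assoc, inv_mul_eq_iff_eq_mul, this]

theorem Intertwines.trans {γ γ' γ'' : Heis p → MulAut (Heis p)} {α β : MulAut (Heis p)}
    (h : Intertwines γ γ' α) (h' : Intertwines γ' γ'' β) : Intertwines γ γ'' (β * α) := by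
  intro n
  rw [mul_assoc, h, ← mul_assoc, h', mul_assoc]
  rfl

theorem cramer {x y z w m₁ m₂ s t : ZMod p} (h1 : (x * w - y * z) * s = m₁ * x + m₂ * z)
    (h2 : (x * w - y * z) * t = m₁ * y + m₂ * w) (hD : x * w - y * z ≠ 0) :
    m₁ = s * w - t * z ∧ m₂ = t * x - s * y := by
  constructor <;> apply mul_left_cancel₀ hD
  · linear_combination z * h2 - w * h1
  · linear_combination y * h1 - x * h2

namespace Param

theorem intertwines_A_iff {u₂ u₃ u₂' u₃' : ZMod p} (h : u₃ ≠ 0) (h' : u₃' ≠ 0)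
    (r₁ r₃ : ZMod p) (β : GL (Fin 2) (ZMod p)) :
    Intertwines (A u₂ u₃).gam (A u₂' u₃').gam (aut r₁ r₃ β) ↔
      (u₂ = u₂' ∧ u₃ = u₃') ∧ β.1 1 0 = -β.1 0 1 * u₃ ∧ β.1 1 1 = β.1 0 0 + β.1 0 1 * u₂ := by
  have hD := det_ne_zero β
  constructor
  · intro hi
    -- The test elements are those where the gamma function takes the values α₁ and α₃, so the left
    -- sides of the resulting equations are unit vectors times det β.
    have e1 := (aut_mul_unip_iff ..).1 (hi ⟨0, 1, 0⟩)
    have e2 := (aut_mul_unip_iff ..).1 (hi ⟨0, u₂, u₃⟩)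
    obtain ⟨-, -, -, e1, e1'⟩ := e1
    obtain ⟨-, -, -, e2, e2'⟩ := e2
    rw [aut_b, aut_c] at e1 e1' e2 e2'
    simp only [mul_zero, mul_one, add_zero] at e1 e1' e2 e2'
    obtain ⟨f1, f1'⟩ := cramer e1 e1' hD
    obtain ⟨f2, f2'⟩ := cramer e2 e2' hD
    generalize β.1 0 0 = x at *
    generalize β.1 0 1 = y at *
    generalize β.1 1 0 = z at *
    generalize β.1 1 1 = w at *
    rw [zero_div] at f1 f1'
    rw [div_self h, div_mul_cancel₀ _ h, sub_self] at f2 f2'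
    have hz : z = -y * u₃' := by
      field_simp at f1'
      linear_combination f1'
    have hw : w = x + y * u₂' := by
      subst hz
      field_simp at f1
      linear_combination -f1
    have hc : z * u₂ + w * u₃ = x * u₃' := by
      field_simp at f2'
      linear_combination f2'
    have hb : x * u₂ + y * u₃ - u₂' * x = -z := by
      rw [hc] at f2
      field_simp at f2
      linear_combination f2
    -- Together with the next equation: the invertible matrix β kills the vector (u₂ - u₂', u₃ -
    -- u₃').
    have g1 : (u₃ - u₃') * w + (u₂ - u₂') * z = 0 := by
      subst hz hw
      linear_combination hc
    have g2 : (u₂ - u₂') * x + (u₃ - u₃') * y = 0 := by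
      subst hz hw
      linear_combination hb
    have k2 : u₂ - u₂' = 0 := by
      apply (mul_eq_zero.1 (?_ : (x * w - y * z) * (u₂ - u₂') = 0)).resolve_left hD
      linear_combination w * g2 - y * g1
    have k3 : u₃ - u₃' = 0 := by
      apply (mul_eq_zero.1 (?_ : (x * w - y * z) * (u₃ - u₃') = 0)).resolve_left hD
      linear_combination x * g1 - z * g2
    rw [sub_eq_zero] at k2 k3
    subst k2 k3
    exact ⟨⟨rfl, rfl⟩, hz, hw⟩
  · rintro ⟨⟨rfl, rfl⟩, hz, hw⟩ n
    refine (aut_mul_unip_iff ..).2 ⟨by ring, by ring, by ring, ?_, ?_⟩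
    · rw [aut_b, aut_c, hz, hw]
      field_simp
      ring
    · rw [aut_b, aut_c, hz, hw]
      field_simp
      ring

/-- Congruence by β multiplies an alternating form by det β, and the rescaling cancels this factor.
So v is an invariant, and for the same reason β is unrestricted in `intertwines_B`. -/
theorem eq_of_intertwines_B {v v' : ZMod p} (h : v ≠ 0) (h' : v' ≠ 0) {α : MulAut (Heis p)}
    (hi : Intertwines (B v).gam (B v').gam α) : v = v' := by
  obtain ⟨r₁, r₃, β, rfl⟩ := exists_eq_aut α
  obtain ⟨-, -, -, -, e⟩ := (aut_mul_unip_iff ..).1 (hi ⟨0, 1, 0⟩)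
  have hD := det_ne_zero β
  rw [aut_b, aut_c] at e
  simp only [mul_zero, mul_one, add_zero] at e
  field_simp at e
  apply mul_left_cancel₀ hD
  linear_combination -e

theorem intertwines_B {v : ZMod p} (h : v ≠ 0) (α : MulAut (Heis p)) :
    Intertwines (B v).gam (B v).gam α := by
  obtain ⟨r₁, r₃, β, rfl⟩ := exists_eq_aut α
  intro n
  refine (aut_mul_unip_iff ..).2 ⟨by ring, by ring, by ring, ?_, ?_⟩
  · rw [aut_b, aut_c]
    field_simp
    ring
  · rw [aut_b, aut_c]
    field_simp
    ring

theorem intertwines_C_iff {x₃ a x₃' a' : ZMod p} (r₁ r₃ : ZMod p) (β : GL (Fin 2) (ZMod p)) :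
    Intertwines (C x₃ a).gam (C x₃' a').gam (aut r₁ r₃ β) ↔
      (x₃ = x₃' ∧ a = a') ∧ β.1 0 1 = 0 ∧ β.1 1 1 = β.1 0 0 ^ 2 ∧
      r₃ = (a + x₃⁻¹) * (β.1 0 0)⁻¹ * β.1 1 0 + (β.1 0 0 - 1) * (1 + a - x₃⁻¹) / 2 := by
  have hD := det_ne_zero β
  have h2 := two_ne_zero' (p := p)
  constructor
  · intro hi
    -- At σ the linear parts make β lower triangular with β₁₁ = β₀₀², the second component gives a =
    -- a', and the first one determines r₃. The test at τ gives x₃ = x₃'.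
    obtain ⟨e1, e2, -, e3, e4⟩ := (aut_mul_unip_iff ..).1 (hi ⟨0, 1, 0⟩)
    obtain ⟨-, -, -, e5, -⟩ := (aut_mul_unip_iff ..).1 (hi ⟨0, 0, 1⟩)
    rw [aut_b] at e2 e3 e4 e5
    rw [aut_c] at e3 e5
    generalize β.1 0 0 = x at *
    generalize β.1 0 1 = y at *
    generalize β.1 1 0 = z at *
    generalize β.1 1 1 = w at *
    simp only [mul_zero, mul_one, add_zero, zero_add, one_pow] at e1 e2 e3 e4 e5
    subst e1
    rw [← sq] at e2
    subst e2
    simp only [mul_zero, zero_mul, add_zero, zero_add, sub_zero, ne_eq, zero_pow,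
      OfNat.ofNat_ne_zero, not_false_eq_true] at e3 e4 e5 hD
    have hx : x ≠ 0 := left_ne_zero_of_mul hD
    have ha : a = a' := by
      apply mul_left_cancel₀ hD
      linear_combination e4
    have hx3 : x₃⁻¹ = x₃'⁻¹ := by
      apply mul_left_cancel₀ hD
      linear_combination e5
    rw [← hx3, ← ha] at e3
    refine ⟨⟨inv_injective hx3, ha⟩, rfl, rfl, ?_⟩
    generalize x₃⁻¹ = e at *
    field_simp at e3 ⊢
    linear_combination e3
  · rintro ⟨⟨rfl, rfl⟩, hy, hw, hr⟩ n
    rw [hy, hw, zero_mul, sub_zero] at hD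
    have hx : β.1 0 0 ≠ 0 := left_ne_zero_of_mul hD
    refine (aut_mul_unip_iff ..).2 ⟨?_, ?_, ?_, ?_, ?_⟩
    · rw [hy, zero_mul]
    · rw [aut_b, hy, hw]; ring
    · rw [hy, mul_zero]
    · rw [aut_b, aut_c, hy, hw, hr]
      generalize x₃⁻¹ = e
      generalize β.1 0 0 = x at *
      field_simp
      ring
    · rw [aut_b, hy, hw]; ring

/-- The form of family A has value 1 at σ, whereas an alternating form vanishes at every vector. -/
theorem not_intertwines_A_B {u₂ u₃ v : ZMod p} (h : v ≠ 0) (α : MulAut (Heis p)) :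
    ¬ Intertwines (A u₂ u₃).gam (B v).gam α := by
  intro hi
  obtain ⟨r₁, r₃, β, rfl⟩ := exists_eq_aut α
  obtain ⟨-, -, -, e, -⟩ := (aut_mul_unip_iff ..).1 (hi ⟨0, 1, 0⟩)
  have hD := det_ne_zero β
  rw [aut_b, aut_c] at e
  simp only [mul_zero, mul_one, add_zero, sub_zero] at e
  apply hD
  field_simp at e
  apply mul_right_cancel₀ h
  linear_combination e

/-- In family C the value at σ acts nontrivially on the quotient by the centre, and conjugation
preserves this. -/
theorem not_intertwines_C {x₃ a : ZMod p} {t : Param p} (ht : ∀ n, ∃ l₁ l₂, t.gam n = unip l₁ l₂ 0)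
    (α : MulAut (Heis p)) : ¬ Intertwines (C x₃ a).gam t.gam α := by
  intro hi
  obtain ⟨r₁, r₃, β, rfl⟩ := exists_eq_aut α
  have h1 := hi ⟨0, 1, 0⟩
  obtain ⟨l₁, l₂, hl⟩ := ht (aut r₁ r₃ β ⟨0, 1, 0⟩)
  rw [hl] at h1
  obtain ⟨e1, e2, -⟩ := (aut_mul_unip_iff ..).1 h1
  simp only [mul_one, zero_mul] at e1 e2
  apply det_ne_zero β
  rw [e1, e2]
  ring

theorem eq_of_intertwines {t t' : Param p} (ht : t.Valid) (ht' : t'.Valid) {α : MulAut (Heis p)}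
    (h : Intertwines t.gam t'.gam α) : t = t' := by
  cases t with
  | A u₂ u₃ =>
    cases t' with
    | A u₂' u₃' =>
      obtain ⟨r₁, r₃, β, rfl⟩ := exists_eq_aut α
      obtain ⟨⟨rfl, rfl⟩, -⟩ := (intertwines_A_iff ht ht' _ _ _).1 h
      rfl
    | B v => exact absurd h (not_intertwines_A_B ht' _)
    | C x₃ a => exact absurd h.symm (not_intertwines_C (fun n => ⟨_, _, rfl⟩) _)
  | B v =>
    cases t' with
    | A u₂' u₃' => exact absurd h.symm (not_intertwines_A_B ht _)
    | B v' => rw [eq_of_intertwines_B ht ht' h]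
    | C x₃ a => exact absurd h.symm (not_intertwines_C (fun n => ⟨_, _, rfl⟩) _)
  | C x₃ a =>
    cases t' with
    | A u₂' u₃' => exact absurd h (not_intertwines_C (fun n => ⟨_, _, rfl⟩) _)
    | B v' => exact absurd h (not_intertwines_C (fun n => ⟨_, _, rfl⟩) _)
    | C x₃' a' =>
      obtain ⟨r₁, r₃, β, rfl⟩ := exists_eq_aut α
      obtain ⟨⟨rfl, rfl⟩, -⟩ := (intertwines_C_iff _ _ _).1 h
      rfl

end Param

end Heis

/-! ### Structure of a gamma function with image of order p² -/

namespace Heis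

variable {p : ℕ} [Fact p.Prime] [Fact (3 < p)]

section Kernel

variable {N : Type*} [Group N] {γ : N → MulAut N}

theorem _root_.Hol.IsGamma.mul_inv_mem (h : Hol.IsGamma γ) {x y : N} (hxy : γ x = γ y) :
    γ (x * y⁻¹) = 1 := by
  have := h x ((γ y)⁻¹ y⁻¹)
  rw [h.map_inv, hxy, MulAut.apply_inv_self, mul_inv_cancel] at this
  exact this

/-- The kernel of a gamma function. -/
def _root_.Hol.IsGamma.ker (h : Hol.IsGamma γ) : Subgroup N where
  carrier := {n | γ n = 1}
  mul_mem' {x y} hx hy := by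
    have := h x y
    rw [Set.mem_ofPred.1 hx, Set.mem_ofPred.1 hy, mul_one] at this
    exact this
  one_mem' := h.map_one
  inv_mem' {x} hx := by
    have := h.map_inv x
    rw [Set.mem_ofPred.1 hx, inv_one] at this
    exact this

theorem _root_.Hol.IsGamma.mem_ker (h : Hol.IsGamma γ) {n : N} : n ∈ h.ker ↔ γ n = 1 := Iff.rfl

theorem _root_.Hol.IsGamma.map_ker_mul (h : Hol.IsGamma γ) {k : N} (hk : k ∈ h.ker) (n : N) :
    γ (k * n) = γ n := by
  have := h k n
  rw [h.mem_ker.1 hk] at this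
  simpa using this

/-- The gamma function obtained by transport along an automorphism. -/
theorem _root_.Hol.IsGamma.conj (h : Hol.IsGamma γ) (α : MulAut N) :
    Hol.IsGamma fun n => α * γ (α⁻¹ n) * α⁻¹ := by
  intro n m
  have := h (α⁻¹ n) (α⁻¹ m)
  have e : α⁻¹ (n * (α * γ (α⁻¹ n) * α⁻¹) m) = α⁻¹ n * γ (α⁻¹ n) (α⁻¹ m) := by
    rw [map_mul]
    simp
  simp only [e, this]
  group

end Kernel

theorem mul_rho (n : Heis p) : n * rho p = rho p * n := by ext <;> simp [rho, add_comm]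

/-- If `d` is central, then ρ is a power of it. Otherwise the commutators of `d` with all elements,
which lie in `S`, fill the centre. -/
theorem rho_mem_of_conj_mem {S : Subgroup (Heis p)} {d : Heis p} (hd : d ≠ 1)
    (h : ∀ a, a * d * a⁻¹ ∈ S) : rho p ∈ S := by
  have hd0 : d ∈ S := by simpa using h 1
  have hc : ∀ a : Heis p, mk' (a.c * d.b - a.b * d.c) 0 0 ∈ S := by
    intro a
    have : mk' (a.c * d.b - a.b * d.c) 0 0 = a * d * a⁻¹ * d⁻¹ := by
      have := two_ne_zero' (p := p)
      refine ext_X ?_ (by simp) (by simp)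
      simp only [X_mul, X_inv, mul_b, mul_c, inv_b, inv_c, X_mk']
      field_simp
      ring
    rw [this]
    exact mul_mem (h a) (inv_mem hd0)
  have hr : mk' 1 0 0 = rho p := ext_X (by simp) rfl rfl
  by_cases hb : d.b = 0
  · by_cases hc0 : d.c = 0
    · have hx : d.a ≠ 0 := fun hx => hd (Heis.ext hx hb hc0)
      have hda : d = rho p ^ d.a.val := by
        rw [rho_pow]
        ext
        · simp
        · exact hb
        · exact hc0
      have : rho p = d ^ (d.a⁻¹).val := by
        rw [hda, ← pow_mul, rho_pow, ← hda]
        ext <;> simp [rho, hx]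
      rw [this]
      exact pow_mem hd0 _
    · have := hc ⟨0, -d.c⁻¹, 0⟩
      simpa [hb, hc0, hr] using this
  · have := hc ⟨0, 0, d.b⁻¹⟩
    simpa [hb, hr] using this

/-- The matrix of an automorphism on the quotient by the centre. -/
def linPart (α : MulAut (Heis p)) : Matrix (Fin 2) (Fin 2) (ZMod p) :=
  !![(α (sigma p)).b, (α (tau p)).b; (α (sigma p)).c, (α (tau p)).c]

theorem linPart_aut (r₁ r₃ : ZMod p) (β : GL (Fin 2) (ZMod p)) : linPart (aut r₁ r₃ β) = β.1 := by
  ext i j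
  fin_cases i <;> fin_cases j <;> simp [linPart, aut_b, aut_c, sigma, tau]

theorem apply_b (α : MulAut (Heis p)) (n : Heis p) :
    (α n).b = linPart α 0 0 * n.b + linPart α 0 1 * n.c := by
  obtain ⟨r₁, r₃, β, rfl⟩ := exists_eq_aut α
  rw [linPart_aut, aut_b]

theorem apply_c (α : MulAut (Heis p)) (n : Heis p) :
    (α n).c = linPart α 1 0 * n.b + linPart α 1 1 * n.c := by
  obtain ⟨r₁, r₃, β, rfl⟩ := exists_eq_aut α
  rw [linPart_aut, aut_c]

theorem linPart_mul (α β : MulAut (Heis p)) : linPart (α * β) = linPart α * linPart β := by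
  ext i j
  fin_cases i <;> fin_cases j <;>
    simp [Matrix.mul_apply, Fin.sum_univ_two] <;> simp [linPart]
  all_goals simp [linPart, apply_b α (β _), apply_c α (β _)]

theorem linPart_one : linPart (1 : MulAut (Heis p)) = 1 := by
  ext i j
  fin_cases i <;> fin_cases j <;> simp [linPart, sigma, tau]

theorem linPart_pow (α : MulAut (Heis p)) (n : ℕ) : linPart (α ^ n) = linPart α ^ n := by
  induction n with
  | zero => simp [linPart_one]
  | succ n ih => rw [pow_succ, linPart_mul, ih, pow_succ]

/-- An automorphism of order dividing a power of `p` has a unipotent matrix. -/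
theorem unipotent_of_pow_eq_one {α : MulAut (Heis p)} {k : ℕ} (h : α ^ p ^ k = 1) :
    linPart α 0 0 + linPart α 1 1 = 2 ∧
    (linPart α 0 0 - 1) * (linPart α 1 1 - 1) = linPart α 0 1 * linPart α 1 0 := by
  set M := linPart α with hM
  have h1 : M ^ p ^ k = 1 := by rw [hM, ← linPart_pow, h, linPart_one]
  -- Frobenius: in characteristic p, (M - 1) to the power pᵏ is the pᵏ-th power of M minus 1, hence
  -- 0. Trace and determinant of M - 1 then vanish.
  have hnil : IsNilpotent (M - 1) := by
    refine ⟨p ^ k, ?_⟩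
    rw [sub_pow_char_pow_of_commute p k (Commute.one_right M), h1, one_pow, sub_self]
  have htr := (Matrix.isNilpotent_trace_of_isNilpotent hnil).eq_zero
  have hdet : (M - 1).det = 0 := by
    obtain ⟨m, hm⟩ := hnil
    have : (M - 1).det ^ m = 0 := by
      rw [← Matrix.det_pow, hm, Matrix.det_eq_zero_of_row_eq_zero 0]
      simp
    exact eq_zero_of_pow_eq_zero this
  rw [Matrix.trace_fin_two] at htr
  rw [Matrix.det_fin_two] at hdet
  simp at htr hdet
  constructor
  · linear_combination htr
  · linear_combination hdet

theorem eq_unip_of_linPart {α : MulAut (Heis p)} (h00 : linPart α 0 0 = 1)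
    (h01 : linPart α 0 1 = 0) (h11 : linPart α 1 1 = 1) :
    α = unip (X (α (sigma p))) (X (α (tau p))) (linPart α 1 0) := by
  refine mulAut_ext (ext_X ?_ ?_ ?_) (ext_X ?_ ?_ ?_)
  · rw [X_unip]; simp [sigma, X]
  · rw [apply_b, h00, h01]; simp [sigma]
  · rw [apply_c]; simp [sigma]
  · rw [X_unip]; simp [tau, X]
  · rw [apply_b, h00, h01]; simp [tau]
  · rw [apply_c, h11]; simp [tau]

section Theta

variable {γ : Heis p → MulAut (Heis p)} (h : Hol.IsGamma γ)
  (hcard : Nat.card (Set.range γ) = p ^ 2)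

theorem theta_comm (h : Hol.IsGamma γ) (hcard : Nat.card (Set.range γ) = p ^ 2)
    (n m : Heis p) : γ n * γ m = γ m * γ n := by
  have hc : Nat.card (h.subgroup.map (Hol.Theta (Heis p))) = p ^ 2 := by
    rw [Hol.Brace.card_map_Theta h.isRegular, h.gamma_eq, hcard]
  have hmem : ∀ n, γ n ∈ h.subgroup.map (Hol.Theta (Heis p)) := fun n =>
    ⟨⟨n, γ n⟩, rfl, rfl⟩
  let _ := IsPGroup.commGroupOfCardEqPrimeSq hc
  have := mul_comm (⟨γ n, hmem n⟩ : h.subgroup.map (Hol.Theta (Heis p))) ⟨γ m, hmem m⟩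
  exact congrArg Subtype.val this

theorem theta_pow (h : Hol.IsGamma γ) (hcard : Nat.card (Set.range γ) = p ^ 2) (n : Heis p) :
    γ n ^ p ^ 2 = 1 := by
  have hc : Nat.card (h.subgroup.map (Hol.Theta (Heis p))) = p ^ 2 := by
    rw [Hol.Brace.card_map_Theta h.isRegular, h.gamma_eq, hcard]
  have hmem : γ n ∈ h.subgroup.map (Hol.Theta (Heis p)) := ⟨⟨n, γ n⟩, rfl, rfl⟩
  have := pow_card_eq_one' (x := (⟨γ n, hmem⟩ : h.subgroup.map (Hol.Theta (Heis p))))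
  rw [hc] at this
  exact congrArg Subtype.val this

theorem theta_rho (h : Hol.IsGamma γ) (hcard : Nat.card (Set.range γ) = p ^ 2) (n : Heis p) :
    γ n (rho p) = rho p := by
  obtain ⟨h1, h2⟩ := unipotent_of_pow_eq_one (theta_pow h hcard n)
  rw [aut_rho]
  refine ext_X ?_ rfl rfl
  simp [linPart] at h1 h2
  rw [X_mk', X_rho]
  linear_combination h2 + h1

/-- Let g = γ(ρ). Since ρ is central and fixed by every γ(n), the element ρ g(a) = g(a) ρ can be
expanded in two ways, and commutativity of the image gives γ(g(a)) = γ(a). So every g(a)a⁻¹ lies in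
the kernel. If g ≠ 1, one of these is nontrivial and all its conjugates lie in the kernel, hence so
does ρ. -/
theorem rho_mem_ker (h : Hol.IsGamma γ) (hcard : Nat.card (Set.range γ) = p ^ 2) :
    rho p ∈ h.ker := by
  set g := γ (rho p) with hg
  have hga : ∀ a, γ (g a) = γ a := by
    intro a
    have h1 := h (rho p) a
    have h2 := h (g a) (rho p)
    rw [theta_rho h hcard, mul_rho, ← hg] at h2
    rw [← hg, h2] at h1
    refine mul_left_cancel (a := g) ?_
    rw [← h1, hg]
    exact theta_comm h hcard _ _
  have hd : ∀ a, g a * a⁻¹ ∈ h.ker := fun a => h.mul_inv_mem (hga a)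
  by_cases hg1 : g = 1
  · exact hg1
  obtain ⟨b, hb⟩ : ∃ b, g b * b⁻¹ ≠ 1 := by
    by_contra hall
    push Not at hall
    exact hg1 (MulEquiv.ext fun b => mul_inv_eq_one.1 (hall b))
  refine rho_mem_of_conj_mem hb fun a => ?_
  -- The cocycle identity for a ↦ g(a)a⁻¹ expresses the conjugate through elements of the kernel.
  have : a * (g b * b⁻¹) * a⁻¹ = (g a * a⁻¹)⁻¹ * (g (a * b) * (a * b)⁻¹) := by
    rw [map_mul]; group
  rw [this]
  exact mul_mem (inv_mem (hd a)) (hd _)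

theorem map_eq (h : Hol.IsGamma γ) (hcard : Nat.card (Set.range γ) = p ^ 2) (n : Heis p) :
    γ n = γ (mk' 0 n.b n.c) := by
  have hn : n = rho p ^ (X n).val * mk' 0 n.b n.c := by
    rw [rho_pow]
    refine ext_X ?_ (by simp) (by simp)
    rw [X_mul]
    simp [X, mk']
  conv_lhs => rw [hn]
  exact h.map_ker_mul (pow_mem (rho_mem_ker h hcard) _) _

/-- By `map_eq` the gamma function factors through the quotient by the centre, which has as many
elements as the image. -/
theorem injective_mk' (h : Hol.IsGamma γ) (hcard : Nat.card (Set.range γ) = p ^ 2) :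
    Function.Injective fun v : ZMod p × ZMod p => γ (mk' 0 v.1 v.2) := by
  have hs : Set.range γ = Set.range fun v : ZMod p × ZMod p => γ (mk' 0 v.1 v.2) := by
    ext α
    constructor
    · rintro ⟨n, rfl⟩
      exact ⟨(n.b, n.c), (map_eq h hcard n).symm⟩
    · rintro ⟨v, rfl⟩
      exact ⟨_, rfl⟩
  rw [hs] at hcard
  have hb := (Nat.bijective_iff_surjective_and_card
    (Set.rangeFactorization fun v : ZMod p × ZMod p => γ (mk' 0 v.1 v.2))).2
    ⟨Set.rangeFactorization_surjective, by rw [hcard, Nat.card_prod, Nat.card_zmod, sq]⟩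
  intro v w hvw
  exact hb.1 (Subtype.ext hvw)

/-- After an automorphism, all values of the gamma function have lower unipotent matrices. -/
theorem exists_conj_unip (h : Hol.IsGamma γ) (hcard : Nat.card (Set.range γ) = p ^ 2) :
    ∃ α : MulAut (Heis p), ∀ n, ∃ l₁ l₂ k, α * γ n * α⁻¹ = unip l₁ l₂ k := by
  by_cases hM : ∀ n, linPart (γ n) = 1
  · refine ⟨1, fun n => ⟨X (γ n (sigma p)), X (γ n (tau p)), linPart (γ n) 1 0, ?_⟩⟩
    rw [one_mul, inv_one, mul_one]
    exact eq_unip_of_linPart (by simp [hM]) (by simp [hM]) (by simp [hM])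
  push Not at hM
  obtain ⟨n₀, hn₀⟩ := hM
  obtain ⟨ht, hd⟩ := unipotent_of_pow_eq_one (theta_pow h hcard n₀)
  -- A Jordan basis: the columns of the matrix of δ are v and (M - 1)v, where v is a standard basis
  -- vector not fixed by M, namely (1, 0) if M₁₀ ≠ 0 and (0, 1) otherwise.
  obtain ⟨δ, hδ⟩ : ∃ δ : MulAut (Heis p),
      linPart (γ n₀) * linPart δ = linPart δ * !![1, 0; 1, 1] := by
    set M := linPart (γ n₀) with hMdef
    have hM' : ∀ B : Matrix (Fin 2) (Fin 2) (ZMod p), M * B = !![M 0 0, M 0 1; M 1 0, M 1 1] * B :=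
      fun B => by rw [← Matrix.eta_fin_two]
    by_cases hz : M 1 0 = 0
    · have hs : M 0 0 = 1 := by
        rw [hz, mul_zero] at hd
        have : (M 0 0 - 1) ^ 2 = 0 := by linear_combination (M 0 0 - 1) * ht - hd
        exact sub_eq_zero.1 (eq_zero_of_pow_eq_zero this)
      have hw : M 1 1 = 1 := by linear_combination ht - hs
      have hy : M 0 1 ≠ 0 := fun hy => hn₀ (by
        rw [Matrix.eta_fin_two M, hs, hy, hz, hw, Matrix.one_fin_two])
      refine ⟨aut 0 0 (mat 0 (M 0 1) 1 0 (by simpa using hy)), ?_⟩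
      rw [linPart_aut, hM', hs, hz, hw]
      ext i j
      fin_cases i <;> fin_cases j <;> simp [coe_mat]
    · refine ⟨aut 0 0 (mat 1 (M 0 0 - 1) 0 (M 1 0) (by simpa using hz)), ?_⟩
      rw [linPart_aut, hM']
      ext i j
      fin_cases i <;> fin_cases j <;> simp [coe_mat]
      · linear_combination (M 0 0 - 1) * ht - hd
      · linear_combination M 1 0 * ht
  refine ⟨δ⁻¹, fun n => ⟨_, _, _, eq_unip_of_linPart ?_ ?_ ?_⟩⟩
  all_goals
    have hδδ : linPart δ⁻¹ * linPart δ = 1 := by rw [← linPart_mul, inv_mul_cancel, linPart_one]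
    have h0 : linPart (δ⁻¹ * γ n₀ * δ⁻¹⁻¹) = !![1, 0; 1, 1] := by
      rw [inv_inv, linPart_mul, linPart_mul, mul_assoc, hδ, ← mul_assoc, hδδ, one_mul]
    -- The image is abelian, so every matrix in it commutes with the Jordan block and is lower
    -- triangular. Unipotency then makes the diagonal entries 1.
    have hcomm : linPart (δ⁻¹ * γ n * δ⁻¹⁻¹) * !![1, 0; 1, 1] =
        !![1, 0; 1, 1] * linPart (δ⁻¹ * γ n * δ⁻¹⁻¹) := by
      rw [← h0, ← linPart_mul, ← linPart_mul]
      congr 1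
      have := theta_comm h hcard n n₀
      calc _ = δ⁻¹ * (γ n * γ n₀) * δ⁻¹⁻¹ := by group
        _ = _ := by rw [this]; group
    have hpow : (δ⁻¹ * γ n * δ⁻¹⁻¹) ^ p ^ 2 = 1 := by
      rw [conj_pow, theta_pow h hcard, mul_one, mul_inv_cancel]
    obtain ⟨ht', hd'⟩ := unipotent_of_pow_eq_one hpow
    generalize linPart (δ⁻¹ * γ n * δ⁻¹⁻¹) = M at *
    have e01 : M 0 1 = 0 := by
      have := congrFun (congrFun hcomm 0) 0
      simpa [Matrix.mul_apply, Fin.sum_univ_two] using this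
    have e00 : M 0 0 = 1 := by
      rw [e01, zero_mul] at hd'
      have : (M 0 0 - 1) ^ 2 = 0 := by linear_combination (M 0 0 - 1) * ht' - hd'
      exact sub_eq_zero.1 (eq_zero_of_pow_eq_zero this)
  · exact e00
  · exact e01
  · linear_combination ht' - e00

end Theta

end Heis

/-! ### Reduction of gamma functions to the normal forms A, B and C -/

namespace Heis

variable {p : ℕ} [Fact p.Prime] [Fact (3 < p)]

theorem additive_eq_mul {f : ZMod p → ZMod p} (h : ∀ x y, f (x + y) = f x + f y) (x : ZMod p) :
    f x = x * f 1 := by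
  let F : ZMod p →+ ZMod p := AddMonoidHom.mk' f h
  have : ∀ n : ℕ, f n = n * f 1 := fun n => by
    have := map_nsmul F n 1
    simpa [F] using this
  obtain ⟨n, rfl⟩ := ZMod.natCast_zmod_surjective x
  exact this n

theorem additive₂_eq {f : ZMod p → ZMod p → ZMod p}
    (h : ∀ b c b' c', f (b + b') (c + c') = f b c + f b' c') (b c : ZMod p) :
    f b c = b * f 1 0 + c * f 0 1 := by
  have h1 := additive_eq_mul (f := fun b => f b 0) (fun x y => by simpa using h x 0 y 0) b
  have h2 := additive_eq_mul (f := fun c => f 0 c) (fun x y => by simpa using h 0 x 0 y) c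
  have := h b 0 0 c
  rw [add_zero, zero_add] at this
  rw [this, h1, h2]

/-- A gamma function that is linear with trivial linear parts is of type `A` or `B`. -/
theorem exists_intertwines_of_linear {γ : Heis p → MulAut (Heis p)} {p₁₁ p₁₂ p₂₁ p₂₂ : ZMod p}
    (hγ : ∀ n, γ n = unip (p₁₁ * n.b + p₁₂ * n.c) (p₂₁ * n.b + p₂₂ * n.c) 0)
    (hd : p₁₁ * p₂₂ - p₁₂ * p₂₁ ≠ 0) :
    ∃ (t : Param p) (_ : t.Valid) (α : MulAut (Heis p)), Intertwines γ t.gam α := by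
  set d := p₁₁ * p₂₂ - p₁₂ * p₂₁ with hdd
  -- This is the value of the bilinear form at (y, -x). It vanishes identically only if the form is
  -- alternating, which is family B.
  by_cases hq : ∃ x y, p₂₂ * x ^ 2 - (p₁₂ + p₂₁) * x * y + p₁₁ * y ^ 2 ≠ 0
  · obtain ⟨x, y, hq⟩ := hq
    have hD : d * x * (p₂₂ * x - p₁₂ * y) - d * y * (p₂₁ * x - p₁₁ * y) ≠ 0 := by
      have := mul_ne_zero hd hq
      intro h0
      apply this
      rw [← h0]
      ring
    -- Rescaled congruence preserves the determinant and the skew part of the form. In family A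
    -- these are 1/u₃ and, up to sign, u₂/u₃, which forces the parameters. The matrix has
    -- determinant d times the value of the form at (y, -x).
    refine ⟨.A ((p₂₁ - p₁₂) / d) d⁻¹, inv_ne_zero hd, aut 0 0 (mat _ _ _ _ hD), fun n => ?_⟩
    rw [hγ]
    refine (aut_mul_unip_iff ..).2 ⟨by ring, by ring, by ring, ?_, ?_⟩
    · simp only [aut_b, aut_c, coe_mat, Matrix.of_apply, Matrix.cons_val', Matrix.cons_val_zero,
        Matrix.cons_val_one, Matrix.cons_val_fin_one]
      have e1 : (p₂₁ - p₁₂) / d / d⁻¹ = p₂₁ - p₁₂ := by field_simp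
      rw [e1, div_inv_eq_mul, hdd]
      ring
    · simp only [aut_b, aut_c, coe_mat, Matrix.of_apply, Matrix.cons_val', Matrix.cons_val_zero,
        Matrix.cons_val_one, Matrix.cons_val_fin_one]
      have e1 : (p₂₁ - p₁₂) / d / d⁻¹ = p₂₁ - p₁₂ := by field_simp
      rw [e1, div_inv_eq_mul, hdd]
      ring
  · push Not at hq
    have h1 : p₂₂ = 0 := by simpa using hq 1 0
    have h2 : p₁₁ = 0 := by simpa using hq 0 1
    have h3 : p₁₂ = -p₂₁ := by
      have := hq 1 1
      rw [h1, h2] at this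
      linear_combination -this
    have h4 : p₂₁ ≠ 0 := by
      rintro h4
      apply hd
      rw [hdd, h4, h1]
      ring
    refine ⟨.B p₂₁⁻¹, inv_ne_zero h4, 1, fun n => ?_⟩
    rw [hγ, one_mul, mul_one, h1, h2, h3]
    change _ = unip (-n.c / p₂₁⁻¹) (n.b / p₂₁⁻¹) 0
    congr 1
    · rw [div_inv_eq_mul]; ring
    · rw [div_inv_eq_mul]; ring

/-- A gamma function with quadratic first component is of type `C`. -/
theorem exists_intertwines_of_quadratic {γ : Heis p → MulAut (Heis p)} {κ a d e : ZMod p}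
    (hγ : ∀ n, γ n = unip ((a - e) * κ / 2 * n.b ^ 2 + d * n.b + e * n.c) (a * n.b) (κ * n.b))
    (hκ : κ ≠ 0) (he : e ≠ 0) :
    ∃ (t : Param p) (_ : t.Valid) (α : MulAut (Heis p)), Intertwines γ t.gam α := by
  have h2 := two_ne_zero' (p := p)
  -- Scaling τ by κ⁻¹ normalises the linear part to b, and r₃ is chosen to turn the linear
  -- coefficient d into that of family C.
  refine ⟨.C e⁻¹ a, inv_ne_zero he, aut 0 ((e - a - 1) / 2 - d / κ)
    (mat 1 0 0 κ⁻¹ (by simpa using hκ)), fun n => ?_⟩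
  rw [hγ]
  refine (aut_mul_unip_iff ..).2 ?_
  simp only [aut_b, aut_c, coe_mat, Matrix.of_apply, Matrix.cons_val', Matrix.cons_val_zero,
        Matrix.cons_val_one, Matrix.cons_val_fin_one, inv_inv]
  refine ⟨by ring, by field_simp; ring, by ring, ?_, ?_⟩
  · field_simp
    ring
  · field_simp
    ring

theorem exists_intertwines_of_unip {γ : Heis p → MulAut (Heis p)} (h : Hol.IsGamma γ)
    (hcard : Nat.card (Set.range γ) = p ^ 2) (hu : ∀ n, ∃ l₁ l₂ k, γ n = unip l₁ l₂ k) :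
    ∃ (t : Param p) (_ : t.Valid) (α : MulAut (Heis p)), Intertwines γ t.gam α := by
  have h2 := two_ne_zero' (p := p)
  have hu' : ∀ b c : ZMod p, ∃ l₁ l₂ k, γ (mk' 0 b c) = unip l₁ l₂ k := fun b c => hu _
  choose l₁ l₂ k hl using hu'
  have hγ : ∀ n, γ n = unip (l₁ n.b n.c) (l₂ n.b n.c) (k n.b n.c) := fun n => by
    rw [map_eq h hcard, hl]
  have hinj := injective_mk' h hcard
  have hinj' : ∀ b c b' c', l₁ b c = l₁ b' c' → l₂ b c = l₂ b' c' → k b c = k b' c' →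
      b = b' ∧ c = c' := by
    intro b c b' c' e1 e2 e3
    have := @hinj (b, c) (b', c') (by dsimp only; rw [hl, hl, e1, e2, e3])
    exact Prod.mk.inj this
  have hmul : ∀ b c b' c', l₁ (b + b') (c + (c' + k b c * b')) = l₁ b c + l₁ b' c' +
      l₂ b c * k b' c' ∧ l₂ (b + b') (c + (c' + k b c * b')) = l₂ b c + l₂ b' c' ∧
      k (b + b') (c + (c' + k b c * b')) = k b c + k b' c' := by
    intro b c b' c'
    have := h (mk' 0 b c) (mk' 0 b' c')
    rw [hγ (_ * _), hγ (mk' 0 b c), hγ (mk' 0 b' c'), unip_mul] at this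
    simpa using unip_injective this
  have hcomm : ∀ b c b' c', l₂ b c * k b' c' = l₂ b' c' * k b c := by
    intro b c b' c'
    have := theta_comm h hcard (mk' 0 b c) (mk' 0 b' c')
    rw [hl, hl, unip_mul, unip_mul] at this
    have := (unip_injective this).1
    linear_combination this
  by_cases hk : ∀ b c, k b c = 0
  · have e1 := additive₂_eq (f := l₁) fun b c b' c' => by simpa [hk] using (hmul b c b' c').1
    have e2 := additive₂_eq (f := l₂) fun b c b' c' => by simpa [hk] using (hmul b c b' c').2.1
    refine exists_intertwines_of_linear (p₁₁ := l₁ 1 0) (p₁₂ := l₁ 0 1) (p₂₁ := l₂ 1 0)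
      (p₂₂ := l₂ 0 1) (fun n => ?_) ?_
    · rw [hγ, hk, e1, e2]
      congr 1 <;> ring
    · intro hD
      have key : ∀ b c, b * l₁ 1 0 + c * l₁ 0 1 = 0 → b * l₂ 1 0 + c * l₂ 0 1 = 0 →
          b = 0 ∧ c = 0 := by
        intro b c f1 f2
        apply hinj'
        · rw [e1, f1, e1 0 0]; ring
        · rw [e2, f2, e2 0 0]; ring
        · rw [hk, hk]
      -- If the determinant were zero, the rows turned by a right angle would lie in the kernel,
      -- which is trivial by injectivity. So the first column would vanish, and (1, 0) would be in
      -- the kernel.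
      obtain ⟨a1, a2⟩ := key (l₂ 0 1) (-l₂ 1 0) (by linear_combination hD) (by ring)
      obtain ⟨a3, a4⟩ := key (l₁ 0 1) (-l₁ 1 0) (by ring) (by linear_combination -hD)
      have := key 1 0 (by rw [neg_eq_zero.1 a4]; ring) (by rw [neg_eq_zero.1 a2]; ring)
      exact one_ne_zero this.1
  · have kadd : ∀ s c, k 0 (s + c) = k 0 s + k 0 c := fun s c => by
      simpa using (hmul 0 s 0 c).2.2
    have kbc : ∀ b c s, k b (c + s) = k b c + k 0 s := fun b c s => by
      simpa using (hmul b c 0 s).2.2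
    -- Composing (0, 1) with (1, -1) shifts the second coordinate by k(0, 1). Comparing with
    -- additivity in the second coordinate leaves k(0, 1)² = 0.
    have k01 : k 0 1 = 0 := by
      have e1 := (hmul 0 1 1 (-1)).2.2
      have e2 := kbc 1 0 (k 0 1)
      have e3 := additive_eq_mul (f := k 0) kadd (k 0 1)
      have e4 := kbc 1 (-1) 1
      have e5 : (1 : ZMod p) + (-1 + k 0 1 * 1) = 0 + k 0 1 := by ring
      rw [e5, zero_add 1, e2] at e1
      rw [neg_add_cancel] at e4
      have : k 0 1 ^ 2 = 0 := by linear_combination e1 - e3 - e4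
      exact eq_zero_of_pow_eq_zero this
    have k0 : ∀ s, k 0 s = 0 := fun s => by
      rw [additive_eq_mul (f := k 0) kadd s, k01, mul_zero]
    have kb : ∀ b c, k b c = k b 0 := fun b c => by
      have := kbc b 0 c
      rwa [k0, add_zero, zero_add] at this
    have kκ : ∀ b c, k b c = k 1 0 * b := fun b c => by
      rw [kb, additive_eq_mul (f := fun b => k b 0) (fun x y => ?_) b, mul_comm]
      have := (hmul x 0 y 0).2.2
      rwa [kb] at this
    set κ := k 1 0 with hκdef
    have hκ : κ ≠ 0 := fun h0 => hk fun b c => by rw [kκ, h0, zero_mul]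
    -- Commutativity of the image makes l₂ proportional to k.
    have hl2 : ∀ b c, l₂ b c = l₂ 1 0 * b := fun b c => by
      have := hcomm b c 1 0
      rw [kκ 1, kκ b] at this
      apply mul_right_cancel₀ hκ
      linear_combination this
    set a := l₂ 1 0 with ha
    have hl1 : ∀ b c b' c', l₁ (b + b') (c + (c' + κ * b * b')) = l₁ b c + l₁ b' c' +
        a * b * (κ * b') := fun b c b' c' => by
      have := (hmul b c b' c').1
      rwa [kκ, hl2, kκ] at this
    have l0 : ∀ c, l₁ 0 c = c * l₁ 0 1 := additive_eq_mul (f := l₁ 0) fun x y => by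
      simpa using hl1 0 x 0 y
    set e := l₁ 0 1 with he
    have lc : ∀ b c, l₁ b c = l₁ b 0 + e * c := fun b c => by
      have := hl1 b 0 0 c
      simp only [add_zero, zero_add, mul_zero] at this
      rw [this, l0, mul_comm]
    -- The defect of additivity of l₁(·, 0) is (a - e)κxy, where -eκxy comes from the shift of the
    -- second coordinate. Subtracting half the corresponding square leaves an additive function.
    have hb := additive_eq_mul (f := fun b => l₁ b 0 - (a - e) * κ / 2 * b ^ 2) fun x y => by
      have := hl1 x 0 y 0
      rw [lc] at this
      field_simp
      linear_combination 2 * this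
    refine exists_intertwines_of_quadratic (κ := κ) (a := a)
      (d := l₁ 1 0 - (a - e) * κ / 2 * 1 ^ 2) (e := e) (fun n => ?_) hκ fun he0 => ?_
    · rw [hγ, kκ, hl2, lc]
      congr 1
      linear_combination hb n.b
    · have := hinj' 0 0 0 1 (by rw [l0, l0, he0]; ring) (by rw [hl2, hl2]) (by rw [k0, k0])
      exact zero_ne_one this.2

/-- Every gamma function on the Heisenberg group with image of order `p²` is equivalent to one in
the list. -/
theorem exists_intertwines {γ : Heis p → MulAut (Heis p)} (h : Hol.IsGamma γ)
    (hcard : Nat.card (Set.range γ) = p ^ 2) :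
    ∃ (t : Param p) (_ : t.Valid) (α : MulAut (Heis p)), Intertwines γ t.gam α := by
  obtain ⟨α, hα⟩ := exists_conj_unip h hcard
  have hI : Intertwines γ (fun n => α * γ (α⁻¹ n) * α⁻¹) α := fun n => by
    simp
  have hr : Set.range (fun n => α * γ (α⁻¹ n) * α⁻¹) = (fun θ => α * θ * α⁻¹) '' Set.range γ := by
    ext θ
    constructor
    · rintro ⟨n, rfl⟩
      exact ⟨_, ⟨_, rfl⟩, rfl⟩
    · rintro ⟨_, ⟨n, rfl⟩, rfl⟩
      exact ⟨α n, by simp⟩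
  obtain ⟨t, ht, β, hβ⟩ := exists_intertwines_of_unip (h.conj α) (by
    rw [hr, Nat.card_image_of_injective _, hcard]
    intro θ θ' hθ
    simpa using hθ) fun n => hα _
  exact ⟨t, ht, _, hI.trans hβ⟩

end Heis

/-! ### Classification of the skew braces up to isomorphism -/

namespace Heis

open SkewBrace

variable {p : ℕ} [Fact p.Prime] [Fact (3 < p)]

theorem not_mulEquiv_elemAb3 : IsEmpty (Heis p ≃* ElemAb3 p) := by
  refine ⟨fun e => ?_⟩
  have h : tau p * sigma p = sigma p * tau p := e.injective (by rw [map_mul, map_mul, mul_comm])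
  have := congrArg Heis.a h
  simp [tau, sigma] at this

theorem exists_param {B : Type v} [SkewBrace B] (hB : Nonempty (B ≃+ Additive (Heis p)))
    (hcard : thetaCard B = p ^ 2) :
    ∃ t : Param p, ∃ ht : t.Valid, Nonempty (B ≃+* Hol.Brace t.subgroup (Param.isRegular ht)) := by
  obtain ⟨f⟩ := hB
  obtain ⟨γ, h, ⟨e⟩⟩ := Hol.exists_isGamma_of_addEquiv f
  rw [thetaCard_congr e, Hol.Brace.thetaCard_eq_card_range, h.gamma_eq] at hcard
  obtain ⟨t, ht, α, hα⟩ := exists_intertwines h hcard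
  obtain ⟨e'⟩ := (Hol.Brace.nonempty_iso_iff h.isRegular (Param.isRegular ht)).2
    ⟨α, by rw [h.gamma_eq, Param.gamma_eq ht]; exact hα⟩
  exact ⟨t, ht, ⟨e.trans e'⟩⟩

namespace Param

theorem eq_of_iso {t t' : Param p} (ht : t.Valid) (ht' : t'.Valid)
    (h : Hol.IsRegular t.subgroup) (h' : Hol.IsRegular t'.subgroup)
    (hi : Nonempty (Hol.Brace t.subgroup h ≃+* Hol.Brace t'.subgroup h')) : t = t' := by
  obtain ⟨α, hα⟩ := (Hol.Brace.nonempty_iso_iff h h').1 hi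
  rw [gamma_eq ht, gamma_eq ht'] at hα
  exact eq_of_intertwines ht ht' (α := α) hα

theorem card_map_Theta {t : Param p} (ht : t.Valid) :
    Nat.card (t.subgroup.map (Hol.Theta (Heis p))) = p ^ 2 := by
  rw [Hol.Brace.card_map_Theta (isRegular ht), gamma_eq ht, card_range_gam ht]

theorem existsUnique_isHeis {B : Type v} [SkewBrace B]
    (hB : IsBraceOf (Heis p) (Heis p) (p ^ 2) B) :
    ∃! t : Param p, t.IsHeis ∧
      ∃ h : Hol.IsRegular t.subgroup, Nonempty (B ≃+* Hol.Brace t.subgroup h) := by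
  obtain ⟨t, ht, ⟨e⟩⟩ := exists_param hB.2.1 hB.2.2
  refine ⟨t, ⟨(isHeis_or_isElem ht).resolve_right fun hE => ?_, _, ⟨e⟩⟩, ?_⟩
  · obtain ⟨f⟩ := hB.1
    obtain ⟨g⟩ := (isBraceOf_elemAb3 hE (isRegular ht)).1
    exact not_mulEquiv_elemAb3.false (f.symm.trans ((e : B ≃* _).trans g))
  · rintro t' ⟨ht', h', ⟨e'⟩⟩
    exact eq_of_iso ht'.valid ht _ _ ⟨e'.symm.trans e⟩

theorem existsUnique_isElem {B : Type v} [SkewBrace B]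
    (hB : IsBraceOf (ElemAb3 p) (Heis p) (p ^ 2) B) :
    ∃! t : Param p, t.IsElem ∧
      ∃ h : Hol.IsRegular t.subgroup, Nonempty (B ≃+* Hol.Brace t.subgroup h) := by
  obtain ⟨t, ht, ⟨e⟩⟩ := exists_param hB.2.1 hB.2.2
  refine ⟨t, ⟨(isHeis_or_isElem ht).resolve_left fun hE => ?_, _, ⟨e⟩⟩, ?_⟩
  · obtain ⟨f⟩ := hB.1
    obtain ⟨g⟩ := (isBraceOf_heis hE (isRegular ht)).1
    exact not_mulEquiv_elemAb3.false ((g.symm.trans (e.symm : _ ≃* B)).trans f)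
  · rintro t' ⟨ht', h', ⟨e'⟩⟩
    exact eq_of_iso ht'.valid ht _ _ ⟨e'.symm.trans e⟩

theorem exists_isRegular_heis (t : Param p) (ht : t.IsHeis) : ∃ h : Hol.IsRegular t.subgroup,
    Nat.card (t.subgroup.map (Hol.Theta (Heis p))) = p ^ 2 ∧ Nonempty (t.subgroup ≃* Heis p) ∧
      IsBraceOf (Heis p) (Heis p) (p ^ 2) (Hol.Brace t.subgroup h) :=
  ⟨isRegular ht.valid, card_map_Theta ht.valid,
    (isBraceOf_heis ht (isRegular ht.valid)).1.map (Hol.Brace.mulEquiv _).trans,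
    isBraceOf_heis ht _⟩

theorem exists_isRegular_elemAb3 (t : Param p) (ht : t.IsElem) : ∃ h : Hol.IsRegular t.subgroup,
    Nat.card (t.subgroup.map (Hol.Theta (Heis p))) = p ^ 2 ∧ Nonempty (t.subgroup ≃* ElemAb3 p) ∧
      IsBraceOf (ElemAb3 p) (Heis p) (p ^ 2) (Hol.Brace t.subgroup h) :=
  ⟨isRegular ht.valid, card_map_Theta ht.valid,
    (isBraceOf_elemAb3 ht (isRegular ht.valid)).1.map (Hol.Brace.mulEquiv _).trans,
    isBraceOf_elemAb3 ht _⟩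

/-- The number of isomorphism classes is the number of parameters, if the parameters satisfying `P`
classify the skew braces in question. -/
theorem numClasses_eq {G : Type w} [Group G] (P : Param p → Prop) (hP : ∀ t, P t → t.Valid)
    (hG : ∀ t, P t → ∀ h : Hol.IsRegular t.subgroup,
      IsBraceOf G (Heis p) (p ^ 2) (Hol.Brace t.subgroup h))
    (hE : ∀ (B : Type u) [SkewBrace B], IsBraceOf G (Heis p) (p ^ 2) B → ∃! t : Param p, P t ∧
      ∃ h : Hol.IsRegular t.subgroup, Nonempty (B ≃+* Hol.Brace t.subgroup h)) :
    numClasses.{u} G (Heis p) (p ^ 2) = Nat.card {t // P t} := by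
  -- The listed braces live in the lowest universe, while the classes are counted in universe `u`.
  let F : {t // P t} → Bundled.{u} := fun t =>
    ⟨ULift.{u} (Hol.Brace t.1.subgroup (isRegular (hP t.1 t.2)))⟩
  have hF : ∀ t, IsBraceOf G (Heis p) (p ^ 2) (F t).carrier := fun t =>
    (hG t.1 t.2 _).congr (uliftEquiv _).symm
  symm
  refine Nat.card_eq_of_bijective (fun t => ⟨Quotient.mk isoSetoid (F t), F t, rfl, hF t⟩)
    ⟨fun t t' h => ?_, ?_⟩
  · obtain ⟨e⟩ := Quotient.exact (congrArg Subtype.val h)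
    exact Subtype.ext (eq_of_iso (hP _ t.2) (hP _ t'.2) _ _
      ⟨(uliftEquiv _).symm.trans (e.trans (uliftEquiv _))⟩)
  · rintro ⟨_, B, rfl, hB⟩
    obtain ⟨t, ⟨ht, h, ⟨e⟩⟩, -⟩ := hE B.carrier hB
    exact ⟨⟨t, ht⟩, Subtype.ext (Quotient.sound ⟨(uliftEquiv _).trans e.symm⟩)⟩

/-- The parameters as a sum type. -/
def equivSum : Param p ≃ (ZMod p × ZMod p) ⊕ ZMod p ⊕ (ZMod p × ZMod p) where
  toFun
    | .A u₂ u₃ => .inl (u₂, u₃)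
    | .B v₂ => .inr (.inl v₂)
    | .C x₃ a => .inr (.inr (x₃, a))
  invFun
    | .inl t => .A t.1 t.2
    | .inr (.inl v) => .B v
    | .inr (.inr t) => .C t.1 t.2
  left_inv t := by cases t <;> rfl
  right_inv t := by rcases t with _ | _ | _ <;> rfl

noncomputable instance : Fintype (Param p) := Fintype.ofEquiv _ equivSum.symm

theorem sum_eq {M : Type*} [AddCommMonoid M] (f : Param p → M) :
    ∑ t, f t = ∑ u₃, ∑ u₂, f (.A u₂ u₃) + (∑ v, f (.B v) + ∑ x₃, ∑ a, f (.C x₃ a)) := by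
  rw [← equivSum.symm.sum_comp, Fintype.sum_sum_type, Fintype.sum_sum_type, Fintype.sum_prod_type,
    Fintype.sum_prod_type, Finset.sum_comm]
  rfl

end Param

end Heis

/-! ### Counting parameters and summing the indices |Aut M₁| / |Aut B| -/

namespace Heis

variable {p : ℕ} [Fact p.Prime] [Fact (3 < p)]

namespace Param

theorem card_compl_zero : ((({0}ᶜ : Finset (ZMod p)).card : ℕ) : ℤ) = p - 1 := by
  rw [Finset.card_compl, ZMod.card, Finset.card_singleton, Nat.cast_sub (NeZero.one_le),
    Nat.cast_one]

open Classical in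
theorem sum_subtype_eq (P : Param p → Prop) (f : Param p → ℤ) :
    ∑ t : {t : Param p // P t}, f t = ∑ t, if P t then f t else 0 := by
  rw [← Finset.sum_filter]
  exact (Finset.sum_subtype _ (fun t => by rw [Finset.mem_filter]; simp) f).symm

open Classical in
/-- Sums over the parameters of the `M₁`-skew braces. -/
theorem sum_isHeis (f : Param p → ℤ) (b c : ℤ) (hb : ∀ v, v ≠ 0 → f (.B v) = b)
    (hc : ∀ x a, x ≠ 0 → f (.C x a) = c) : ∑ t : {t : Param p // t.IsHeis}, f t =
    (∑ u₃ ∈ {0}ᶜ, ∑ u₂, f (.A u₂ u₃) - ∑ u ∈ {0}ᶜ, f (.A u u)) + (p - 2) * b +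
      (p - 1) ^ 2 * c := by
  have hB : ((({0, 2}ᶜ : Finset (ZMod p)).card : ℕ) : ℤ) = p - 2 := by
    have : 3 < p := Fact.out
    rw [Finset.card_compl, ZMod.card, Finset.card_pair two_ne_zero'.symm,
      Nat.cast_sub (by omega), Nat.cast_ofNat]
  have hC : ∀ x : ZMod p, ((({x}ᶜ : Finset (ZMod p)).card : ℕ) : ℤ) = p - 1 := fun x => by
    rw [← card_compl_zero, Finset.card_compl, Finset.card_compl, Finset.card_singleton,
      Finset.card_singleton]
  rw [sum_subtype_eq, sum_eq, add_assoc, ← Finset.sum_sub_distrib]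
  congr 1
  · rw [← Finset.sum_subset (Finset.subset_univ ({0}ᶜ : Finset (ZMod p)))]
    · refine Finset.sum_congr rfl fun u₃ hu => ?_
      rw [← Finset.sum_compl_add_sum {u₃}, ← Finset.sum_compl_add_sum {u₃}, Finset.sum_singleton,
        Finset.sum_singleton, add_sub_cancel_right, if_neg (by simp [IsHeis]), add_zero]
      refine Finset.sum_congr rfl fun u₂ hu₂ => if_pos ⟨by simpa using hu, by simpa using hu₂⟩
    · intro u₃ _ hu
      refine Finset.sum_eq_zero fun u₂ _ => if_neg ?_
      simp only [Finset.mem_compl, Finset.mem_singleton, not_not] at hu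
      simp [IsHeis, hu]
  congr 1
  · rw [← hB, ← nsmul_eq_mul, ← Finset.sum_const, ← Finset.sum_filter]
    refine Finset.sum_congr ?_ fun v hv => hb v ?_
    · ext v; rw [Finset.mem_filter]; simp [IsHeis]
    · exact fun h => by simp [h] at hv
  · have : ∀ x₃ ∈ ({0}ᶜ : Finset (ZMod p)),
        ∑ a, (if (C x₃ a).IsHeis then f (C x₃ a) else 0) = (p - 1) * c := by
      intro x₃ hx
      have hx : x₃ ≠ 0 := by simpa using hx
      -- For each nonzero x₃ exactly one value of a is excluded, namely (1 + x₃)/x₃.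
      rw [← hC ((1 + x₃) / x₃), ← nsmul_eq_mul, ← Finset.sum_const, ← Finset.sum_filter]
      refine Finset.sum_congr ?_ fun a _ => hc x₃ a hx
      ext a; simp [IsHeis, hx, eq_div_iff hx]
    rw [← Finset.sum_subset (Finset.subset_univ ({0}ᶜ : Finset (ZMod p))), Finset.sum_congr rfl this,
      Finset.sum_const, nsmul_eq_mul, hC]
    · ring
    · intro x₃ _ hx
      refine Finset.sum_eq_zero fun u₂ _ => if_neg ?_
      simp only [Finset.mem_compl, Finset.mem_singleton, not_not] at hx
      simp [IsHeis, hx]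

open Classical in
/-- Sums over the parameters of the `C_p³`-skew braces. -/
theorem sum_isElem (f : Param p → ℤ) (b c : ℤ) (hb : ∀ v, v ≠ 0 → f (.B v) = b)
    (hc : ∀ x a, x ≠ 0 → f (.C x a) = c) : ∑ t : {t : Param p // t.IsElem}, f t =
    ∑ u ∈ {0}ᶜ, f (.A u u) + b + (p - 1) * c := by
  rw [sum_subtype_eq, sum_eq, add_assoc]
  congr 1
  · rw [← Finset.sum_subset (Finset.subset_univ ({0}ᶜ : Finset (ZMod p)))]
    · refine Finset.sum_congr rfl fun u₃ hu => ?_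
      rw [Finset.sum_eq_single u₃ (fun u₂ _ h => if_neg (by simp [IsElem, h])) (by simp)]
      exact if_pos ⟨by simpa using hu, rfl⟩
    · intro u₃ _ hu
      refine Finset.sum_eq_zero fun u₂ _ => if_neg ?_
      simp only [Finset.mem_compl, Finset.mem_singleton, not_not] at hu
      simp [IsElem, hu]
  congr 1
  · rw [Finset.sum_eq_single 2 (fun v _ h => if_neg (by simp [IsElem, h])) (by simp), if_pos (show IsElem (.B (2 : ZMod p)) from rfl),
      hb _ two_ne_zero']
  · rw [← card_compl_zero, ← nsmul_eq_mul, ← Finset.sum_const,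
      ← Finset.sum_subset (Finset.subset_univ ({0}ᶜ : Finset (ZMod p)))]
    · refine Finset.sum_congr rfl fun x₃ hx => ?_
      have hx : x₃ ≠ 0 := by simpa using hx
      rw [Finset.sum_eq_single ((1 + x₃) / x₃) (fun v _ h => if_neg ?_) (by simp), if_pos ?_,
        hc _ _ hx]
      · exact ⟨hx, div_mul_cancel₀ _ hx⟩
      · rintro ⟨-, h'⟩
        exact h (eq_div_of_mul_eq hx h')
    · intro x₃ _ hx
      refine Finset.sum_eq_zero fun u₂ _ => if_neg ?_
      simp only [Finset.mem_compl, Finset.mem_singleton, not_not] at hx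
      simp [IsElem, hx]

variable (p) in
theorem card_isHeis : (Nat.card {t : Param p // t.IsHeis} : ℤ) = (2 * p - 3) * p := by
  classical
  have := sum_isHeis (p := p) (fun _ => 1) 1 1 (fun _ _ => rfl) (fun _ _ _ => rfl)
  simp only [Finset.sum_const, nsmul_eq_mul, mul_one, Finset.card_univ, card_compl_zero,
    ZMod.card] at this
  rw [Nat.card_eq_fintype_card, this]
  ring

variable (p) in
theorem card_isElem : (Nat.card {t : Param p // t.IsElem} : ℤ) = 2 * p - 1 := by
  classical
  have := sum_isElem (p := p) (fun _ => 1) 1 1 (fun _ _ => rfl) (fun _ _ _ => rfl)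
  simp only [Finset.sum_const, nsmul_eq_mul, mul_one, Finset.card_univ, card_compl_zero] at this
  rw [Nat.card_eq_fintype_card, this]
  ring

/-- The index of the automorphism group of the skew brace in `Aut(M₁)`. -/
noncomputable def weight : Param p → ℤ
  | .A u₂ u₃ => p ^ 2 + p * quadraticChar (ZMod p) (u₂ ^ 2 - 4 * u₃) -
      if u₂ ^ 2 - 4 * u₃ = 0 then 1 else 0
  | .B _ => 1
  | .C _ _ => (p ^ 2 - 1) * p

theorem four_ne_zero' : (4 : ZMod p) ≠ 0 := by
  rw [show (4 : ZMod p) = 2 * 2 by norm_num]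
  exact mul_ne_zero two_ne_zero' two_ne_zero'

theorem sum_quadraticChar_sub (d : ZMod p) :
    ∑ u : ZMod p, quadraticChar (ZMod p) (d - 4 * u) = 0 := by
  have h : ringChar (ZMod p) ≠ 2 := by
    have : 3 < p := Fact.out
    rw [ZMod.ringChar_zmod_n]; omega
  rw [← quadraticChar_sum_zero h]
  exact ((Equiv.mulLeft₀ (4 : ZMod p) four_ne_zero').trans (Equiv.subLeft d)).sum_comp
    (fun u => quadraticChar (ZMod p) u)

variable (p) in
theorem sum_weight_A : ∑ u₃ ∈ {0}ᶜ, ∑ u₂ : ZMod p, weight (.A u₂ u₃) =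
    (p - 1 : ℤ) * (p ^ 3 - p - 1) := by
  have h4 := four_ne_zero' (p := p)
  -- Over all u₃ the sum is zero, the discriminant being affine in u₃. The omitted term u₃ = 0 has
  -- discriminant u₂² and contributes p - 1.
  have hχ : ∑ u₃ ∈ {0}ᶜ, ∑ u₂ : ZMod p, quadraticChar (ZMod p) (u₂ ^ 2 - 4 * u₃) = 1 - p := by
    have h0 : ∑ u₃ : ZMod p, ∑ u₂ : ZMod p, quadraticChar (ZMod p) (u₂ ^ 2 - 4 * u₃) = 0 := by
      rw [Finset.sum_comm]
      exact Finset.sum_eq_zero fun u₂ _ => sum_quadraticChar_sub _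
    rw [← Finset.sum_compl_add_sum {0}, Finset.sum_singleton] at h0
    have h1 : ∑ u₂ : ZMod p, quadraticChar (ZMod p) (u₂ ^ 2 - 4 * 0) = p - 1 := by
      rw [← Finset.sum_compl_add_sum {0}, Finset.sum_singleton, ← card_compl_zero]
      simp only [mul_zero, sub_zero, ne_eq, OfNat.ofNat_ne_zero, not_false_eq_true, zero_pow,
        MulChar.map_zero, add_zero]
      rw [Finset.sum_congr rfl fun u hu => quadraticChar_sq_one' (by simpa using hu)]
      simp
    linarith
  -- Each nonzero u₂ has exactly one partner u₃ = u₂²/4, and u₂ = 0 has none that is nonzero.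
  have hD : ∑ u₃ ∈ {0}ᶜ, ∑ u₂ : ZMod p, (if u₂ ^ 2 - 4 * u₃ = 0 then 1 else 0 : ℤ) = p - 1 := by
    rw [Finset.sum_comm, ← card_compl_zero, ← Finset.sum_compl_add_sum {0}, Finset.sum_singleton,
      Finset.card_eq_sum_ones, Nat.cast_sum, Finset.sum_eq_zero (s := {0}ᶜ) (f := fun u₃ =>
        if (0 : ZMod p) ^ 2 - 4 * u₃ = 0 then (1 : ℤ) else 0), add_zero]
    · refine Finset.sum_congr rfl fun u₂ hu => ?_
      have hu : u₂ ≠ 0 := by simpa using hu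
      rw [Finset.sum_eq_single (u₂ ^ 2 / 4)]
      · rw [if_pos (by rw [mul_div_cancel₀ _ h4, sub_self]), Nat.cast_one]
      · intro u _ h
        refine if_neg fun h' => h ?_
        rw [eq_div_iff h4, mul_comm, sub_eq_zero.1 h']
      · intro h
        simp [hu, h4] at h
    · intro u hu
      have hu : u ≠ 0 := by simpa using hu
      simp [hu, h4]
  simp only [weight, Finset.sum_sub_distrib, Finset.sum_add_distrib, ← Finset.mul_sum, hχ, hD,
    Finset.sum_const, Finset.card_univ, ZMod.card, nsmul_eq_mul, card_compl_zero]
  ring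

variable (p) in
theorem sum_weight_A_diag : ∑ u ∈ {0}ᶜ, weight (.A u u : Param p) = (p ^ 3 - p ^ 2 - p - 1 : ℤ) := by
  have h4 := four_ne_zero' (p := p)
  -- Since u² - 4u = u²(1 - 4u⁻¹), inversion turns this into the complete linear sum, which is zero,
  -- without its term χ(1) = 1.
  have hχ : ∑ u ∈ {0}ᶜ, quadraticChar (ZMod p) (u ^ 2 - 4 * u) = -1 := by
    have h1 := sum_quadraticChar_sub (p := p) 1
    rw [← Finset.sum_compl_add_sum {0}, Finset.sum_singleton, mul_zero, sub_zero, map_one] at h1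
    rw [eq_neg_of_add_eq_zero_left h1.symm.symm |>.symm]
    refine Finset.sum_nbij' (fun u => u⁻¹) (fun u => u⁻¹) ?_ ?_ ?_ ?_ ?_
    · simp
    · simp
    · simp
    · simp
    · intro u hu
      have hu : u ≠ 0 := by simpa using hu
      rw [show u ^ 2 - 4 * u = u ^ 2 * (1 - 4 * u⁻¹) by field_simp, map_mul,
        quadraticChar_sq_one' hu, one_mul]
  have hD : ∑ u ∈ ({0}ᶜ : Finset (ZMod p)), (if u ^ 2 - 4 * u = 0 then 1 else 0 : ℤ) = 1 := by
    rw [Finset.sum_eq_single (4 : ZMod p)]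
    · exact if_pos (by ring)
    · intro u hu h
      have hu : u ≠ 0 := by simpa using hu
      refine if_neg fun h' => h (mul_left_cancel₀ hu ?_)
      linear_combination h'
    · intro h
      simp [h4] at h
  simp only [weight, Finset.sum_sub_distrib, Finset.sum_add_distrib, ← Finset.mul_sum, hχ, hD,
    Finset.sum_const, nsmul_eq_mul, card_compl_zero]
  ring

open Classical in
variable (p) in
theorem sum_weight_isHeis : ∑ t : {t : Param p // t.IsHeis}, t.1.weight =
    (p ^ 4 - p ^ 3 - 2 * p ^ 2 + 2 * p + 1 : ℤ) * p := by
  rw [sum_isHeis weight 1 ((p ^ 2 - 1) * p) (fun _ _ => rfl) (fun _ _ _ => rfl), sum_weight_A,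
    sum_weight_A_diag]
  ring

open Classical in
variable (p) in
theorem sum_weight_isElem : ∑ t : {t : Param p // t.IsElem}, t.1.weight =
    (p ^ 2 - 2 : ℤ) * p ^ 2 := by
  rw [sum_isElem weight 1 ((p ^ 2 - 1) * p) (fun _ _ => rfl) (fun _ _ _ => rfl), sum_weight_A_diag]
  ring

end Param

end Heis

/-! ### Automorphism groups of the braces and their orders -/

namespace Heis

variable {p : ℕ} [Fact p.Prime] [Fact (3 < p)]

/-- The number of matrices commuting with a given companion matrix, in terms of the discriminant. -/
theorem card_norm_ne_zero (u₂ u₃ : ZMod p) :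
    (Nat.card {b : ZMod p × ZMod p // b.1 * (b.1 + b.2 * u₂) - b.2 * (-b.2 * u₃) ≠ 0} : ℤ) =
      (p - 1) * (p - quadraticChar (ZMod p) (u₂ ^ 2 - 4 * u₃)) := by
  have h2 := two_ne_zero' (p := p)
  have h4 := Param.four_ne_zero' (p := p)
  have hp : ringChar (ZMod p) ≠ 2 := by
    have : 3 < p := Fact.out
    rw [ZMod.ringChar_zmod_n]; omega
  set D := u₂ ^ 2 - 4 * u₃ with hD
  -- Completing the square: four times the determinant is (2b₁ + b₂u₂)² - D b₂², so the admissible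
  -- b₁ correspond to the square roots of D b₂².
  have hrow : ∀ b₂ : ZMod p, ∑ b₁ : ZMod p,
      (if b₁ * (b₁ + b₂ * u₂) - b₂ * (-b₂ * u₃) = 0 then 1 else 0 : ℤ) =
        quadraticChar (ZMod p) (D * b₂ ^ 2) + 1 := by
    intro b₂
    rw [← quadraticChar_card_sqrts hp, Fintype.sum_equiv ((Equiv.mulLeft₀ (2 : ZMod p) h2).trans
      (Equiv.addRight (b₂ * u₂))) _ (fun s => if s ^ 2 = D * b₂ ^ 2 then (1 : ℤ) else 0)]
    · rw [← Finset.sum_filter, Finset.sum_const, nsmul_eq_mul, mul_one]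
      congr 2
      ext s; simp
    · intro b₁
      change (if _ then (1 : ℤ) else 0) = if (2 * b₁ + b₂ * u₂) ^ 2 = D * b₂ ^ 2 then 1 else 0
      refine if_congr ⟨fun h => ?_, fun h => mul_left_cancel₀ h4 ?_⟩ rfl rfl
      · linear_combination 4 * h
      · linear_combination h
  have hz : ((Finset.univ.filter fun b : ZMod p × ZMod p =>
      b.1 * (b.1 + b.2 * u₂) - b.2 * (-b.2 * u₃) = 0).card : ℤ) =
        p + (p - 1) * quadraticChar (ZMod p) D := by
    rw [Finset.card_filter, Nat.cast_sum, Fintype.sum_prod_type, Finset.sum_comm]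
    simp only [Nat.cast_ite, Nat.cast_one, Nat.cast_zero, hrow, map_mul, Finset.sum_add_distrib,
      ← Finset.mul_sum, Finset.sum_const, Finset.card_univ, ZMod.card, nsmul_eq_mul, mul_one]
    have : ∑ b : ZMod p, quadraticChar (ZMod p) (b ^ 2) = p - 1 := by
      rw [← Finset.sum_compl_add_sum {0}, Finset.sum_singleton, ← Param.card_compl_zero,
        Finset.sum_congr rfl fun u hu => quadraticChar_sq_one' (by simpa using hu)]
      simp
    rw [this]
    ring
  have htot := Finset.card_filter_add_card_filter_not (s := (Finset.univ : Finset (ZMod p × ZMod p)))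
    (fun b => b.1 * (b.1 + b.2 * u₂) - b.2 * (-b.2 * u₃) = 0)
  rw [Finset.card_univ, Fintype.card_prod, ZMod.card] at htot
  have htot' := congrArg (Nat.cast : ℕ → ℤ) htot
  push_cast at htot'
  rw [hz] at htot'
  rw [Nat.card_eq_fintype_card, Fintype.card_subtype]
  linear_combination htot'

namespace Param

/-- The automorphisms of the skew brace with given parameters. -/
noncomputable def ringAutEquiv {t : Param p} (ht : t.Valid) (h : Hol.IsRegular t.subgroup) :
    RingAut (Hol.Brace t.subgroup h) ≃ {α : MulAut (Heis p) // Intertwines t.gam t.gam α} :=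
  (Hol.Brace.isoEquiv h h).trans (Equiv.subtypeEquivRight fun α => by
    rw [gamma_eq ht]; exact Iff.rfl)

theorem isBraceAut_iff {t : Param p} (ht : t.Valid) (h : Hol.IsRegular t.subgroup)
    (α : MulAut (Heis p)) : IsBraceAut h α ↔ Intertwines t.gam t.gam α := by
  constructor
  · rintro ⟨φ, hφ⟩
    have : α = (ringAutEquiv ht h φ).1 := MulEquiv.ext fun n => (hφ n).symm
    rw [this]
    exact (ringAutEquiv ht h φ).2
  · intro hα
    exact ⟨(ringAutEquiv ht h).symm ⟨α, hα⟩, fun x => rfl⟩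

theorem isBraceAut_A_iff {u₂ u₃ : ZMod p} (hu : u₃ ≠ 0)
    (h : Hol.IsRegular (Param.A u₂ u₃).subgroup) (α : MulAut (Heis p)) : IsBraceAut h α ↔
      ∃ (r₁ r₃ : ℕ) (b₁ b₂ : ZMod p) (β : GL (Fin 2) (ZMod p)),
        (β : Matrix (Fin 2) (Fin 2) (ZMod p)) = !![b₁, b₂; -b₂ * u₃, b₁ + b₂ * u₂] ∧
        α = alpha1 p ^ r₁ * alpha3 p ^ r₃ * autGL β := by
  rw [isBraceAut_iff (t := .A u₂ u₃) hu]
  constructor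
  · intro hα
    obtain ⟨r₁, r₃, β, rfl⟩ := exists_eq_aut α
    obtain ⟨-, h1, h2⟩ := (intertwines_A_iff hu hu r₁ r₃ β).1 hα
    obtain ⟨r₁, rfl⟩ := ZMod.natCast_zmod_surjective r₁
    obtain ⟨r₃, rfl⟩ := ZMod.natCast_zmod_surjective r₃
    refine ⟨r₁, r₃, β.1 0 0, β.1 0 1, β, ?_, aut_natCast r₁ r₃ β⟩
    rw [← h1, ← h2]
    exact Matrix.eta_fin_two β.1
  · rintro ⟨r₁, r₃, b₁, b₂, β, hβ, rfl⟩
    rw [← aut_natCast, intertwines_A_iff hu hu, hβ]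
    exact ⟨⟨rfl, rfl⟩, rfl, rfl⟩

theorem isBraceAut_C_iff {x₃ a : ZMod p} (hx : x₃ ≠ 0)
    (h : Hol.IsRegular (Param.C x₃ a).subgroup) (α : MulAut (Heis p)) : IsBraceAut h α ↔
      ∃ (r₁ r₃ : ℕ) (b₁ b₃ : ZMod p) (β : GL (Fin 2) (ZMod p)),
        (β : Matrix (Fin 2) (Fin 2) (ZMod p)) = !![b₁, 0; b₃, b₁ ^ 2] ∧
        (r₃ : ZMod p) = (a + x₃⁻¹) * b₁⁻¹ * b₃ + (b₁ - 1) * (1 + a - x₃⁻¹) / 2 ∧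
        α = alpha1 p ^ r₁ * alpha3 p ^ r₃ * autGL β := by
  rw [isBraceAut_iff (t := .C x₃ a) hx]
  constructor
  · intro hα
    obtain ⟨r₁, r₃, β, rfl⟩ := exists_eq_aut α
    obtain ⟨-, h1, h2, h3⟩ := (intertwines_C_iff r₁ r₃ β).1 hα
    obtain ⟨r₁, rfl⟩ := ZMod.natCast_zmod_surjective r₁
    obtain ⟨r₃, rfl⟩ := ZMod.natCast_zmod_surjective r₃
    refine ⟨r₁, r₃, β.1 0 0, β.1 1 0, β, ?_, h3, aut_natCast r₁ r₃ β⟩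
    rw [← h2, ← h1]
    exact Matrix.eta_fin_two β.1
  · rintro ⟨r₁, r₃, b₁, b₂, β, hβ, hr, rfl⟩
    rw [← aut_natCast, intertwines_C_iff, hβ]
    exact ⟨⟨rfl, rfl⟩, rfl, rfl, hr⟩

theorem isBraceAut_B {v₂ : ZMod p} (hv : v₂ ≠ 0)
    (h : Hol.IsRegular (Param.B v₂).subgroup) (α : MulAut (Heis p)) : IsBraceAut h α ∧
      ∃ (r₁ r₃ : ℕ) (β : GL (Fin 2) (ZMod p)),
        α = alpha1 p ^ r₁ * alpha3 p ^ r₃ * autGL β := by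
  refine ⟨(isBraceAut_iff (t := .B v₂) hv h α).2 (intertwines_B hv α), ?_⟩
  obtain ⟨r₁, r₃, β, rfl⟩ := exists_eq_aut α
  obtain ⟨r₁, rfl⟩ := ZMod.natCast_zmod_surjective r₁
  obtain ⟨r₃, rfl⟩ := ZMod.natCast_zmod_surjective r₃
  exact ⟨r₁, r₃, β, aut_natCast r₁ r₃ β⟩

variable (p) in
theorem card_mulAut_int : (Nat.card (MulAut (Heis p)) : ℤ) = (p ^ 2 - 1) * (p ^ 2 - p) * p ^ 2 := by
  have h1 : 1 ≤ p := NeZero.one_le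
  rw [card_mulAut, Nat.cast_mul, Nat.cast_mul, Nat.cast_sub (Nat.one_le_pow _ _ h1),
    Nat.cast_sub (Nat.le_self_pow two_ne_zero p)]
  push_cast
  ring

/-- The parameters r₁ and r₃ are free. The matrices are the invertible combinations of 1 and the
companion matrix of x² - u₂x + u₃, counted by `card_norm_ne_zero`. -/
theorem card_ringAut_A {u₂ u₃ : ZMod p} (hu : u₃ ≠ 0)
    (h : Hol.IsRegular (Param.A u₂ u₃).subgroup) :
    (Nat.card (RingAut (Hol.Brace (Param.A u₂ u₃).subgroup h)) : ℤ) =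
      p ^ 2 * ((p - 1) * (p - quadraticChar (ZMod p) (u₂ ^ 2 - 4 * u₃))) := by
  let F : ZMod p × ZMod p ×
      {b : ZMod p × ZMod p // b.1 * (b.1 + b.2 * u₂) - b.2 * (-b.2 * u₃) ≠ 0} →
      {α : MulAut (Heis p) // Intertwines (A u₂ u₃).gam (A u₂ u₃).gam α} := fun x =>
    ⟨aut x.1 x.2.1 (mat x.2.2.1.1 x.2.2.1.2 (-x.2.2.1.2 * u₃) (x.2.2.1.1 + x.2.2.1.2 * u₂) x.2.2.2),
      (intertwines_A_iff hu hu _ _ _).2 ⟨⟨rfl, rfl⟩, rfl, rfl⟩⟩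
  have hF : Function.Bijective F := by
    constructor
    · rintro ⟨r₁, r₃, ⟨b₁, b₂⟩, hb⟩ ⟨s₁, s₃, ⟨c₁, c₂⟩, hc⟩ hxy
      obtain ⟨rfl, rfl, hm⟩ := aut_injective (congrArg Subtype.val hxy)
      have hm := congrArg Units.val hm
      have h1 := congrFun (congrFun hm 0) 0
      have h2 := congrFun (congrFun hm 0) 1
      simp only [coe_mat, Matrix.of_apply, Matrix.cons_val', Matrix.cons_val_zero,
        Matrix.cons_val_one] at h1 h2
      subst h1 h2
      rfl
    · rintro ⟨α, hα⟩
      obtain ⟨r₁, r₃, β, rfl⟩ := exists_eq_aut α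
      obtain ⟨-, h1, h2⟩ := (intertwines_A_iff hu hu r₁ r₃ β).1 hα
      have hβ : β.1 =
          !![β.1 0 0, β.1 0 1; -β.1 0 1 * u₃, β.1 0 0 + β.1 0 1 * u₂] := by
        rw [← h1, ← h2]
        exact Matrix.eta_fin_two β.1
      refine ⟨⟨r₁, r₃, ⟨(β.1 0 0, β.1 0 1), ?_⟩⟩,
        Subtype.ext (congrArg (aut r₁ r₃) (Units.ext hβ.symm))⟩
      have := det_ne_zero β
      rwa [h1, h2] at this
  rw [Nat.card_congr (ringAutEquiv (t := .A u₂ u₃) hu h), ← Nat.card_eq_of_bijective F hF,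
    Nat.card_prod, Nat.card_prod, Nat.card_zmod]
  push_cast
  rw [card_norm_ne_zero]
  ring

theorem card_ringAut_B {v₂ : ZMod p} (hv : v₂ ≠ 0) (h : Hol.IsRegular (Param.B v₂).subgroup) :
    (Nat.card (RingAut (Hol.Brace (Param.B v₂).subgroup h)) : ℤ) =
      (p ^ 2 - 1) * (p ^ 2 - p) * p ^ 2 := by
  rw [Nat.card_congr (ringAutEquiv (t := .B v₂) hv h), ← card_mulAut_int]
  exact congrArg _ (Nat.card_congr (Equiv.subtypeUnivEquiv (intertwines_B hv)))

theorem card_ringAut_C {x₃ a : ZMod p} (hx : x₃ ≠ 0)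
    (h : Hol.IsRegular (Param.C x₃ a).subgroup) :
    (Nat.card (RingAut (Hol.Brace (Param.C x₃ a).subgroup h)) : ℤ) = (p - 1) * p ^ 2 := by
  let F : ZMod p × (ZMod p)ˣ × ZMod p →
      {α : MulAut (Heis p) // Intertwines (C x₃ a).gam (C x₃ a).gam α} := fun x =>
    ⟨aut x.1 ((a + x₃⁻¹) * (x.2.1 : ZMod p)⁻¹ * x.2.2 + (x.2.1 - 1) * (1 + a - x₃⁻¹) / 2)
      (mat (x.2.1 : ZMod p) 0 x.2.2 (x.2.1 ^ 2 : ZMod p) (by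
        rw [zero_mul, sub_zero]; exact mul_ne_zero x.2.1.ne_zero (pow_ne_zero 2 x.2.1.ne_zero))),
      (intertwines_C_iff _ _ _).2 ⟨⟨rfl, rfl⟩, rfl, rfl, rfl⟩⟩
  have hF : Function.Bijective F := by
    constructor
    · rintro ⟨r, b₁, b₃⟩ ⟨s, c₁, c₃⟩ hxy
      obtain ⟨rfl, -, hm⟩ := aut_injective (congrArg Subtype.val hxy)
      have hm := congrArg Units.val hm
      have h1 := congrFun (congrFun hm 0) 0
      have h2 := congrFun (congrFun hm 1) 0
      simp only [coe_mat, Matrix.of_apply, Matrix.cons_val', Matrix.cons_val_zero,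
        Matrix.cons_val_one] at h1 h2
      obtain rfl := Units.ext h1
      subst h2
      rfl
    · rintro ⟨α, hα⟩
      obtain ⟨r₁, r₃, β, rfl⟩ := exists_eq_aut α
      obtain ⟨-, h1, h2, h3⟩ := (intertwines_C_iff r₁ r₃ β).1 hα
      have hb : β.1 0 0 ≠ 0 := by
        intro hb
        have := det_ne_zero β
        rw [h1, hb] at this
        simp at this
      refine ⟨⟨r₁, Units.mk0 _ hb, β.1 1 0⟩, Subtype.ext ?_⟩
      have hβ : mat (β.1 0 0) 0 (β.1 1 0) (β.1 0 0 ^ 2) (by simpa using hb) = β := by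
        refine Units.ext ?_
        rw [coe_mat, ← h2, ← h1]
        exact (Matrix.eta_fin_two β.1).symm
      change aut r₁ _ (mat (β.1 0 0) 0 (β.1 1 0) (β.1 0 0 ^ 2) _) = _
      rw [hβ]
      exact congrArg (aut r₁ · β) h3.symm
  rw [Nat.card_congr (ringAutEquiv (t := .C x₃ a) hx h), ← Nat.card_eq_of_bijective F hF,
    Nat.card_prod, Nat.card_prod, Nat.card_zmod, Nat.card_units, Nat.card_zmod, Nat.cast_mul,
    Nat.cast_mul, Nat.cast_sub NeZero.one_le]
  push_cast
  ring

/-- The weight is the index of the automorphism group of the skew brace in `Aut(M₁)`. -/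
theorem weight_mul_card {t : Param p} (ht : t.Valid) (h : Hol.IsRegular t.subgroup) :
    t.weight * Nat.card (RingAut (Hol.Brace t.subgroup h)) = Nat.card (MulAut (Heis p)) := by
  rw [card_mulAut_int]
  cases t with
  | A u₂ u₃ =>
    rw [card_ringAut_A ht h, weight]
    -- The index is (p² - 1)p / (p - χ(D)), that is p² - 1, p² + p or p² - p for χ(D) = 0, 1, -1.
    by_cases hD : u₂ ^ 2 - 4 * u₃ = 0
    · rw [if_pos hD, hD, MulChar.map_zero]
      ring
    · rw [if_neg hD]
      rcases quadraticChar_dichotomy hD with h1 | h1 <;> rw [h1] <;> ring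
  | B v₂ =>
    rw [card_ringAut_B ht h, weight, one_mul]
  | C x₃ a =>
    rw [card_ringAut_C ht h, weight]
    ring

end Param

end Heis

/-! ### From skew braces to regular subgroups normalised by left translations -/

namespace SkewBrace

section Transport

variable {B : Type u} [SkewBrace B] {G : Type v} [Group G]

/-- The additive left translations of a skew brace, transported to a copy of the multiplicative
group. -/
def translation (φ : B ≃* G) : Multiplicative B →* Equiv.Perm G where
  toFun b := (φ.symm.toEquiv.trans (Equiv.addLeft b.toAdd)).trans φ.toEquiv
  map_one' := by ext x; simp
  map_mul' a b := by ext x; simp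

theorem translation_apply (φ : B ≃* G) (b c : B) :
    translation φ (Multiplicative.ofAdd b) (φ c) = φ (b + c) := by
  simp [translation]

theorem translation_one (φ : B ≃* G) (b : B) :
    translation φ (Multiplicative.ofAdd b) 1 = φ b := by
  have := translation_apply φ b 1
  rwa [map_one, one_eq_zero, add_zero] at this

/-- By the brace identity c * (b + c⁻¹ * d) = (c * b - c) + d, so conjugating the additive
translation by b with the multiplicative one by c gives the additive translation by c * b - c. -/
theorem isRegularNormalised_range (φ : B ≃* G) :
    IsRegularNormalised (translation φ).range where
  regular x y := by
    obtain ⟨b, rfl⟩ := φ.surjective x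
    obtain ⟨c, rfl⟩ := φ.surjective y
    refine ⟨translation φ (Multiplicative.ofAdd (c - b)), ⟨⟨_, rfl⟩, ?_⟩, ?_⟩
    · rw [translation_apply, sub_add_cancel]
    · rintro _ ⟨⟨a, rfl⟩, h⟩
      have h' : translation φ (Multiplicative.ofAdd a.toAdd) (φ b) = φ c := h
      rw [translation_apply] at h'
      rw [← φ.injective h', add_sub_cancel_right]
      rfl
  normalised g n hn := by
    obtain ⟨b, rfl⟩ := hn
    obtain ⟨c, rfl⟩ := φ.surjective g
    refine ⟨Multiplicative.ofAdd (c * b.toAdd - c), Equiv.ext fun x => ?_⟩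
    obtain ⟨d, rfl⟩ := φ.surjective x
    have h := translation_apply φ b.toAdd (c⁻¹ * d)
    rw [map_mul, map_inv] at h
    rw [translation_apply, Equiv.Perm.mul_apply, Equiv.Perm.mul_apply, Equiv.inv_mulLeft,
      Equiv.coe_mulLeft, Equiv.coe_mulLeft]
    refine Eq.trans ?_ (congrArg (φ c * ·) h).symm
    rw [← map_mul, brace_property, mul_inv_cancel_left]

theorem range_translation_eq_iff (φ : B ≃* G) {M : Subgroup (Equiv.Perm G)}
    (hM : IsRegularNormalised M) :
    (translation φ).range = M ↔ ∀ b c, φ (b + c) = hM.elt (φ b) (φ c) := by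
  constructor
  · rintro rfl b c
    rw [← hM.eq_elt ⟨Multiplicative.ofAdd b, rfl⟩ (translation_one φ b), translation_apply]
  · intro h
    have he : ∀ b, translation φ (Multiplicative.ofAdd b) = hM.elt (φ b) := fun b =>
      Equiv.ext fun x => by
        obtain ⟨c, rfl⟩ := φ.surjective x
        rw [translation_apply, h]
    ext n
    constructor
    · rintro ⟨b, rfl⟩
      exact (he b.toAdd) ▸ hM.elt_mem _
    · intro hn
      refine ⟨Multiplicative.ofAdd (φ.symm (n 1)), ?_⟩
      rw [he, φ.apply_symm_apply]
      exact (hM.eq_elt hn rfl).symm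

/-- The isomorphisms from a skew brace to the one of a regular subgroup `M`, as those isomorphisms
of the multiplicative groups that carry the additive translations to `M`. -/
noncomputable def fiberEquiv {M : Subgroup (Equiv.Perm G)} (hM : IsRegularNormalised M) :
    {φ : B ≃* G // (translation φ).range = M} ≃ (B ≃+* hM.Brace) where
  toFun φ :=
    { toFun := φ.1
      invFun := φ.1.symm
      left_inv := φ.1.left_inv
      right_inv := φ.1.right_inv
      map_mul' := φ.1.map_mul
      map_add' := (range_translation_eq_iff φ.1 hM).1 φ.2 }
  invFun e := ⟨
    { toFun := e
      invFun := e.symm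
      left_inv := e.left_inv
      right_inv := e.right_inv
      map_mul' := e.map_mul }, (range_translation_eq_iff _ hM).2 e.map_add⟩
  left_inv _ := rfl
  right_inv _ := rfl

/-- The automorphisms of `G` are counted by the regular subgroups whose skew brace is isomorphic
to `B` and by the automorphisms of `B`. -/
theorem card_mul_card_ringAut (φ₀ : B ≃* G) :
    Nat.card {M : Subgroup (Equiv.Perm G) //
      ∃ hM : IsRegularNormalised M, Nonempty (B ≃+* hM.Brace)} * Nat.card (RingAut B) =
      Nat.card (MulAut G) := by
  let X := {M : Subgroup (Equiv.Perm G) //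
      ∃ hM : IsRegularNormalised M, Nonempty (B ≃+* hM.Brace)}
  let F : (B ≃* G) → X := fun φ => ⟨(translation φ).range, isRegularNormalised_range φ,
    ⟨fiberEquiv _ ⟨φ, rfl⟩⟩⟩
  -- The fibre over M consists of the isomorphisms from B to the brace of M, a torsor under the
  -- automorphisms of B.
  have hfib : ∀ M : X, Nonempty ({φ // F φ = M} ≃ RingAut B) := by
    rintro ⟨M, hM, ⟨e⟩⟩
    refine ⟨(Equiv.subtypeEquivRight fun φ => Subtype.ext_iff).trans ((fiberEquiv hM).trans ?_)⟩
    exact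
      { toFun := fun f => f.trans e.symm
        invFun := fun f => RingEquiv.trans f e
        left_inv := fun f => by ext; simp
        right_inv := fun f => by ext; simp }
  have e := (Equiv.sigmaFiberEquiv F).symm.trans
    ((Equiv.sigmaCongrRight fun M => (hfib M).some).trans (Equiv.sigmaEquivProd X (RingAut B)))
  rw [← Nat.card_prod, ← Nat.card_congr e]
  exact Nat.card_congr
    { toFun := fun f => φ₀.symm.trans f
      invFun := fun f => φ₀.trans f
      left_inv := fun f => by ext; simp
      right_inv := fun f => by ext; simp }

end Transport

end SkewBrace

namespace IsRegularNormalised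

variable {G : Type u} [Group G] {M : Subgroup (Equiv.Perm G)} (hM : IsRegularNormalised M)

/-- The additive group of the skew brace of `M` is `M`. -/
noncomputable def addEquiv : hM.Brace ≃+ Additive M where
  toFun a := Additive.ofMul ⟨hM.elt a, hM.elt_mem a⟩
  invFun n := (n.toMul : Equiv.Perm G) 1
  left_inv a := hM.elt_one a
  right_inv n := congrArg Additive.ofMul (Subtype.ext (hM.eq_elt n.toMul.2 rfl).symm)
  map_add' a b := congrArg Additive.ofMul (Subtype.ext (hM.elt_elt a b))

theorem isBraceOf_iff {Γ : Type v} {N : Type w} [Group Γ] [Group N] (r : ℕ) (e : G ≃* Γ) :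
    SkewBrace.IsBraceOf Γ N r hM.Brace ↔
      Nonempty (M ≃* N) ∧ SkewBrace.thetaCard hM.Brace = r := by
  constructor
  · rintro ⟨-, ⟨f⟩, h⟩
    exact ⟨⟨MulEquiv.toAdditive.symm (hM.addEquiv.symm.trans f)⟩, h⟩
  · rintro ⟨⟨f⟩, h⟩
    exact ⟨⟨e⟩, ⟨hM.addEquiv.trans (MulEquiv.toAdditive f)⟩, h⟩

end IsRegularNormalised

/-! ### The number of regular subgroups of each type -/

namespace Heis

open SkewBrace

variable {p : ℕ} [Fact p.Prime] [Fact (3 < p)]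

namespace Param

open Classical in
/-- The number of regular subgroups normalised by left translations, if the parameters satisfying
`P` classify the skew braces in question. -/
theorem card_regular_eq {G : Type u} [Group G] {Γ : Type w} [Group Γ] [Finite Γ]
    (e : Γ ≃* G) (P : Param p → Prop) (hP : ∀ t, P t → t.Valid)
    (hG : ∀ t, P t → ∀ h : Hol.IsRegular t.subgroup,
      IsBraceOf G (Heis p) (p ^ 2) (Hol.Brace t.subgroup h))
    (hE : ∀ (B : Type w) [SkewBrace B], IsBraceOf G (Heis p) (p ^ 2) B → ∃! t : Param p, P t ∧
      ∃ h : Hol.IsRegular t.subgroup, Nonempty (B ≃+* Hol.Brace t.subgroup h))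
    {k : ℤ} (hk : (Nat.card (MulAut Γ) : ℤ) = k * Nat.card (MulAut (Heis p))) :
    (Nat.card {M : Subgroup (Equiv.Perm Γ) // ∃ hM : IsRegularNormalised M,
      Nonempty (M ≃* Heis p) ∧ thetaCard hM.Brace = p ^ 2} : ℤ) =
      k * ∑ t : {t : Param p // P t}, t.1.weight := by
  let X : {t : Param p // P t} → Type w := fun t => {M : Subgroup (Equiv.Perm Γ) //
    ∃ hM : IsRegularNormalised M,
      Nonempty (Hol.Brace t.1.subgroup (isRegular (hP t.1 t.2)) ≃+* hM.Brace)}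
  let F : (Σ t, X t) → {M : Subgroup (Equiv.Perm Γ) // ∃ hM : IsRegularNormalised M,
      Nonempty (M ≃* Heis p) ∧ thetaCard hM.Brace = p ^ 2} := fun x => ⟨x.2.1, by
    obtain ⟨t, M, hM, ⟨f⟩⟩ := x
    exact ⟨hM, (hM.isBraceOf_iff _ e).1 ((hG t.1 t.2 _).congr f)⟩⟩
  have hF : Function.Bijective F := by
    constructor
    · rintro ⟨t, M, hM, ⟨f⟩⟩ ⟨t', M', hM', ⟨f'⟩⟩ h
      obtain rfl : M = M' := congrArg Subtype.val h
      obtain rfl : t = t' := Subtype.ext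
        (eq_of_iso (hP _ t.2) (hP _ t'.2) _ _ ⟨f.trans f'.symm⟩)
      rfl
    · rintro ⟨M, hM, h⟩
      obtain ⟨t, ⟨ht, h', ⟨f⟩⟩, -⟩ := hE hM.Brace ((hM.isBraceOf_iff _ e).2 h)
      exact ⟨⟨⟨t, ht⟩, M, hM, ⟨f.symm⟩⟩, rfl⟩
  -- Both sides times |Aut B| equal |Aut Γ|. The factor |Aut B| is cancelled; it is nonzero because
  -- it divides |Aut M₁|.
  have hX : ∀ t, (Nat.card (X t) : ℤ) = k * t.1.weight := by
    intro t
    obtain ⟨f⟩ := (hG t.1 t.2 (isRegular (hP t.1 t.2))).1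
    have h1 := congrArg (Nat.cast : ℕ → ℤ) (card_mul_card_ringAut (f.trans e.symm))
    have h2 := weight_mul_card (hP t.1 t.2) (isRegular (hP t.1 t.2))
    have h3 : (Nat.card (MulAut (Heis p)) : ℤ) ≠ 0 := by
      have : Finite (MulAut (Heis p)) := Finite.of_equiv _ (autEquiv (p := p))
      exact_mod_cast Nat.card_pos.ne'
    rw [Nat.cast_mul, hk, ← h2, ← mul_assoc] at h1
    refine mul_right_cancel₀ (fun h0 => h3 ?_) h1
    rw [← h2, h0, mul_zero]
  rw [← Nat.card_eq_of_bijective F hF, Nat.card_sigma, Nat.cast_sum, Finset.mul_sum]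
  exact Finset.sum_congr rfl fun t _ => hX t

end Param

-- |GL₃(F_p)| = (p³ - 1) p² |GL₂(F_p)|, and p² |GL₂(F_p)| is the order of Aut(M₁).
variable (p) in
theorem card_mulAut_elemAb3 : (Nat.card (MulAut (ElemAb3 p)) : ℤ) =
    (p ^ 3 - 1) * Nat.card (MulAut (Heis p)) := by
  have h1 : 1 ≤ p := NeZero.one_le
  let e₁ : AddAut (Fin 3 → ZMod p) ≃ MulAut (ElemAb3 p) :=
    AddEquiv.toMultiplicative.trans
      (MulAut.congr (MulEquiv.piMultiplicative (fun _ : Fin 3 => ZMod p))).toEquiv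
  let e₂ : ((Fin 3 → ZMod p) ≃ₗ[ZMod p] (Fin 3 → ZMod p)) ≃ AddAut (Fin 3 → ZMod p) :=
    { toFun := fun f => f.toAddEquiv
      invFun := fun f => f.toLinearEquiv (fun c x => ZMod.map_smul f c x)
      left_inv := fun _ => rfl
      right_inv := fun _ => rfl }
  have hc := Nat.card_congr ((Matrix.GeneralLinearGroup.toLin.toEquiv.trans
    (LinearMap.GeneralLinearGroup.generalLinearEquiv _ _).toEquiv).trans (e₂.trans e₁))
  rw [← hc, Matrix.card_GL_field, Fin.prod_univ_three, Param.card_mulAut_int]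
  simp only [ZMod.card, Fin.val_zero, Fin.val_one, Fin.val_two, pow_zero, pow_one]
  rw [Nat.cast_mul, Nat.cast_mul, Nat.cast_sub (Nat.one_le_pow _ _ h1),
    Nat.cast_sub (Nat.le_self_pow three_ne_zero p),
    Nat.cast_sub (Nat.pow_le_pow_right h1 (by norm_num))]
  push_cast
  ring

end Heis

theorem lemma17 (p : ℕ) [Fact p.Prime] [Fact (3 < p)] :
    -- the number of isomorphism classes of skew braces
    ((SkewBrace.numClasses.{u} (Heis p) (Heis p) (p ^ 2) : ℤ) = (2 * p - 3) * p) ∧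
    ((SkewBrace.numClasses.{u} (ElemAb3 p) (Heis p) (p ^ 2) : ℤ) = 2 * p - 1) ∧
    -- the listed subgroups are regular with image of order `p ^ 2` and have the stated structure
    (∀ t : Heis.Param p, t.IsHeis → ∃ h : Hol.IsRegular t.subgroup,
      Nat.card (t.subgroup.map (Hol.Theta (Heis p))) = p ^ 2 ∧
      Nonempty (t.subgroup ≃* Heis p) ∧
      SkewBrace.IsBraceOf (Heis p) (Heis p) (p ^ 2) (Hol.Brace t.subgroup h)) ∧
    (∀ t : Heis.Param p, t.IsElem → ∃ h : Hol.IsRegular t.subgroup,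
      Nat.card (t.subgroup.map (Hol.Theta (Heis p))) = p ^ 2 ∧
      Nonempty (t.subgroup ≃* ElemAb3 p) ∧
      SkewBrace.IsBraceOf (ElemAb3 p) (Heis p) (p ^ 2) (Hol.Brace t.subgroup h)) ∧
    -- every skew brace in question is isomorphic to exactly one in the list
    (∀ (B : Type v) [SkewBrace B], SkewBrace.IsBraceOf (Heis p) (Heis p) (p ^ 2) B →
      ∃! t : Heis.Param p, t.IsHeis ∧
        ∃ h : Hol.IsRegular t.subgroup, Nonempty (B ≃+* Hol.Brace t.subgroup h)) ∧
    (∀ (B : Type v) [SkewBrace B], SkewBrace.IsBraceOf (ElemAb3 p) (Heis p) (p ^ 2) B →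
      ∃! t : Heis.Param p, t.IsElem ∧
        ∃ h : Hol.IsRegular t.subgroup, Nonempty (B ≃+* Hol.Brace t.subgroup h)) ∧
    -- the automorphism groups, family by family
    (∀ u₂ u₃ : ZMod p, u₃ ≠ 0 → ∃ h : Hol.IsRegular (Heis.Param.A u₂ u₃).subgroup,
      (∀ α : MulAut (Heis p), Heis.IsBraceAut h α ↔
        ∃ (r₁ r₃ : ℕ) (b₁ b₂ : ZMod p) (β : GL (Fin 2) (ZMod p)),
          (β : Matrix (Fin 2) (Fin 2) (ZMod p)) = !![b₁, b₂; -b₂ * u₃, b₁ + b₂ * u₂] ∧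
          α = Heis.alpha1 p ^ r₁ * Heis.alpha3 p ^ r₃ * Heis.autGL β) ∧
      (u₂ ^ 2 - 4 * u₃ = 0 →
        (Nat.card (RingAut (Hol.Brace _ h)) : ℤ) = (p - 1) * p ^ 3) ∧
      (u₂ ^ 2 - 4 * u₃ ≠ 0 → IsSquare (u₂ ^ 2 - 4 * u₃) →
        (Nat.card (RingAut (Hol.Brace _ h)) : ℤ) = (p - 1) ^ 2 * p ^ 2) ∧
      (¬ IsSquare (u₂ ^ 2 - 4 * u₃) →
        (Nat.card (RingAut (Hol.Brace _ h)) : ℤ) = (p ^ 2 - 1) * p ^ 2)) ∧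
    (∀ v₂ : ZMod p, v₂ ≠ 0 → ∃ h : Hol.IsRegular (Heis.Param.B v₂).subgroup,
      (∀ α : MulAut (Heis p), Heis.IsBraceAut h α ∧
        ∃ (r₁ r₃ : ℕ) (β : GL (Fin 2) (ZMod p)),
          α = Heis.alpha1 p ^ r₁ * Heis.alpha3 p ^ r₃ * Heis.autGL β) ∧
      (Nat.card (RingAut (Hol.Brace _ h)) : ℤ) = (p ^ 2 - 1) * (p ^ 2 - p) * p ^ 2) ∧
    (∀ x₃ a : ZMod p, x₃ ≠ 0 → ∃ h : Hol.IsRegular (Heis.Param.C x₃ a).subgroup,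
      (∀ α : MulAut (Heis p), Heis.IsBraceAut h α ↔
        ∃ (r₁ r₃ : ℕ) (b₁ b₃ : ZMod p) (β : GL (Fin 2) (ZMod p)),
          (β : Matrix (Fin 2) (Fin 2) (ZMod p)) = !![b₁, 0; b₃, b₁ ^ 2] ∧
          (r₃ : ZMod p) = (a + x₃⁻¹) * b₁⁻¹ * b₃ + (b₁ - 1) * (1 + a - x₃⁻¹) / 2 ∧
          α = Heis.alpha1 p ^ r₁ * Heis.alpha3 p ^ r₃ * Heis.autGL β) ∧
      (Nat.card (RingAut (Hol.Brace _ h)) : ℤ) = (p - 1) * p ^ 2) ∧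
    -- the number of Hopf-Galois structures
    (∀ (K : Type v) (L : Type w) [Field K] [Field L] [Algebra K L] [FiniteDimensional K L]
      [IsGalois K L], Nonempty ((L ≃ₐ[K] L) ≃* Heis p) →
      (HopfGaloisStructure.number K L (Heis p) (p ^ 2) : ℤ) =
        (p ^ 4 - p ^ 3 - 2 * p ^ 2 + 2 * p + 1) * p) ∧
    (∀ (K : Type v) (L : Type w) [Field K] [Field L] [Algebra K L] [FiniteDimensional K L]
      [IsGalois K L], Nonempty ((L ≃ₐ[K] L) ≃* ElemAb3 p) →
      (HopfGaloisStructure.number K L (Heis p) (p ^ 2) : ℤ) =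
        (p ^ 3 - 1) * (p ^ 2 - 2) * p ^ 2) := by
  refine ⟨?_, ?_, Heis.Param.exists_isRegular_heis, Heis.Param.exists_isRegular_elemAb3,
    fun B _ => Heis.Param.existsUnique_isHeis, fun B _ => Heis.Param.existsUnique_isElem,
    fun u₂ u₃ hu => ⟨Heis.Param.isRegular (t := .A u₂ u₃) hu,
      Heis.Param.isBraceAut_A_iff hu _, ?_, ?_, ?_⟩,
    fun v₂ hv => ⟨Heis.Param.isRegular (t := .B v₂) hv, Heis.Param.isBraceAut_B hv _,
      Heis.Param.card_ringAut_B hv _⟩,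
    fun x₃ a hx => ⟨Heis.Param.isRegular (t := .C x₃ a) hx, Heis.Param.isBraceAut_C_iff hx _,
      Heis.Param.card_ringAut_C hx _⟩, ?_, ?_⟩
  · rw [Heis.Param.numClasses_eq Heis.Param.IsHeis (fun _ => Heis.Param.IsHeis.valid)
      (fun _ => Heis.Param.isBraceOf_heis) (fun _ _ => Heis.Param.existsUnique_isHeis),
      Heis.Param.card_isHeis]
  · rw [Heis.Param.numClasses_eq Heis.Param.IsElem (fun _ => Heis.Param.IsElem.valid)
      (fun _ => Heis.Param.isBraceOf_elemAb3) (fun _ _ => Heis.Param.existsUnique_isElem),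
      Heis.Param.card_isElem]
  · intro hD
    rw [Heis.Param.card_ringAut_A hu, hD, MulChar.map_zero]
    ring
  · intro hD hs
    rw [Heis.Param.card_ringAut_A hu, (quadraticChar_one_iff_isSquare hD).2 hs]
    ring
  · intro hs
    rw [Heis.Param.card_ringAut_A hu, quadraticChar_neg_one_iff_not_isSquare.2 hs]
    ring
  · rintro K L _ _ _ _ _ ⟨e⟩
    rw [HopfGaloisStructure.number_eq, Heis.Param.card_regular_eq e Heis.Param.IsHeis
      (fun _ => Heis.Param.IsHeis.valid) (fun _ => Heis.Param.isBraceOf_heis)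
      (fun _ _ => Heis.Param.existsUnique_isHeis) (k := 1), Heis.Param.sum_weight_isHeis, one_mul]
    rw [one_mul, Nat.card_congr (MulAut.congr e).toEquiv]
  · rintro K L _ _ _ _ _ ⟨e⟩
    rw [HopfGaloisStructure.number_eq, Heis.Param.card_regular_eq e Heis.Param.IsElem
      (fun _ => Heis.Param.IsElem.valid) (fun _ => Heis.Param.isBraceOf_elemAb3)
      (fun _ _ => Heis.Param.existsUnique_isElem) (k := p ^ 3 - 1), Heis.Param.sum_weight_isElem]
    · ring
    · rw [Nat.card_congr (MulAut.congr e).toEquiv, Heis.card_mulAut_elemAb3]
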